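/- **Notation.** For $z\in\mathbb C$, $n\in\mathbb N_0$ let $(z)_n=z(z+1)\cdots(z+n-1)$. The Gegenbauer polynomials are $C_n^\mu(x)=\frac{(2\mu)_n}{n!}\,{}_2F_1\big(-n,2\mu+n;\mu+\tfrac12;\tfrac{1-x}2\big)$. For $x\in(-1,1)$ the Ferrers functions of the first and second kind are $$\mathsf P_\nu^\mu(x)=\Big(\frac{1+x}{1-x}\Big)^{\mu/2}\frac{1}{\Gamma(1-\mu)}\,{}_2F_1\Big(-\nu,\nu+1;1-\mu;\frac{1-x}2\Big),$$ where $\frac1{\Gamma(c)}{}_2F_1(a,b;c;z)$ is understood as the regularized hypergeometric function, entire in $c$, and $$\mathsf Q_\nu^\mu(x)=\sqrt\pi\,2^\mu\frac{\Gamma(\frac{\nu+\mu+2}2)}{\Gamma(\frac{\nu-\mu+1}2)}\frac{x\cos[\frac\pi2(\nu+\mu)]}{(1-x^2)^{\mu/2}}\,{}_2F_1\Big(\frac{1-\nu-\mu}2,\frac{\nu-\mu+2}2;\frac32;x^2\Big)-\sqrt\pi\,2^{\mu-1}\frac{\Gamma(\frac{\nu+\mu+1}2)}{\Gamma(\frac{\nu-\mu+2}2)}\frac{\sin[\frac\pi2(\nu+\mu)]}{(1-x^2)^{\mu/2}}\,{}_2F_1\Big(\frac{-\nu-\mu}2,\frac{\nu-\mu+1}2;\frac12;x^2\Big).$$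 The function $\mathsf Q_\nu^\mu$ is defined if $\nu+\mu\notin\{-1,-2,\dots\}$, and also in the anomalous cases $\nu\in\{-\frac32,-\frac52,\dots\}$, $\nu+\mu,\nu-\mu\in\{-1,-2,\dots\}$, where the formula is taken as its limit with respect to the order $\mu$ at fixed $\nu$. Powers of positive real numbers are principal. For $\theta,\theta'\in\mathbb R$ put $\theta_<=\min\{\theta,\theta'\}$ and $\theta_>=\max\{\theta,\theta'\}$. **Theorem.** Let $\mu\in\mathbb C$ with $\Re\mu>-\tfrac12$, $\mu\ne0$; let $\nu\in\mathbb C\setminus\{-1,-2,\dots\}$, $\gamma\in\mathbb R$, and $\theta,\theta'\in(0,\pi)$ with $\tan(\tfrac12\theta_<)\tan(\tfrac12\theta_>)<1$. Let $\Theta\in[0,\pi]$ be given by $\cos\Theta=\cos\theta\cos\theta'+\sin\theta\sin\theta'\cos\gamma$, and put $K=\dfrac{2^\mu\Gamma(\mu)}{(\sin\theta\sin\theta')^\mu}$. Then the following hold, each series being absolutely convergent; in (2), (4) and (6) it is assumed that all the functions $\mathsf Q$ that occur are defined; in all but (3) it is assumed that $\theta\ne\theta'$, and in (3) that $\Theta\ne0$.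 $$\begin{aligned} (1)\quad&\frac{\mathsf P_\nu^{\mu}(\cos\Theta)}{\sin^\mu\Theta}=K\sum_{n=0}^\infty(-1)^n(n+\mu)\,\mathsf P_\nu^{-(\mu+n)}(\cos\theta_<)\,\mathsf P_\nu^{\mu+n}(\cos\theta_>)\,C_n^\mu(\cos\gamma),\\ (2)\quad&\frac{\mathsf Q_\nu^{\mu}(\cos\Theta)}{\sin^\mu\Theta}=K\sum_{n=0}^\infty(-1)^n(n+\mu)\,\mathsf P_\nu^{-(\mu+n)}(\cos\theta_<)\,\mathsf Q_\nu^{\mu+n}(\cos\theta_>)\,C_n^\mu(\cos\gamma),\\ (3)\quad&\frac{\mathsf P_\nu^{-\mu}(\cos\Theta)}{\sin^\mu\Theta}=K\sum_{n=0}^\infty(-1)^n(n+\mu)(\nu+\mu+1)_n(\mu-\nu)_n\,\mathsf P_\nu^{-(\mu+n)}(\cos\theta)\,\mathsf P_\nu^{-(\mu+n)}(\cos\theta')\,C_n^\mu(\cos\gamma),\\ (4)\quad&\frac{\mathsf Q_\nu^{-\mu}(\cos\Theta)}{\sin^\mu\Theta}=K\sum_{n=0}^\infty(-1)^n(n+\mu)(\nu+\mu+1)_n(\mu-\nu)_n\,\mathsf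 P_\nu^{-(\mu+n)}(\cos\theta_<)\,\mathsf Q_\nu^{-(\mu+n)}(\cos\theta_>)\,C_n^\mu(\cos\gamma),\\ (5)\quad&\frac{\mathsf P_\nu^{-\mu}(-\cos\Theta)}{\sin^\mu\Theta}=K\sum_{n=0}^\infty(n+\mu)(\nu+\mu+1)_n(\mu-\nu)_n\,\mathsf P_\nu^{-(\mu+n)}(\cos\theta_<)\,\mathsf P_\nu^{-(\mu+n)}(-\cos\theta_>)\,C_n^\mu(\cos\gamma),\\ (6)\quad&\frac{\mathsf Q_\nu^{-\mu}(-\cos\Theta)}{\sin^\mu\Theta}=K\sum_{n=0}^\infty(n+\mu)(\nu+\mu+1)_n(\mu-\nu)_n\,\mathsf P_\nu^{-(\mu+n)}(\cos\theta_<)\,\mathsf Q_\nu^{-(\mu+n)}(-\cos\theta_>)\,C_n^\mu(\cos\gamma). \end{aligned}$$ -/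

import Mathlib

/-- The Pochhammer symbol `(z)_n = z (z + 1) ⋯ (z + n - 1)`. -/
noncomputable def pochhammerSymbol (z : ℂ) (n : ℕ) : ℂ :=
  (ascPochhammer ℂ n).eval z

/-- The Gegenbauer polynomial
`C_n^μ(x) = ((2μ)_n / n!) ₂F₁(-n, 2μ + n; μ + 1/2; (1 - x)/2)`. -/
noncomputable def gegenbauerC (n : ℕ) (μ : ℂ) (x : ℝ) : ℂ :=
  pochhammerSymbol (2 * μ) n / (n.factorial : ℂ) *
    ordinaryHypergeometric (-(n : ℂ)) (2 * μ + n) (μ + 1 / 2) ((1 - (x : ℂ)) / 2)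

/-- The Ferrers function of the first kind `𝖯_ν^μ` on `(-1, 1)`,
`((1 + x)/(1 - x))^(μ/2) · (1/Γ(1 - μ)) ₂F₁(-ν, ν + 1; 1 - μ; (1 - x)/2)`.
The quotient `₂F₁(a, b; c; z) / Γ(c)` is the regularized hypergeometric function, which is
entire in `c`; so every complex order `μ` is allowed. -/
noncomputable def ferrersP (ν μ : ℂ) (x : ℝ) : ℂ :=
  (((1 + x) / (1 - x) : ℝ) : ℂ) ^ (μ / 2) *
    Complex.regularizedGaussHGFun (-ν) (ν + 1) (1 - μ) ((1 - (x : ℂ)) / 2)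

/-- The hypergeometric representation of the Ferrers function of the second kind on `(-1, 1)`.
If `ν + μ` is not a negative integer, no gamma function in a numerator is at a pole; a gamma
function in a denominator at a pole makes its summand vanish (Mathlib has `Γ = 0` at the poles
and division by zero is zero). -/
noncomputable def ferrersQSeries (ν μ : ℂ) (x : ℝ) : ℂ :=
  (Real.sqrt Real.pi : ℂ) * (2 : ℂ) ^ μ *
      (Complex.Gamma ((ν + μ + 2) / 2) / Complex.Gamma ((ν - μ + 1) / 2)) *
      ((x : ℂ) * Complex.cos (Real.pi / 2 * (ν + μ)) / ((1 - x ^ 2 : ℝ) : ℂ) ^ (μ / 2)) *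
      ordinaryHypergeometric ((1 - ν - μ) / 2) ((ν - μ + 2) / 2) (3 / 2 : ℂ) ((x : ℂ) ^ 2)
    - (Real.sqrt Real.pi : ℂ) * (2 : ℂ) ^ (μ - 1) *
      (Complex.Gamma ((ν + μ + 1) / 2) / Complex.Gamma ((ν - μ + 2) / 2)) *
      (Complex.sin (Real.pi / 2 * (ν + μ)) / ((1 - x ^ 2 : ℝ) : ℂ) ^ (μ / 2)) *
      ordinaryHypergeometric ((-ν - μ) / 2) ((ν - μ + 1) / 2) (1 / 2 : ℂ) ((x : ℂ) ^ 2)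

/-- `z` is one of `-1, -2, -3, …`. -/
def IsNegInt (z : ℂ) : Prop :=
  ∃ m : ℕ, z = -((m : ℂ) + 1)

/-- The pairs (degree, order) for which the Ferrers function of the second kind is defined:
`ν + μ` is not a negative integer, or the case is anomalous, i.e. `ν` is one of
`-3/2, -5/2, …` and the poles of the gamma functions in the numerators of the hypergeometric
representation, as a function of the order, are cancelled by those in the denominators (for
`ν + μ` a negative integer this means that `ν - μ` is a negative integer too). -/
def FerrersQDefined (ν μ : ℂ) : Prop :=
  ¬ IsNegInt (ν + μ) ∨ ((∃ k : ℕ, ν = -((k : ℂ) + 3 / 2)) ∧ IsNegInt (ν - μ))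

open Classical in
/-- The Ferrers function of the second kind `𝖰_ν^μ` on `(-1, 1)`: the hypergeometric
representation, extended to the anomalous cases by continuity in the order. -/
noncomputable def ferrersQ (ν μ : ℂ) (x : ℝ) : ℂ :=
  if IsNegInt (ν + μ) then
    Filter.limUnder (nhdsWithin μ {μ}ᶜ) (fun μ' : ℂ => ferrersQSeries ν μ' x)
  else ferrersQSeries ν μ x

/-- The complex power `r^μ = exp(μ log r)` of a positive real number `r`. -/
noncomputable def realCpow (r : ℝ) (μ : ℂ) : ℂ :=
  (r : ℂ) ^ μ

/-- `f = (2^μ Γ(μ) / (sin θ sin θ')^μ) ∑_{n ≥ 0} (n + μ) a_n C_n^μ(cos γ)`, where the series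
converges absolutely. -/
def HasGegenbauerExpansion (μ : ℂ) (θ θ' γ : ℝ) (f : ℂ) (a : ℕ → ℂ) : Prop :=
  Summable (fun n : ℕ => ((n : ℂ) + μ) * a n * gegenbauerC n μ (Real.cos γ)) ∧
  f = (2 : ℂ) ^ μ * Complex.Gamma μ / realCpow (Real.sin θ * Real.sin θ') μ *
    ∑' n : ℕ, ((n : ℂ) + μ) * a n * gegenbauerC n μ (Real.cos γ)

/-!
Divided by `(sin θ) ^ (μ + n)`, the Ferrers functions of order `±(μ + n)` become, with suitable
constants, functions `G n` of `cos θ` such that `G n' = -G (n + 1)` and `G n` solves Gegenbauer's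
equation. For such a family both sides of the product formula
`∑' k, (w (1 - w) (1 - y²)) ^ k G (2 k) ((1 - 2 w) y) / (k! Γ(μ + k + 1))`
`= G 0 y · ₂F₁(μ - ν, ν + μ + 1; μ + 1; w) / Γ(μ + 1)`
solve the same hypergeometric equation in `w` and agree at `w = 0`, where the other solutions
are singular. Now expand `G 0 (cos α cos β + sin α sin β cos γ)` by Taylor's formula around
`cos α cos β` and the powers of `2 cos γ` in Gegenbauer polynomials. The coefficient of the `n`-th
Gegenbauer polynomial is then the left-hand side of the product formula for the family
`G (n + ·)`, with `w = sin² (α / 2)` and `y = cos β`; the right-hand side contains the Ferrers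
function of order `-(μ + n)` at `cos α`. The expansions at `-cos Θ` arise from the
reflected family `(-1) ^ n G n (-z)`.
-/

open Filter Topology

/-! ### Power series convergent on the unit disc -/

/-- A sequence that grows more slowly than every geometric sequence of ratio greater than one;
equivalently, the power series with these coefficients converges absolutely on the open unit
disc. -/
def IsSubexponential {E : Type*} [Norm E] (a : ℕ → E) : Prop :=
  ∀ r : ℝ, 1 < r → a =O[atTop] fun j => r ^ j

/-- The sum of the power series with coefficients `a`. -/
noncomputable def powerSum (a : ℕ → ℂ) (z : ℂ) : ℂ := ∑' j, a j * z ^ j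

/-- The coefficients of the derivative of the power series with coefficients `a`. -/
def derivCoeff (a : ℕ → ℂ) (j : ℕ) : ℂ := ((j : ℂ) + 1) * a (j + 1)

theorem isBigO_pow_of_eventually_succ_le {V : ℕ → ℝ} {r : ℝ} (hr : 0 < r) (hV0 : ∀ n, 0 ≤ V n)
    (hV : ∀ᶠ n in atTop, V (n + 1) ≤ r * V n) : V =O[atTop] fun n => r ^ n := by
  obtain ⟨N, hN⟩ := eventually_atTop.1 hV
  refine .of_bound (V N / r ^ N) (eventually_atTop.2 ⟨N, fun n hn => ?_⟩)
  obtain ⟨k, rfl⟩ := Nat.exists_eq_add_of_le hn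
  rw [Real.norm_of_nonneg (hV0 _), Real.norm_of_nonneg (by positivity)]
  calc V (N + k) ≤ r ^ k * V N :=
        le_geom (u := fun k => V (N + k)) hr.le k fun i _ => hN (N + i) (by omega)
    _ = V N / r ^ N * r ^ (N + k) := by rw [pow_add]; field_simp

namespace IsSubexponential

section NormedField

variable {𝕜 : Type*} [NormedField 𝕜] {a b : ℕ → 𝕜}

theorem summable_norm_mul_pow (ha : IsSubexponential a) {r : ℝ} (hr : 0 ≤ r) (hr1 : r < 1) :
    Summable fun j => ‖a j‖ * r ^ j := by
  obtain ⟨s, hrs, hs1⟩ := exists_between hr1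
  have hs : 0 < s := hr.trans_lt hrs
  refine summable_of_isBigO_nat
    (summable_geometric_of_lt_one (by positivity) ((inv_mul_lt_one₀ hs).2 hrs))
    (((ha s⁻¹ ((one_lt_inv₀ hs).2 hs1)).norm_left.mul (Asymptotics.isBigO_refl _ _)).congr_right
      fun j => (mul_pow s⁻¹ r j).symm)

theorem summable_norm (ha : IsSubexponential a) {z : 𝕜} (hz : ‖z‖ < 1) :
    Summable fun j => ‖a j * z ^ j‖ := by
  simpa using ha.summable_norm_mul_pow (norm_nonneg z) hz

theorem exists_norm_mul_pow_le (ha : IsSubexponential a) {r : ℝ} (hr : 0 ≤ r) (hr1 : r < 1) :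
    ∃ C, ∀ j, ‖a j‖ * r ^ j ≤ C :=
  ⟨∑' j, ‖a j‖ * r ^ j, fun j =>
    (ha.summable_norm_mul_pow hr hr1).le_tsum j fun _ _ => by positivity⟩

theorem mul (ha : IsSubexponential a) (hb : IsSubexponential b) :
    IsSubexponential fun j => a j * b j := by
  intro r hr
  have hs : 1 < √r := Real.lt_sqrt_of_sq_lt (by simpa using hr)
  refine ((ha _ hs).mul (hb _ hs)).congr_right fun j => ?_
  rw [← mul_pow, Real.mul_self_sqrt (by positivity)]

theorem add (ha : IsSubexponential a) (hb : IsSubexponential b) :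
    IsSubexponential fun j => a j + b j :=
  fun r hr => (ha r hr).add (hb r hr)

theorem sub (ha : IsSubexponential a) (hb : IsSubexponential b) :
    IsSubexponential fun j => a j - b j :=
  fun r hr => (ha r hr).sub (hb r hr)

theorem const (c : 𝕜) : IsSubexponential fun _ => c := fun r hr =>
  .of_bound ‖c‖ (.of_forall fun j => by
    simpa [abs_of_pos (one_pos.trans hr)] using
      le_mul_of_one_le_right (norm_nonneg c) (one_le_pow₀ hr.le))

theorem const_mul (ha : IsSubexponential a) (c : 𝕜) : IsSubexponential fun j => c * a j :=
  (const c).mul ha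

theorem succ (ha : IsSubexponential a) : IsSubexponential fun j => a (j + 1) := fun r hr => by
  refine ((ha r hr).comp_tendsto (tendsto_add_atTop_nat 1)).trans ?_
  simpa [Function.comp_def, pow_succ'] using
    (Asymptotics.isBigO_refl (fun j : ℕ => r ^ j) atTop).const_mul_left r

/-- A form of Poincaré's theorem on linear recurrences. The proof factors the limiting recurrence:
`a (n + 1) - α * a n` is multiplied by approximately `β` at each step. -/
theorem of_recurrence {p q : ℕ → 𝕜} {α β : 𝕜} (hα : ‖α‖ ≤ 1) (hβ : ‖β‖ ≤ 1)
    (hp : Tendsto p atTop (𝓝 (α + β))) (hq : Tendsto q atTop (𝓝 (-(α * β))))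
    (h : ∀ᶠ n in atTop, a (n + 2) = p n * a (n + 1) + q n * a n) : IsSubexponential a := by
  intro r hr
  set δ := r - 1 with hδ
  have hδ0 : 0 < δ := sub_pos.2 hr
  set u : ℕ → 𝕜 := fun n => a (n + 1) - α * a n with hu
  set V : ℕ → ℝ := fun n => max (δ * ‖a n‖) ‖u n‖
  have haV : ∀ n, ‖a n‖ ≤ δ⁻¹ * V n := fun n => by
    rw [le_inv_mul_iff₀ hδ0]; exact le_max_left _ _
  have hV0 : ∀ n, 0 ≤ V n := fun n => (norm_nonneg _).trans (le_max_right _ _)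
  have ha_succ : ∀ n, ‖a (n + 1)‖ ≤ ‖a n‖ + ‖u n‖ := fun n => by
    calc ‖a (n + 1)‖ = ‖α * a n + u n‖ := by rw [hu]; congr 1; ring
      _ ≤ ‖α‖ * ‖a n‖ + ‖u n‖ := (norm_add_le _ _).trans_eq (by rw [norm_mul])
      _ ≤ ‖a n‖ + ‖u n‖ := by gcongr; exact mul_le_of_le_one_left (norm_nonneg _) hα
  have hpq : Tendsto (fun n => 1 + ‖p n - (α + β)‖ * (δ⁻¹ + 1) + ‖q n + α * β‖ * δ⁻¹) atTop
      (𝓝 1) := by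
    simpa using ((((hp.sub_const (α + β)).norm.mul_const (δ⁻¹ + 1)).const_add 1).add
      ((hq.add_const (α * β)).norm.mul_const δ⁻¹))
  have hV : ∀ᶠ n in atTop, V (n + 1) ≤ r * V n := by
    filter_upwards [h, hpq.eventually_le_const hr] with n hn hpqn
    have hun : u (n + 1) = β * u n + ((p n - (α + β)) * a (n + 1) + (q n + α * β) * a n) := by
      simp only [hu, hn]; ring
    refine max_le ?_ ?_
    · calc δ * ‖a (n + 1)‖ ≤ δ * ‖a n‖ + δ * ‖u n‖ := by rw [← mul_add]; gcongr; exact ha_succ n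
        _ ≤ V n + δ * V n := by gcongr <;> first | exact le_max_left _ _ | exact le_max_right _ _
        _ = r * V n := by rw [hδ]; ring
    · calc ‖u (n + 1)‖
          ≤ ‖β‖ * ‖u n‖ + (‖p n - (α + β)‖ * ‖a (n + 1)‖ + ‖q n + α * β‖ * ‖a n‖) := by
            rw [hun, ← norm_mul, ← norm_mul, ← norm_mul]
            exact (norm_add_le _ _).trans (by gcongr; exact norm_add_le _ _)
        _ ≤ 1 * V n + (‖p n - (α + β)‖ * (δ⁻¹ * V n + V n) + ‖q n + α * β‖ * (δ⁻¹ * V n)) := by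
            gcongr
            exacts [le_max_right _ _, (ha_succ n).trans (add_le_add (haV n) (le_max_right _ _)),
              haV n]
        _ = (1 + ‖p n - (α + β)‖ * (δ⁻¹ + 1) + ‖q n + α * β‖ * δ⁻¹) * V n := by ring
        _ ≤ r * V n := by gcongr
  have haV' : a =O[atTop] V := .of_bound δ⁻¹ (.of_forall fun n => by
    simpa [abs_of_nonneg (hV0 n)] using haV n)
  exact haV'.trans (isBigO_pow_of_eventually_succ_le (one_pos.trans hr) hV0 hV)

end NormedField

section Complex

variable {a b : ℕ → ℂ}

theorem natCast : IsSubexponential fun j => (j : ℂ) := fun r hr => by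
  simpa using (isLittleO_pow_const_const_pow_of_one_lt (R := ℂ) 1 hr).isBigO

theorem natCast_mul (ha : IsSubexponential a) : IsSubexponential fun j => (j : ℂ) * a j :=
  natCast.mul ha

protected theorem derivCoeff (ha : IsSubexponential a) : IsSubexponential (derivCoeff a) := by
  have h := ha.natCast_mul.succ
  simp only [Nat.cast_succ] at h
  exact h

protected theorem summable (ha : IsSubexponential a) {z : ℂ} (hz : ‖z‖ < 1) :
    Summable fun j => a j * z ^ j :=
  (ha.summable_norm hz).of_norm

theorem hasDerivAt_powerSum (ha : IsSubexponential a) {z : ℂ} (hz : ‖z‖ < 1) :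
    HasDerivAt (powerSum a) (powerSum (derivCoeff a) z) z := by
  obtain ⟨s, hzs, hs1⟩ := exists_between hz
  have hs0 : 0 ≤ s := (norm_nonneg z).trans hzs.le
  have hterm : ∀ (j : ℕ) (w : ℂ), HasDerivAt (fun w => a j * w ^ j) (a j * (j * w ^ (j - 1))) w :=
    fun j w => (hasDerivAt_pow j w).const_mul (a j)
  have hbound : Summable fun j : ℕ => ‖a j‖ * (j * s ^ (j - 1)) := by
    refine (summable_nat_add_iff 1).1 ((ha.derivCoeff.summable_norm_mul_pow hs0 hs1).congr
      fun j => ?_)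
    rw [derivCoeff, norm_mul, ← Nat.cast_succ, Complex.norm_natCast, Nat.add_sub_cancel]
    ring
  have hz' : z ∈ Metric.ball (0 : ℂ) s := mem_ball_zero_iff.2 hzs
  have hderiv := hasDerivAt_tsum_of_isPreconnected hbound Metric.isOpen_ball
    (convex_ball (0 : ℂ) s).isPreconnected (fun j w _ => hterm j w) (fun j w hw => by
      rw [norm_mul, norm_mul, norm_pow, Complex.norm_natCast]
      gcongr
      exact (mem_ball_zero_iff.1 hw).le) hz' (ha.summable hz) hz'
  refine hderiv.congr_deriv ?_
  rw [powerSum, Summable.tsum_eq_zero_add (.of_norm_bounded hbound fun j => ?_)]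
  · simp only [derivCoeff, Nat.cast_zero, zero_mul, mul_zero, zero_add, Nat.cast_add,
      Nat.cast_one, Nat.add_sub_cancel]
    exact tsum_congr fun j => by ring
  · rw [norm_mul, norm_mul, norm_pow, Complex.norm_natCast]
    gcongr

theorem powerSum_add (ha : IsSubexponential a) (hb : IsSubexponential b) {z : ℂ} (hz : ‖z‖ < 1) :
    powerSum (fun j => a j + b j) z = powerSum a z + powerSum b z := by
  simpa only [powerSum, add_mul] using (ha.summable hz).tsum_add (hb.summable hz)

theorem powerSum_sub (ha : IsSubexponential a) (hb : IsSubexponential b) {z : ℂ} (hz : ‖z‖ < 1) :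
    powerSum (fun j => a j - b j) z = powerSum a z - powerSum b z := by
  simpa only [powerSum, sub_mul] using (ha.summable hz).tsum_sub (hb.summable hz)

theorem mul_powerSum_derivCoeff (ha : IsSubexponential a) {z : ℂ} (hz : ‖z‖ < 1) :
    z * powerSum (derivCoeff a) z = powerSum (fun j => (j : ℂ) * a j) z := by
  rw [powerSum, powerSum, (ha.natCast_mul.summable hz).tsum_eq_zero_add, ← tsum_mul_left]
  simp only [Nat.cast_zero, zero_mul, zero_add, derivCoeff]
  exact tsum_congr fun j => by push_cast; ring

theorem sq_mul_powerSum_derivCoeff (ha : IsSubexponential a) {z : ℂ} (hz : ‖z‖ < 1) :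
    z ^ 2 * powerSum (derivCoeff (derivCoeff a)) z
      = powerSum (fun j => (j : ℂ) * ((j : ℂ) - 1) * a j) z := by
  have hcoeff : derivCoeff (fun j => (j : ℂ) * a j - a j)
      = fun j : ℕ => (j : ℂ) * derivCoeff a j := by
    funext j
    simp only [derivCoeff]
    push_cast
    ring
  have h := (ha.natCast_mul.sub ha).mul_powerSum_derivCoeff hz
  rw [hcoeff] at h
  rw [sq, mul_assoc, ha.derivCoeff.mul_powerSum_derivCoeff hz, h]
  simp only [sub_mul, mul_sub, mul_assoc, mul_one]

end Complex

end IsSubexponential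

theorem powerSum_const_mul (c : ℂ) (a : ℕ → ℂ) (z : ℂ) :
    powerSum (fun j => c * a j) z = c * powerSum a z := by
  simp only [powerSum, mul_assoc, tsum_mul_left]

theorem powerSum_zero_right (a : ℕ → ℂ) : powerSum a 0 = a 0 := by
  rw [powerSum, tsum_eq_single 0 fun j hj => by simp [hj], pow_zero, mul_one]

/-! ### The hypergeometric equation -/

/-- The differential operator of Gauss's hypergeometric equation with parameters `a`, `b`, `c`. -/
noncomputable def hypergeometricOperator (a b c : ℂ) (f : ℂ → ℂ) (z : ℂ) : ℂ :=
  z * (1 - z) * deriv (deriv f) z + (c - (a + b + 1) * z) * deriv f z - a * b * f z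

/-- Holomorphic solutions of Gauss's hypergeometric equation on a set, which is open in all
applications. -/
structure IsHypergeometricSolutionOn (a b c : ℂ) (f : ℂ → ℂ) (U : Set ℂ) : Prop where
  differentiableOn : DifferentiableOn ℂ f U
  operator_eq_zero : ∀ z ∈ U, hypergeometricOperator a b c f z = 0

section HypergeometricOperator

variable {a b c z : ℂ} {f f₁ g : ℂ → ℂ} {U : Set ℂ}

theorem hypergeometricOperator_eq_of_hasDerivAt {f₂ : ℂ}
    (hf : ∀ᶠ w in 𝓝 z, HasDerivAt f (f₁ w) w) (hf₁ : HasDerivAt f₁ f₂ z) :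
    hypergeometricOperator a b c f z
      = z * (1 - z) * f₂ + (c - (a + b + 1) * z) * f₁ z - a * b * f z := by
  have hderiv : deriv f =ᶠ[𝓝 z] f₁ := hf.mono fun _ hw => hw.deriv
  rw [hypergeometricOperator, hderiv.deriv_eq, hf₁.deriv, hderiv.eq_of_nhds]

theorem hypergeometricOperator_const_mul (κ : ℂ) :
    hypergeometricOperator a b c (fun w => κ * f w) z
      = κ * hypergeometricOperator a b c f z := by
  simp only [hypergeometricOperator, deriv_const_mul_field', deriv_const_mul_field]
  ring

theorem hypergeometricOperator_sum {ι : Type*} {F : ι → ℂ → ℂ} (u : Finset ι) (hU : IsOpen U)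
    (hF : ∀ i ∈ u, DifferentiableOn ℂ (F i) U) (hz : z ∈ U) :
    hypergeometricOperator a b c (fun w => ∑ i ∈ u, F i w) z
      = ∑ i ∈ u, hypergeometricOperator a b c (F i) z := by
  have hderiv : ∀ w ∈ U,
      HasDerivAt (fun w => ∑ i ∈ u, F i w) (∑ i ∈ u, deriv (F i) w) w := fun w hw =>
    .fun_sum fun i hi => ((hF i hi).differentiableAt (hU.mem_nhds hw)).hasDerivAt
  rw [hypergeometricOperator_eq_of_hasDerivAt (by filter_upwards [hU.mem_nhds hz] using hderiv)
    (.fun_sum fun i hi =>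
      (((hF i hi).deriv hU).differentiableAt (hU.mem_nhds hz)).hasDerivAt)]
  simp only [hypergeometricOperator, Finset.sum_add_distrib, Finset.sum_sub_distrib,
    Finset.mul_sum]

theorem tendsto_hypergeometricOperator {F : ℕ → ℂ → ℂ} (hU : IsOpen U)
    (hF : ∀ n, DifferentiableOn ℂ (F n) U) (hlim : TendstoLocallyUniformlyOn F f atTop U)
    (hz : z ∈ U) :
    Tendsto (fun n => hypergeometricOperator a b c (F n) z) atTop
      (𝓝 (hypergeometricOperator a b c f z)) := by
  have hlim₁ := hlim.deriv (.of_forall hF) hU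
  have hlim₂ := hlim₁.deriv (.of_forall fun n => (hF n).deriv hU) hU
  exact (((hlim₂.tendsto_at hz).const_mul _).add ((hlim₁.tendsto_at hz).const_mul _)).sub
    ((hlim.tendsto_at hz).const_mul _)

theorem eventuallyEq_mul_deriv_of_eventuallyEq_pow_mul {m : ℕ} (hg : AnalyticAt ℂ g 0)
    (h : f =ᶠ[𝓝 0] fun z => z ^ m * g z) :
    (fun z => z * deriv f z) =ᶠ[𝓝 0] fun z => z ^ m * (m * g z + z * deriv g z) := by
  filter_upwards [h.eventuallyEq_nhds, hg.eventually_analyticAt] with z hz hgz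
  rw [hz.deriv_eq, deriv_fun_mul (by fun_prop) hgz.differentiableAt, deriv_pow_field]
  rcases m with _ | m
  · simp
  · rw [Nat.add_sub_cancel, pow_succ]
    ring

/-- The leading exponent `m` of a nonzero solution at the origin would satisfy the indicial
equation `m (m - 1 + c) = 0`. -/
theorem eventually_eq_zero_of_hypergeometricOperator_eq_zero (hc : ∀ k : ℕ, c ≠ -k)
    (hf : AnalyticAt ℂ f 0) (hode : ∀ᶠ z in 𝓝 0, hypergeometricOperator a b c f z = 0)
    (h0 : f 0 = 0) : ∀ᶠ z in 𝓝 0, f z = 0 := by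
  by_contra hne
  obtain ⟨m, g, hg, hg0, hfg⟩ := hf.exists_eventuallyEq_pow_smul_nonzero_iff.2 hne
  simp only [sub_zero, smul_eq_mul] at hfg
  obtain ⟨k, rfl⟩ : ∃ k, m = k + 1 := by
    refine Nat.exists_eq_succ_of_ne_zero fun hm => hg0 ?_
    simpa [hm, h0] using hfg.self_of_nhds.symm
  set h : ℂ → ℂ := fun z => (k + 1 : ℕ) * g z + z * deriv g z with hh
  have hha : AnalyticAt ℂ h 0 := by fun_prop
  have hf₁ := eventuallyEq_mul_deriv_of_eventuallyEq_pow_mul hg hfg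
  have hf₂ := eventuallyEq_mul_deriv_of_eventuallyEq_pow_mul hha hf₁
  set φ : ℂ → ℂ := fun z => (1 - z) * ((k + 1 : ℕ) * h z + z * deriv h z - h z)
    + (c - (a + b + 1) * z) * h z - a * b * z * g z with hφ
  have hφa : AnalyticAt ℂ φ 0 := by fun_prop
  have hpow : ∀ᶠ z in 𝓝 0, z ^ (k + 1) * φ z = 0 := by
    filter_upwards [hode, hf.eventually_analyticAt, hfg, hf₁, hf₂] with z hz hfz e₀ e₁ e₂
    rw [deriv_fun_mul differentiableAt_fun_id hfz.deriv.differentiableAt, deriv_id''] at e₂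
    rw [hypergeometricOperator] at hz
    simp only [hφ]
    linear_combination z * hz - (1 - z) * e₂ + (1 - z) * e₁ - (c - (a + b + 1) * z) * e₁
      + a * b * z * e₀
  have hφ0 : φ 0 = 0 := by
    refine tendsto_nhds_unique (hφa.continuousAt.tendsto.mono_left nhdsWithin_le_nhds)
      (tendsto_const_nhds.congr' (f₁ := fun _ => 0) (l₁ := 𝓝[≠] 0) ?_)
    filter_upwards [hpow.filter_mono nhdsWithin_le_nhds, self_mem_nhdsWithin] with z hz hz0
    exact ((mul_eq_zero.1 hz).resolve_left (pow_ne_zero _ hz0)).symm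
  have hindicial : ((k : ℂ) + 1) * (c + k) * g 0 = 0 := by
    simp only [hφ, hh] at hφ0
    push_cast at hφ0
    linear_combination hφ0
  exact hg0 ((mul_eq_zero.1 hindicial).resolve_left (mul_ne_zero (Nat.cast_add_one_ne_zero k)
    fun hk => hc k (eq_neg_of_add_eq_zero_left hk)))

end HypergeometricOperator

namespace IsHypergeometricSolutionOn

variable {a b c : ℂ} {f f₁ f₂ g : ℂ → ℂ} {U V : Set ℂ}

theorem of_hasDerivAt (hU : IsOpen U) (hf : ∀ z ∈ U, HasDerivAt f (f₁ z) z)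
    (hf₁ : ∀ z ∈ U, HasDerivAt f₁ (f₂ z) z)
    (hode : ∀ z ∈ U,
      z * (1 - z) * f₂ z + (c - (a + b + 1) * z) * f₁ z - a * b * f z = 0) :
    IsHypergeometricSolutionOn a b c f U where
  differentiableOn z hz := (hf z hz).differentiableAt.differentiableWithinAt
  operator_eq_zero z hz := by
    rw [hypergeometricOperator_eq_of_hasDerivAt (by filter_upwards [hU.mem_nhds hz] using hf)
      (hf₁ z hz), hode z hz]

theorem mono (hf : IsHypergeometricSolutionOn a b c f V) (hUV : U ⊆ V) :
    IsHypergeometricSolutionOn a b c f U :=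
  ⟨hf.differentiableOn.mono hUV, fun z hz => hf.operator_eq_zero z (hUV hz)⟩

theorem const_mul (hf : IsHypergeometricSolutionOn a b c f U) (κ : ℂ) :
    IsHypergeometricSolutionOn a b c (fun z => κ * f z) U :=
  ⟨hf.differentiableOn.const_mul κ, fun z hz => by
    rw [hypergeometricOperator_const_mul, hf.operator_eq_zero z hz, mul_zero]⟩

theorem hasDerivAt (hf : IsHypergeometricSolutionOn a b c f U) (hU : IsOpen U) :
    ∀ z ∈ U, HasDerivAt f (deriv f z) z :=
  fun _ hz => (hf.differentiableOn.differentiableAt (hU.mem_nhds hz)).hasDerivAt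

theorem hasDerivAt_deriv (hf : IsHypergeometricSolutionOn a b c f U) (hU : IsOpen U) :
    ∀ z ∈ U, HasDerivAt (deriv f) (deriv (deriv f) z) z :=
  fun _ hz => ((hf.differentiableOn.deriv hU).differentiableAt (hU.mem_nhds hz)).hasDerivAt

theorem sub (hf : IsHypergeometricSolutionOn a b c f U)
    (hg : IsHypergeometricSolutionOn a b c g U) (hU : IsOpen U) :
    IsHypergeometricSolutionOn a b c (fun z => f z - g z) U :=
  .of_hasDerivAt hU (fun z hz => (hf.hasDerivAt hU z hz).fun_sub (hg.hasDerivAt hU z hz))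
    (fun z hz => (hf.hasDerivAt_deriv hU z hz).fun_sub (hg.hasDerivAt_deriv hU z hz))
    fun z hz => by
      have hfz := hf.operator_eq_zero z hz
      have hgz := hg.operator_eq_zero z hz
      rw [hypergeometricOperator] at hfz hgz
      linear_combination hfz - hgz

theorem eqOn (hf : IsHypergeometricSolutionOn a b c f U)
    (hg : IsHypergeometricSolutionOn a b c g U) (hc : ∀ k : ℕ, c ≠ -k) (hU : IsOpen U)
    (hU' : IsPreconnected U) (h0 : 0 ∈ U) (hfg : f 0 = g 0) : Set.EqOn f g U := by
  have hfa := hf.differentiableOn.analyticOnNhd hU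
  have hga := hg.differentiableOn.analyticOnNhd hU
  refine hfa.eqOn_of_preconnected_of_eventuallyEq hga hU' h0 ?_
  have hzero := eventually_eq_zero_of_hypergeometricOperator_eq_zero hc
    ((hfa 0 h0).fun_sub (hga 0 h0))
    (by filter_upwards [hU.mem_nhds h0] using (hf.sub hg hU).operator_eq_zero)
    (sub_eq_zero.2 hfg)
  exact hzero.mono fun z hz => sub_eq_zero.1 hz

end IsHypergeometricSolutionOn

theorem one_sub_mem_slitPlane {z : ℂ} (hz : ‖z‖ < 1) : 1 - z ∈ Complex.slitPlane := by
  rw [sub_eq_add_neg]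
  exact Complex.mem_slitPlane_of_norm_lt_one (by simpa using hz)

theorem cpow_eq_cpow_sub_one_mul {x : ℂ} (hx : x ≠ 0) (s : ℂ) : x ^ s = x ^ (s - 1) * x := by
  rw [Complex.cpow_sub _ _ hx, Complex.cpow_one, div_mul_cancel₀ _ hx]

theorem hasDerivAt_one_sub_cpow_mul {f : ℂ → ℂ} {f' z : ℂ} (hz : 1 - z ∈ Complex.slitPlane)
    (hf : HasDerivAt f f' z) (s : ℂ) :
    HasDerivAt (fun w => (1 - w) ^ s * f w)
      ((1 - z) ^ (s - 1) * ((1 - z) * f' - s * f z)) z := by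
  have hsub : HasDerivAt (fun w : ℂ => 1 - w) (-1) z := (hasDerivAt_id z).const_sub 1
  refine ((hsub.cpow_const (c := s) hz).fun_mul hf).congr_deriv ?_
  rw [cpow_eq_cpow_sub_one_mul (Complex.slitPlane_ne_zero hz) s]
  ring

theorem IsHypergeometricSolutionOn.one_sub_cpow_mul {a b c : ℂ} {f : ℂ → ℂ} {U : Set ℂ}
    (hf : IsHypergeometricSolutionOn (c - a) (c - b) c f U) (hU : IsOpen U)
    (hslit : ∀ z ∈ U, 1 - z ∈ Complex.slitPlane) :
    IsHypergeometricSolutionOn a b c (fun z => (1 - z) ^ (c - a - b) * f z) U := by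
  refine .of_hasDerivAt hU
    (fun z hz => hasDerivAt_one_sub_cpow_mul (hslit z hz) (hf.hasDerivAt hU z hz) _)
    (fun z hz => hasDerivAt_one_sub_cpow_mul (hslit z hz)
      ((((hasDerivAt_id z).const_sub 1).fun_mul (hf.hasDerivAt_deriv hU z hz)).fun_sub
        ((hf.hasDerivAt hU z hz).const_mul (c - a - b))) _) fun z hz => ?_
  have hne := Complex.slitPlane_ne_zero (hslit z hz)
  have hode := hf.operator_eq_zero z hz
  rw [hypergeometricOperator] at hode
  rw [cpow_eq_cpow_sub_one_mul hne (c - a - b), cpow_eq_cpow_sub_one_mul hne (c - a - b - 1)]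
  simp only [id_eq]
  linear_combination (1 - z) ^ (c - a - b - 1 - 1) * (1 - z) ^ 2 * hode

/-- The recursion for the coefficients of a power series that solves the hypergeometric
equation. -/
def HypergeometricRecursion (a b c : ℂ) (r : ℕ → ℂ) : Prop :=
  ∀ j : ℕ, ((j : ℂ) + 1) * (c + j) * r (j + 1) = (a + j) * (b + j) * r j

namespace HypergeometricRecursion

variable {a b c : ℂ} {r : ℕ → ℂ}

theorem isSubexponential (hr : HypergeometricRecursion a b c r) : IsSubexponential r := by
  refine .of_recurrence (α := 1) (β := 0)
    (p := fun n : ℕ => (a + 1 + 1 * n) / (c + 1 + 1 * n) * ((b + 1 + 1 * n) / (2 + 1 * n)))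
    (q := fun _ => 0) (by simp) (by simp) ?_ (by simp) ?_
  · simpa using (tendsto_add_mul_div_add_mul_atTop_nhds (a + 1) (c + 1) 1 one_ne_zero).mul
      (tendsto_add_mul_div_add_mul_atTop_nhds (b + 1) 2 1 one_ne_zero)
  · filter_upwards [(tendsto_natCast_atTop_cobounded (α := ℂ)).eventually_ne_cobounded (-(c + 1))]
      with n hn
    have hc : c + 1 + n ≠ 0 := fun h => hn (eq_neg_of_add_eq_zero_right h)
    have h2 : (2 : ℂ) + n ≠ 0 := by exact_mod_cast (by omega : 2 + n ≠ 0)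
    have h := hr (n + 1)
    push_cast at h
    simp only [zero_mul, add_zero, one_mul]
    rw [div_mul_div_comm, div_mul_eq_mul_div, eq_div_iff (mul_ne_zero hc h2)]
    linear_combination h

theorem isHypergeometricSolutionOn (hr : HypergeometricRecursion a b c r) :
    IsHypergeometricSolutionOn a b c (powerSum r) (Metric.ball 0 1) := by
  have hs := hr.isSubexponential
  refine .of_hasDerivAt Metric.isOpen_ball
    (fun z hz => hs.hasDerivAt_powerSum (mem_ball_zero_iff.1 hz))
    (fun z hz => hs.derivCoeff.hasDerivAt_powerSum (mem_ball_zero_iff.1 hz)) fun z hz => ?_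
  have hz := mem_ball_zero_iff.1 hz
  have hterm : ∀ j : ℕ, ((j : ℂ) + c) * derivCoeff r j * z ^ j
      - (((j : ℂ) * (j - 1) + (a + b + 1) * j + a * b) * r j) * z ^ j = 0 := fun j => by
    rw [derivCoeff]
    linear_combination z ^ j * hr j
  have e₂ : IsSubexponential fun j : ℕ => (j : ℂ) * (j - 1) * r j :=
    (IsSubexponential.natCast.mul (.sub .natCast (.const 1))).mul hs
  have h := (hs.derivCoeff.natCast_mul.add (hs.derivCoeff.const_mul c)).powerSum_sub
    ((e₂.add (hs.natCast_mul.const_mul (a + b + 1))).add (hs.const_mul (a * b))) hz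
  rw [hs.derivCoeff.natCast_mul.powerSum_add (hs.derivCoeff.const_mul c) hz,
    (e₂.add (hs.natCast_mul.const_mul (a + b + 1))).powerSum_add (hs.const_mul (a * b)) hz,
    e₂.powerSum_add (hs.natCast_mul.const_mul (a + b + 1)) hz, powerSum_const_mul,
    powerSum_const_mul, powerSum_const_mul, ← hs.derivCoeff.mul_powerSum_derivCoeff hz,
    ← hs.mul_powerSum_derivCoeff hz, ← hs.sq_mul_powerSum_derivCoeff hz] at h
  rw [show powerSum _ z = 0 from (tsum_congr fun j => ?_).trans tsum_zero] at h
  · linear_combination -h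
  · linear_combination hterm j

end HypergeometricRecursion

/-- The coefficients of the regularized Gauss hypergeometric series. -/
noncomputable def gaussCoeff (a b c : ℂ) (j : ℕ) : ℂ :=
  (ascPochhammer ℂ j).eval a * (ascPochhammer ℂ j).eval b / (j.factorial * Complex.Gamma (c + j))

theorem powerSum_gaussCoeff (a b c : ℂ) :
    powerSum (gaussCoeff a b c) = Complex.regularizedGaussHGFun a b c := by
  funext z
  rw [powerSum, Complex.regularizedGaussHGFun, FormalMultilinearSeries.sum]
  refine tsum_congr fun j => ?_
  rw [FormalMultilinearSeries.apply_eq_pow_smul_coeff, Complex.coeff_regularizedGaussHGFunSeries,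
    smul_eq_mul, mul_comm, gaussCoeff]

theorem hypergeometricRecursion_gaussCoeff (a b c : ℂ) :
    HypergeometricRecursion a b c (gaussCoeff a b c) := fun j => by
  have hj : ((j : ℂ) + 1) ≠ 0 := Nat.cast_add_one_ne_zero j
  have hj' : (j.factorial : ℂ) ≠ 0 := Nat.cast_ne_zero.2 j.factorial_ne_zero
  simp only [gaussCoeff, ascPochhammer_succ_eval, Nat.factorial_succ, Nat.cast_mul, Nat.cast_add,
    Nat.cast_one, div_eq_mul_inv, mul_inv,
    Complex.one_div_Gamma_eq_self_mul_one_div_Gamma_add_one (c + j), ← add_assoc]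
  field_simp

theorem isHypergeometricSolutionOn_regularizedGaussHGFun (a b c : ℂ) :
    IsHypergeometricSolutionOn a b c (Complex.regularizedGaussHGFun a b c) (Metric.ball 0 1) :=
  powerSum_gaussCoeff a b c ▸ (hypergeometricRecursion_gaussCoeff a b c).isHypergeometricSolutionOn

theorem regularizedGaussHGFun_zero (a b c : ℂ) :
    Complex.regularizedGaussHGFun a b c 0 = (Complex.Gamma c)⁻¹ := by
  simp [← powerSum_gaussCoeff, powerSum_zero_right, gaussCoeff]

theorem regularizedGaussHGFun_euler {a b c : ℂ} (hc : ∀ k : ℕ, c ≠ -k) {z : ℂ} (hz : ‖z‖ < 1) :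
    Complex.regularizedGaussHGFun a b c z =
      (1 - z) ^ (c - a - b) * Complex.regularizedGaussHGFun (c - a) (c - b) c z :=
  (isHypergeometricSolutionOn_regularizedGaussHGFun a b c).eqOn
    ((isHypergeometricSolutionOn_regularizedGaussHGFun (c - a) (c - b) c).one_sub_cpow_mul
      Metric.isOpen_ball fun w hw => one_sub_mem_slitPlane (mem_ball_zero_iff.1 hw))
    hc Metric.isOpen_ball (convex_ball 0 1).isPreconnected (Metric.mem_ball_self one_pos)
    (by simp [regularizedGaussHGFun_zero]) (mem_ball_zero_iff.2 hz)

theorem ordinaryHypergeometric_euler {a b c : ℂ} (hc : ∀ k : ℕ, c ≠ -k) {z : ℂ} (hz : ‖z‖ < 1) :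
    ordinaryHypergeometric a b c z =
      (1 - z) ^ (c - a - b) * ordinaryHypergeometric (c - a) (c - b) c z := by
  have h := regularizedGaussHGFun_euler (a := a) (b := b) hc hz
  rw [← Complex.ordinaryHypergeometric_div_Gamma_eq hc,
    ← Complex.ordinaryHypergeometric_div_Gamma_eq hc, ← mul_div_assoc] at h
  exact (div_left_inj' (Complex.Gamma_ne_zero hc)).1 h

/-! ### Gegenbauer polynomials -/

theorem natCast_descFactorial_div_factorial (n j : ℕ) :
    (n.descFactorial j : ℂ) / n.factorial = (Complex.Gamma (n - j + 1))⁻¹ := by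
  rcases le_or_gt j n with hj | hj
  · rw [← Nat.cast_sub hj, Complex.Gamma_nat_eq_factorial, ← Nat.factorial_mul_descFactorial hj,
      Nat.cast_mul, div_mul_cancel_right₀]
    exact Nat.cast_ne_zero.2 (Nat.descFactorial_eq_zero_iff_lt.not.2 hj.not_gt)
  · obtain ⟨k, rfl⟩ := Nat.exists_eq_add_of_lt hj
    rw [show (n : ℂ) - (n + k + 1 : ℕ) + 1 = -k by push_cast; ring,
      Complex.Gamma_neg_nat_eq_zero, Nat.descFactorial_of_lt hj, Nat.cast_zero, zero_div, inv_zero]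

theorem ascPochhammer_eval_neg_natCast (n j : ℕ) :
    (ascPochhammer ℂ j).eval (-(n : ℂ)) = (-1) ^ j * n.descFactorial j := by
  rw [ascPochhammer_eval_neg_eq_descPochhammer, descPochhammer_eval_eq_descFactorial]

/-- The coefficient of `((1 - x) / 2) ^ j` in the Gegenbauer polynomial `C_n^μ(x)`. It vanishes for
`n < j` because of the pole of the last gamma function. -/
noncomputable def gegenbauerCoeff (μ : ℂ) (n j : ℕ) : ℂ :=
  (-1) ^ j * (ascPochhammer ℂ (n + j)).eval (2 * μ) /
    (j.factorial * (ascPochhammer ℂ j).eval (μ + 1 / 2) * Complex.Gamma (n - j + 1))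

section Gegenbauer

variable {μ : ℂ}

theorem gegenbauerC_eq_sum (μ : ℂ) (x : ℝ) {n N : ℕ} (hN : n < N) :
    gegenbauerC n μ x = ∑ j ∈ Finset.range N, gegenbauerCoeff μ n j * ((1 - (x : ℂ)) / 2) ^ j := by
  rw [gegenbauerC, ordinaryHypergeometric_eq_tsum]
  beta_reduce
  rw [tsum_eq_sum (s := Finset.range N), Finset.mul_sum]
  · refine Finset.sum_congr rfl fun j _ => ?_
    rw [ascPochhammer_eval_neg_natCast, gegenbauerCoeff, pochhammerSymbol, smul_eq_mul,
      ← ascPochhammer_mul, Polynomial.eval_mul, div_eq_mul_inv _ (_ * _ * _),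
      mul_inv _ (Complex.Gamma _), ← natCast_descFactorial_div_factorial]
    simp only [Polynomial.eval_comp, Polynomial.eval_add, Polynomial.eval_X,
      Polynomial.eval_natCast]
    ring
  · intro j hj
    have hnj : n < j := hN.trans_le (not_lt.1 (Finset.mem_range.not.1 hj))
    simp [ascPochhammer_eval_neg_natCast, Nat.descFactorial_of_lt hnj]

theorem gegenbauerCoeff_zero_right (μ : ℂ) (n : ℕ) :
    gegenbauerCoeff μ n 0 = (ascPochhammer ℂ n).eval (2 * μ) / n.factorial := by
  simp [gegenbauerCoeff, Complex.Gamma_nat_eq_factorial]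

theorem gegenbauerC_zero (μ : ℂ) (x : ℝ) : gegenbauerC 0 μ x = 1 := by
  simp [gegenbauerC_eq_sum μ x zero_lt_one, gegenbauerCoeff_zero_right]

theorem gegenbauerC_one (hμ : μ + 1 / 2 ≠ 0) (x : ℝ) : gegenbauerC 1 μ x = 2 * μ * x := by
  have hcoeff : gegenbauerCoeff μ 1 1 = -4 * μ := by
    rw [gegenbauerCoeff, ascPochhammer_succ_eval, ascPochhammer_one, Polynomial.eval_X,
      Polynomial.eval_X, Nat.cast_one, sub_self, zero_add, Complex.Gamma_one, Nat.factorial_one,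
      Nat.cast_one, one_mul, mul_one, div_eq_iff hμ]
    ring
  rw [gegenbauerC_eq_sum μ x (lt_add_one 1), Finset.sum_range_succ, Finset.sum_range_one,
    gegenbauerCoeff_zero_right, hcoeff]
  simp only [ascPochhammer_one, Polynomial.eval_X, Nat.factorial_one, Nat.cast_one, div_one]
  ring

theorem gegenbauerCoeff_recurrence_zero (μ : ℂ) (n : ℕ) :
    ((n : ℂ) + 2) * gegenbauerCoeff μ (n + 2) 0
      = 2 * (n + 1 + μ) * gegenbauerCoeff μ (n + 1) 0 - (n + 2 * μ) * gegenbauerCoeff μ n 0 := by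
  have h₁ : (n : ℂ) + 1 ≠ 0 := Nat.cast_add_one_ne_zero n
  have h₂ : (n : ℂ) + 1 + 1 ≠ 0 := by exact_mod_cast Nat.cast_add_one_ne_zero (R := ℂ) (n + 1)
  simp only [gegenbauerCoeff_zero_right, ascPochhammer_succ_eval, Nat.factorial_succ, Nat.cast_mul,
    Nat.cast_succ]
  field_simp
  ring

theorem gegenbauerCoeff_recurrence_succ {i : ℕ} (hi : μ + 1 / 2 + i ≠ 0) (n : ℕ) :
    ((n : ℂ) + 2) * gegenbauerCoeff μ (n + 2) (i + 1)
      = 2 * (n + 1 + μ) * (gegenbauerCoeff μ (n + 1) (i + 1) - 2 * gegenbauerCoeff μ (n + 1) i)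
        - (n + 2 * μ) * gegenbauerCoeff μ n (i + 1) := by
  have hP₂ : (ascPochhammer ℂ (n + 2 + (i + 1))).eval (2 * μ)
      = (ascPochhammer ℂ (n + i + 1)).eval (2 * μ) * (2 * μ + (n + i + 1)) *
        (2 * μ + (n + i + 2)) := by
    rw [show n + 2 + (i + 1) = n + i + 1 + 1 + 1 by ring, ascPochhammer_succ_eval,
      ascPochhammer_succ_eval]
    push_cast
    ring
  have hP₁ : (ascPochhammer ℂ (n + 1 + (i + 1))).eval (2 * μ)
      = (ascPochhammer ℂ (n + i + 1)).eval (2 * μ) * (2 * μ + (n + i + 1)) := by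
    rw [show n + 1 + (i + 1) = n + i + 1 + 1 by ring, ascPochhammer_succ_eval]
    push_cast
    ring
  have hΓ₁ := Complex.one_div_Gamma_eq_self_mul_one_div_Gamma_add_one ((n : ℂ) - i)
  have hΓ₂ := Complex.one_div_Gamma_eq_self_mul_one_div_Gamma_add_one ((n : ℂ) - i + 1)
  rw [gegenbauerCoeff, gegenbauerCoeff, gegenbauerCoeff, gegenbauerCoeff, hP₂, hP₁,
    show n + (i + 1) = n + i + 1 by ring, show n + 1 + i = n + i + 1 by ring,
    ascPochhammer_succ_eval i, Nat.factorial_succ, Nat.cast_mul]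
  rw [show ((n + 2 : ℕ) : ℂ) - (i + 1 : ℕ) + 1 = n - i + 1 + 1 by push_cast; ring,
    show ((n + 1 : ℕ) : ℂ) - (i + 1 : ℕ) + 1 = n - i + 1 by push_cast; ring,
    show ((n + 1 : ℕ) : ℂ) - i + 1 = n - i + 1 + 1 by push_cast; ring,
    show (n : ℂ) - (i + 1 : ℕ) + 1 = n - i by push_cast; ring]
  have hi' : (i : ℂ) + 1 ≠ 0 := Nat.cast_add_one_ne_zero i
  simp only [div_eq_mul_inv _ (_ * _), mul_inv, hΓ₁, hΓ₂, Nat.cast_succ, pow_succ]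
  generalize hd : μ + 1 / 2 + (i : ℂ) = d at hi ⊢
  field_simp
  rw [← hd]
  ring

theorem gegenbauerC_recurrence (hμ : ∀ k : ℕ, μ + 1 / 2 ≠ -k) (x : ℝ) (n : ℕ) :
    ((n : ℂ) + 2) * gegenbauerC (n + 2) μ x
      = 2 * (n + 1 + μ) * x * gegenbauerC (n + 1) μ x - (n + 2 * μ) * gegenbauerC n μ x := by
  set v : ℂ := (1 - (x : ℂ)) / 2 with hv
  have hx : (x : ℂ) = 1 - 2 * v := by rw [hv]; ring
  have hxC : (x : ℂ) * gegenbauerC (n + 1) μ x = gegenbauerCoeff μ (n + 1) 0 +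
      ∑ j ∈ Finset.range (n + 2), (gegenbauerCoeff μ (n + 1) (j + 1)
        - 2 * gegenbauerCoeff μ (n + 1) j) * v ^ (j + 1) := by
    calc (x : ℂ) * gegenbauerC (n + 1) μ x
        = gegenbauerC (n + 1) μ x - 2 * v * gegenbauerC (n + 1) μ x := by rw [hx]; ring
      _ = ∑ j ∈ Finset.range (n + 3), gegenbauerCoeff μ (n + 1) j * v ^ j
          - 2 * v * ∑ j ∈ Finset.range (n + 2), gegenbauerCoeff μ (n + 1) j * v ^ j := by
        rw [← gegenbauerC_eq_sum μ x (by omega), ← gegenbauerC_eq_sum μ x (by omega)]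
      _ = _ := by
        rw [Finset.sum_range_succ', Finset.mul_sum, pow_zero, mul_one, add_comm, add_sub_assoc,
          ← Finset.sum_sub_distrib]
        exact congrArg _ (Finset.sum_congr rfl fun j _ => by ring)
  have hsum : ((n : ℂ) + 2) *
        ∑ j ∈ Finset.range (n + 2), gegenbauerCoeff μ (n + 2) (j + 1) * v ^ (j + 1)
      = 2 * (n + 1 + μ) * (∑ j ∈ Finset.range (n + 2), (gegenbauerCoeff μ (n + 1) (j + 1)
        - 2 * gegenbauerCoeff μ (n + 1) j) * v ^ (j + 1)) - (n + 2 * μ) *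
        ∑ j ∈ Finset.range (n + 2), gegenbauerCoeff μ n (j + 1) * v ^ (j + 1) := by
    simp only [Finset.mul_sum, ← Finset.sum_sub_distrib]
    refine Finset.sum_congr rfl fun j _ => ?_
    linear_combination v ^ (j + 1) *
      gegenbauerCoeff_recurrence_succ (fun h => hμ j (eq_neg_of_add_eq_zero_left h)) n
  rw [mul_assoc, hxC, gegenbauerC_eq_sum μ x (show n + 2 < n + 3 by omega),
    gegenbauerC_eq_sum μ x (show n < n + 3 by omega), Finset.sum_range_succ',
    Finset.sum_range_succ' (n := n + 2), ← hv, pow_zero, mul_one, mul_one]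
  linear_combination gegenbauerCoeff_recurrence_zero μ n + hsum

theorem isSubexponential_gegenbauerC (hμ : ∀ k : ℕ, μ + 1 / 2 ≠ -k) (γ : ℝ) :
    IsSubexponential fun n => gegenbauerC n μ (Real.cos γ) := by
  have hnorm : ‖Complex.exp (γ * Complex.I)‖ = 1 := Complex.norm_exp_ofReal_mul_I γ
  have hsum : Complex.exp (γ * Complex.I) + (Complex.exp (γ * Complex.I))⁻¹
      = 2 * (Real.cos γ : ℂ) := by
    rw [Complex.ofReal_cos, Complex.two_cos, ← Complex.exp_neg, neg_mul]
  refine .of_recurrence (α := Complex.exp (γ * Complex.I)) (β := (Complex.exp (γ * Complex.I))⁻¹)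
    (p := fun n => 2 * Real.cos γ * ((1 + μ + 1 * n) / (2 + 1 * n)))
    (q := fun n => -((2 * μ + 1 * n) / (2 + 1 * n))) hnorm.le (by rw [norm_inv, hnorm, inv_one])
    ?_ ?_ (.of_forall fun n => ?_)
  · rw [hsum]
    simpa only [div_one, mul_one] using
      (tendsto_add_mul_div_add_mul_atTop_nhds (1 + μ) 2 1 one_ne_zero).const_mul
        (2 * (Real.cos γ : ℂ))
  · rw [mul_inv_cancel₀ (Complex.exp_ne_zero _)]
    simpa only [div_one] using
      (tendsto_add_mul_div_add_mul_atTop_nhds (2 * μ) 2 (1 : ℂ) one_ne_zero).neg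
  · have hn : (n : ℂ) + 2 ≠ 0 := by exact_mod_cast (by omega : n + 2 ≠ 0)
    refine mul_left_cancel₀ hn ((gegenbauerC_recurrence hμ _ n).trans ?_)
    rw [one_mul, add_comm 2 (n : ℂ)]
    field_simp
    ring

/-- The Gegenbauer polynomials with an integer index, zero for negative indices. -/
noncomputable def gegenbauerInt (μ : ℂ) (x : ℝ) : ℤ → ℂ
  | .ofNat n => gegenbauerC n μ x
  | .negSucc _ => 0

theorem gegenbauerInt_natCast (μ : ℂ) (x : ℝ) (n : ℕ) :
    gegenbauerInt μ x n = gegenbauerC n μ x := rfl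

theorem gegenbauerInt_of_neg (μ : ℂ) (x : ℝ) {n : ℤ} (hn : n < 0) : gegenbauerInt μ x n = 0 := by
  obtain ⟨k, rfl⟩ := Int.eq_negSucc_of_lt_zero hn
  rfl

theorem gegenbauerInt_recurrence (hμ : ∀ k : ℕ, μ + 1 / 2 ≠ -k) (x : ℝ) (n : ℤ) :
    2 * (n + μ) * x * gegenbauerInt μ x n
      = (n + 1) * gegenbauerInt μ x (n + 1) + (n + 2 * μ - 1) * gegenbauerInt μ x (n - 1) := by
  match n with
  | .negSucc 0 => simp [gegenbauerInt_of_neg]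
  | .negSucc (k + 1) =>
    rw [gegenbauerInt_of_neg μ x (by omega), gegenbauerInt_of_neg μ x (by omega),
      gegenbauerInt_of_neg μ x (by omega)]
    simp
  | 0 =>
    have h₀ : gegenbauerInt μ x 0 = 1 := gegenbauerC_zero μ x
    have h₁ : gegenbauerInt μ x 1 = 2 * μ * x :=
      gegenbauerC_one (by simpa only [Nat.cast_zero, neg_zero] using hμ 0) x
    simp [h₀, h₁, gegenbauerInt_of_neg]
  | (n + 1 : ℕ) =>
    have h := gegenbauerC_recurrence hμ x n
    rw [show ((n + 1 : ℕ) : ℤ) + 1 = (n + 2 : ℕ) by push_cast; ring,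
      show ((n + 1 : ℕ) : ℤ) - 1 = n by push_cast; ring]
    simp only [gegenbauerInt_natCast]
    push_cast
    linear_combination -h

/-- The coefficient of `C_{m - 2 k}^μ` in the expansion of `(2 x) ^ m / (m! Γ(μ))` in Gegenbauer
polynomials. -/
noncomputable def gegenbauerMonomialCoeff (μ : ℂ) (m k : ℕ) : ℂ :=
  ((m - 2 * k : ℂ) + μ) / (k.factorial * Complex.Gamma (μ + m - k + 1))

theorem gegenbauerMonomialCoeff_succ_zero (μ : ℂ) (m : ℕ) :
    ((m : ℂ) + 1) * gegenbauerMonomialCoeff μ (m + 1) 0 = (m + 1) / Complex.Gamma (μ + m + 1) := by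
  have hcoeff : gegenbauerMonomialCoeff μ (m + 1) 0
      = (μ + m + 1) * (Complex.Gamma (μ + m + 1 + 1))⁻¹ := by
    rw [gegenbauerMonomialCoeff, Nat.factorial_zero, div_eq_mul_inv]
    push_cast
    ring_nf
  rw [hcoeff, ← Complex.one_div_Gamma_eq_self_mul_one_div_Gamma_add_one, div_eq_mul_inv]

theorem gegenbauerMonomialCoeff_succ_succ (μ : ℂ) (m k : ℕ) :
    ((m : ℂ) + 1) * gegenbauerMonomialCoeff μ (m + 1) (k + 1)
      = (m - 2 * (k + 1) + 1) / ((k + 1).factorial * Complex.Gamma (μ + m - (k + 1) + 1))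
        + (m - 2 * k + 2 * μ - 1) / (k.factorial * Complex.Gamma (μ + m - k + 1)) := by
  have hΓ := Complex.one_div_Gamma_eq_self_mul_one_div_Gamma_add_one (μ + m - (k + 1) + 1)
  rw [show μ + (m : ℂ) - (k + 1) + 1 + 1 = μ + m - k + 1 by ring] at hΓ
  have hk : (k : ℂ) + 1 ≠ 0 := Nat.cast_add_one_ne_zero k
  simp only [gegenbauerMonomialCoeff, div_eq_mul_inv, mul_inv, hΓ, Nat.factorial_succ,
    Nat.cast_mul, Nat.cast_succ]
  rw [show μ + ((m : ℂ) + 1) - (k + 1) + 1 = μ + m - k + 1 by ring]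
  field_simp
  ring

theorem two_mul_mul_gegenbauerMonomialCoeff_mul (hμ : ∀ k : ℕ, μ + 1 / 2 ≠ -k) (x : ℝ)
    (m k : ℕ) :
    2 * (x : ℂ) * (gegenbauerMonomialCoeff μ m k * gegenbauerInt μ x (m - 2 * k))
      = (m - 2 * k + 1) / (k.factorial * Complex.Gamma (μ + m - k + 1))
          * gegenbauerInt μ x (m + 1 - 2 * k)
        + (m - 2 * k + 2 * μ - 1) / (k.factorial * Complex.Gamma (μ + m - k + 1))
          * gegenbauerInt μ x (m + 1 - 2 * (k + 1)) := by
  have h := gegenbauerInt_recurrence hμ x (m - 2 * k)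
  rw [show (m : ℤ) - 2 * k + 1 = m + 1 - 2 * k by ring,
    show (m : ℤ) - 2 * k - 1 = m + 1 - 2 * (k + 1) by ring] at h
  push_cast at h
  rw [gegenbauerMonomialCoeff]
  linear_combination h / (k.factorial * Complex.Gamma (μ + m - k + 1))

theorem two_mul_mul_sum_gegenbauerMonomialCoeff (hμ : ∀ k : ℕ, μ + 1 / 2 ≠ -k) (x : ℝ) (m : ℕ) :
    2 * (x : ℂ) * ∑ k ∈ Finset.range (m + 1),
        gegenbauerMonomialCoeff μ m k * gegenbauerInt μ x (m - 2 * k)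
      = (m + 1) * ∑ k ∈ Finset.range (m + 2),
        gegenbauerMonomialCoeff μ (m + 1) k * gegenbauerInt μ x (m + 1 - 2 * k) := by
  have hlast : gegenbauerInt μ x (m + 1 - 2 * ((m + 1 : ℕ) : ℤ)) = 0 :=
    gegenbauerInt_of_neg μ x (by push_cast; omega)
  have hextend : ∑ k ∈ Finset.range (m + 1), (m - 2 * k + 1 : ℂ) /
        (k.factorial * Complex.Gamma (μ + m - k + 1)) * gegenbauerInt μ x (m + 1 - 2 * k)
      = ∑ k ∈ Finset.range (m + 2), (m - 2 * k + 1 : ℂ) /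
        (k.factorial * Complex.Gamma (μ + m - k + 1)) * gegenbauerInt μ x (m + 1 - 2 * k) := by
    rw [Finset.sum_range_succ _ (m + 1), hlast, mul_zero, add_zero]
  rw [Finset.mul_sum, Finset.sum_congr rfl fun k _ =>
    two_mul_mul_gegenbauerMonomialCoeff_mul hμ x m k, Finset.sum_add_distrib, hextend,
    Finset.mul_sum, Finset.sum_range_succ', Finset.sum_range_succ' _ (m + 1), add_right_comm,
    ← Finset.sum_add_distrib]
  congr 1
  · refine Finset.sum_congr rfl fun k _ => ?_
    rw [← mul_assoc, gegenbauerMonomialCoeff_succ_succ]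
    push_cast
    ring
  · rw [← mul_assoc, gegenbauerMonomialCoeff_succ_zero]
    simp

theorem pow_div_factorial_eq_sum_gegenbauerInt (hΓ : ∀ k : ℕ, μ ≠ -k)
    (hμ : ∀ k : ℕ, μ + 1 / 2 ≠ -k) (x : ℝ) (m : ℕ) :
    (2 * (x : ℂ)) ^ m / m.factorial = Complex.Gamma μ * ∑ k ∈ Finset.range (m + 1),
      gegenbauerMonomialCoeff μ m k * gegenbauerInt μ x (m - 2 * k) := by
  induction m with
  | zero =>
    have hΓμ := Complex.Gamma_ne_zero hΓ
    have hμ0 : μ ≠ 0 := by simpa using hΓ 0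
    have h₀ : gegenbauerInt μ x 0 = 1 := gegenbauerC_zero μ x
    simp only [pow_zero, Nat.factorial_zero, Nat.cast_one, div_one, zero_add, Finset.range_one,
      gegenbauerMonomialCoeff, Nat.cast_zero, zero_sub, add_zero, Finset.sum_singleton, mul_zero,
      neg_zero, sub_zero, Complex.Gamma_add_one μ hμ0, one_mul, h₀, mul_one]
    field_simp
  | succ m ih =>
    have hm : (m : ℂ) + 1 ≠ 0 := Nat.cast_add_one_ne_zero m
    calc (2 * (x : ℂ)) ^ (m + 1) / (m + 1).factorial
        = (m + 1 : ℂ)⁻¹ * (2 * x * ((2 * (x : ℂ)) ^ m / m.factorial)) := by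
          rw [Nat.factorial_succ, pow_succ]; push_cast; field_simp
      _ = _ := by
          rw [ih, mul_left_comm (2 * (x : ℂ)), two_mul_mul_sum_gegenbauerMonomialCoeff hμ,
            mul_left_comm, inv_mul_cancel_left₀ hm]
          push_cast
          rfl

end Gegenbauer

/-! ### The product formula -/

/-- A sequence of functions on the disc of radius `R` about `p`, each the negative derivative of
the previous one, whose `n`-th member solves the Gegenbauer equation of order `μ + n`, that is,
Legendre's equation of order `μ + n` after division by `(1 - z ^ 2) ^ ((μ + n) / 2)`. The addition
theorems hold for every such sequence. -/
structure IsGegenbauerFamily (ν μ p : ℂ) (R : ℝ) (G : ℕ → ℂ → ℂ) : Prop where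
  hasDerivAt : ∀ n, ∀ z ∈ Metric.ball p R, HasDerivAt (G n) (-G (n + 1) z) z
  ode : ∀ n : ℕ, ∀ z ∈ Metric.ball p R, (1 - z ^ 2) * G (n + 2) z
    + 2 * (μ + n + 1) * z * G (n + 1) z + (ν - (μ + n)) * (ν + (μ + n) + 1) * G n z = 0

namespace IsGegenbauerFamily

variable {ν μ p : ℂ} {R : ℝ} {G : ℕ → ℂ → ℂ}

theorem shift (hG : IsGegenbauerFamily ν μ p R G) (n : ℕ) :
    IsGegenbauerFamily ν (μ + n) p R fun k => G (k + n) where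
  hasDerivAt k z hz := by
    rw [Nat.add_right_comm]
    exact hG.hasDerivAt (k + n) z hz
  ode k z hz := by
    rw [Nat.add_right_comm k 2, Nat.add_right_comm k 1]
    have hode := hG.ode (k + n) z hz
    push_cast at hode
    linear_combination hode

theorem reflect (hG : IsGegenbauerFamily ν μ p R G) :
    IsGegenbauerFamily ν μ (-p) R fun n z => (-1) ^ n * G n (-z) := by
  have hneg : ∀ z ∈ Metric.ball (-p) R, -z ∈ Metric.ball p R := fun z hz => by
    simpa [dist_eq_norm, ← norm_neg (-z - p), add_comm] using hz
  refine ⟨fun n z hz => ?_, fun n z hz => ?_⟩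
  · refine (((hG.hasDerivAt n (-z) (hneg z hz)).scomp z (hasDerivAt_neg z)).const_mul
      ((-1) ^ n)).congr_deriv ?_
    simp [pow_succ]
  · linear_combination (-1) ^ n * hG.ode n (-z) (hneg z hz)

theorem differentiableOn (hG : IsGegenbauerFamily ν μ p R G) (n : ℕ) :
    DifferentiableOn ℂ (G n) (Metric.ball p R) := fun z hz =>
  (hG.hasDerivAt n z hz).differentiableAt.differentiableWithinAt

theorem iteratedDeriv_eq (hG : IsGegenbauerFamily ν μ p R G) (k : ℕ) :
    ∀ z ∈ Metric.ball p R, iteratedDeriv k (G 0) z = (-1) ^ k * G k z := by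
  induction k with
  | zero => simp
  | succ k ih =>
    intro z hz
    have heq : iteratedDeriv k (G 0) =ᶠ[𝓝 z] fun z => (-1) ^ k * G k z := by
      filter_upwards [Metric.isOpen_ball.mem_nhds hz] using ih
    rw [iteratedDeriv_succ, heq.deriv_eq, ((hG.hasDerivAt k z hz).const_mul _).deriv, pow_succ]
    ring

/-- Cauchy's estimates. -/
theorem exists_norm_le (hG : IsGegenbauerFamily ν μ p R G) {z₁ : ℂ} {r : ℝ} (hr : 0 < r)
    (hrR : ‖z₁ - p‖ + r < R) : ∃ δ > 0, ∃ M, 0 ≤ M ∧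
      ∀ z ∈ Metric.ball z₁ δ, ∀ k, ‖G k z‖ ≤ k.factorial * M / r ^ k := by
  obtain ⟨δ, hδ, hδR⟩ := exists_between (sub_pos.2 hrR)
  have hsub : Metric.closedBall z₁ (r + δ) ⊆ Metric.ball p R := by
    refine (Metric.closedBall_subset_ball' (ε₂ := R) ?_)
    rw [dist_eq_norm]
    linarith
  obtain ⟨M, hM⟩ := (isCompact_closedBall z₁ (r + δ)).exists_bound_of_continuousOn
    ((hG.differentiableOn 0).continuousOn.mono hsub)
  refine ⟨δ, hδ, M, (norm_nonneg _).trans (hM z₁ (Metric.mem_closedBall_self (by linarith))),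
    fun z hz k => ?_⟩
  have hball : Metric.closedBall z r ⊆ Metric.closedBall z₁ (r + δ) :=
    Metric.closedBall_subset_closedBall' (by linarith [Metric.mem_ball.1 hz])
  have hdiff : DiffContOnCl ℂ (G 0) (Metric.ball z r) := by
    apply DifferentiableOn.diffContOnCl
    rw [closure_ball z hr.ne']
    exact (hG.differentiableOn 0).mono (hball.trans hsub)
  have hcauchy := Complex.norm_iteratedDeriv_le_of_forall_mem_sphere_norm_le k hr hdiff
    fun w hw => hM w (hball (Metric.sphere_subset_closedBall hw))
  rw [hG.iteratedDeriv_eq k z (hsub (hball (Metric.mem_closedBall_self hr.le)))] at hcauchy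
  simpa using hcauchy

end IsGegenbauerFamily

/-- The coefficients `1 / (k! Γ(μ + k + 1))` of the Bessel function of order `μ`. -/
noncomputable def besselCoeff (μ : ℂ) (k : ℕ) : ℂ :=
  (k.factorial * Complex.Gamma (μ + k + 1))⁻¹

theorem besselCoeff_eq_mul_succ (μ : ℂ) (k : ℕ) :
    besselCoeff μ k = (k + 1) * (μ + k + 1) * besselCoeff μ (k + 1) := by
  have hk : (k : ℂ) + 1 ≠ 0 := Nat.cast_add_one_ne_zero k
  simp only [besselCoeff, Nat.factorial_succ, Nat.cast_mul, Nat.cast_add, Nat.cast_one, mul_inv,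
    Complex.one_div_Gamma_eq_self_mul_one_div_Gamma_add_one (μ + k + 1), ← add_assoc]
  field_simp

/-- Up to a factor `2 ^ (2 * k)`, these numbers are the quotients `(2 * k)! / (k! Γ(μ + k + 1))`
which occur when Cauchy's estimates are applied to a series with Bessel coefficients. -/
noncomputable def factorialDivGamma (μ : ℂ) (k : ℕ) : ℂ :=
  k.factorial / Complex.Gamma (μ + k + 1)

theorem isSubexponential_factorialDivGamma (μ : ℂ) : IsSubexponential (factorialDivGamma μ) := by
  refine HypergeometricRecursion.isSubexponential (a := 1) (b := 1) (c := μ + 1) fun k => ?_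
  simp only [factorialDivGamma, Nat.factorial_succ, Nat.cast_mul, Nat.cast_add, Nat.cast_one,
    div_eq_mul_inv, Complex.one_div_Gamma_eq_self_mul_one_div_Gamma_add_one (μ + k + 1),
    ← add_assoc]
  ring

theorem factorial_add_two_mul_le (n k : ℕ) :
    ((n + 2 * k).factorial : ℝ) ≤ 2 ^ (n + 2 * k) * (k.factorial * (n + k).factorial) := by
  have hfact := Nat.add_choose_mul_factorial_mul_factorial k (n + k)
  have hchoose := Nat.choose_le_two_pow (k + (n + k)) (n + k)
  rw [show k + (n + k) = n + 2 * k by ring] at hfact hchoose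
  rw [← hfact, mul_assoc]
  push_cast
  gcongr
  exact_mod_cast hchoose

theorem norm_besselCoeff_mul_factorial_le (μ : ℂ) (n k : ℕ) :
    ‖besselCoeff (μ + n) k‖ * (n + 2 * k).factorial
      ≤ ‖factorialDivGamma μ (n + k)‖ * 2 ^ (n + 2 * k) := by
  have hcoeff : besselCoeff (μ + n) k
      = factorialDivGamma μ (n + k) / (k.factorial * (n + k).factorial) := by
    have hne : ((n + k).factorial : ℂ) ≠ 0 := Nat.cast_ne_zero.2 (n + k).factorial_ne_zero
    rw [besselCoeff, factorialDivGamma, Nat.cast_add, ← add_assoc, mul_inv]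
    field_simp
  rw [hcoeff, norm_div, norm_mul, Complex.norm_natCast, Complex.norm_natCast, div_mul_eq_mul_div,
    div_le_iff₀ (by positivity), mul_assoc]
  gcongr
  exact factorial_add_two_mul_le n k

/-- The domain of convergence of the product formula `tsum_productTerm_eq`. -/
def productDomain (p : ℂ) (R : ℝ) (y : ℂ) : Set ℂ :=
  {w | ‖(1 - 2 * w) * y - p‖ + 2 * √‖w * (1 - w) * (1 - y ^ 2)‖ < R}

/-- The terms of the series in the product formula `tsum_productTerm_eq`. -/
noncomputable def productTerm (μ : ℂ) (G : ℕ → ℂ → ℂ) (y : ℂ) (k : ℕ) (w : ℂ) : ℂ :=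
  besselCoeff μ k * ((w * (1 - w) * (1 - y ^ 2)) ^ k * G (2 * k) ((1 - 2 * w) * y))

section Product

variable {ν μ μ' p y w w₁ : ℂ} {R : ℝ} {G : ℕ → ℂ → ℂ}

theorem isOpen_productDomain (p : ℂ) (R : ℝ) (y : ℂ) : IsOpen (productDomain p R y) :=
  isOpen_lt (by fun_prop) continuous_const

theorem one_sub_two_mul_mul_mem_ball (hw : w ∈ productDomain p R y) :
    (1 - 2 * w) * y ∈ Metric.ball p R := by
  rw [mem_ball_iff_norm]
  exact lt_of_le_of_lt (le_add_of_nonneg_right (by positivity)) hw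

theorem exists_norm_productTerm_le (μ : ℂ) (hG : IsGegenbauerFamily ν μ' p R G)
    (hw : w₁ ∈ productDomain p R y) :
    ∃ t ∈ 𝓝 w₁, ∃ u : ℕ → ℝ, Summable u ∧ ∀ k, ∀ w ∈ t, ‖productTerm μ G y k w‖ ≤ u k := by
  set base : ℂ → ℂ := fun w => w * (1 - w) * (1 - y ^ 2)
  have hbound : ‖(1 - 2 * w₁) * y - p‖ + 2 * √‖base w₁‖ < R := hw
  obtain ⟨r, hr₁, hr₂⟩ := exists_between (lt_sub_iff_add_lt'.2 hbound)
  have hr₀ : 0 < r := lt_of_le_of_lt (by positivity) hr₁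
  obtain ⟨τ, hτ₁, hτ₂⟩ := exists_between (show √‖base w₁‖ < r / 2 by linarith)
  have hτ₀ : 0 < τ := lt_of_le_of_lt (Real.sqrt_nonneg _) hτ₁
  obtain ⟨δ, hδ, M, hM₀, hM⟩ := hG.exists_norm_le hr₀ (lt_sub_iff_add_lt'.1 hr₂)
  have hopen : {w | ‖base w‖ < τ ^ 2} ∩ {w | (1 - 2 * w) * y ∈ Metric.ball _ δ} ∈ 𝓝 w₁ :=
    ((isOpen_lt (by fun_prop) continuous_const).inter
      (Metric.isOpen_ball.preimage (by fun_prop))).mem_nhds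
      ⟨(Real.sqrt_lt' hτ₀).1 hτ₁, Metric.mem_ball_self hδ⟩
  have hq : 2 * τ / r < 1 := by rw [div_lt_one hr₀]; linarith
  refine ⟨_, hopen, _, (((isSubexponential_factorialDivGamma μ).summable_norm_mul_pow
    (sq_nonneg (2 * τ / r)) (pow_lt_one₀ (by positivity) hq two_ne_zero)).mul_left M),
    fun k w hw => ?_⟩
  have hcoeff := norm_besselCoeff_mul_factorial_le μ 0 k
  simp only [Nat.cast_zero, add_zero, zero_add] at hcoeff
  calc ‖productTerm μ G y k w‖
      = ‖besselCoeff μ k‖ * (‖base w‖ ^ k * ‖G (2 * k) ((1 - 2 * w) * y)‖) := by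
        rw [productTerm, norm_mul, norm_mul, norm_pow]
    _ ≤ ‖besselCoeff μ k‖ * ((τ ^ 2) ^ k * ((2 * k).factorial * M / r ^ (2 * k))) := by
        gcongr
        exacts [hw.1.le, hM _ hw.2 _]
    _ = ‖besselCoeff μ k‖ * (2 * k).factorial * (M * (τ / r) ^ (2 * k)) := by
        rw [div_pow, pow_mul τ]; ring
    _ ≤ ‖factorialDivGamma μ k‖ * 2 ^ (2 * k) * (M * (τ / r) ^ (2 * k)) := by gcongr
    _ = M * (‖factorialDivGamma μ k‖ * ((2 * τ / r) ^ 2) ^ k) := by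
        rw [← pow_mul, mul_div_assoc, mul_pow]; ring

theorem tendstoLocallyUniformlyOn_productTerm (μ : ℂ) (hG : IsGegenbauerFamily ν μ' p R G) :
    TendstoLocallyUniformlyOn (fun N w => ∑ k ∈ Finset.range N, productTerm μ G y k w)
      (fun w => ∑' k, productTerm μ G y k w) atTop (productDomain p R y) :=
  tendstoLocallyUniformlyOn_of_forall_exists_nhds fun _ hw =>
    have ⟨t, ht, _, hu, hle⟩ := exists_norm_productTerm_le μ hG hw
    ⟨t, mem_nhdsWithin_of_mem_nhds ht, tendstoUniformlyOn_tsum_nat hu hle⟩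

theorem tendsto_productTerm_zero (μ : ℂ) (hG : IsGegenbauerFamily ν μ' p R G)
    (hw : w ∈ productDomain p R y) :
    Tendsto (fun k => productTerm μ G y k w) atTop (𝓝 0) :=
  have ⟨_, ht, _, hu, hle⟩ := exists_norm_productTerm_le μ hG hw
  (hu.of_norm_bounded fun k => hle k w (mem_of_mem_nhds ht)).tendsto_atTop_zero

theorem IsGegenbauerFamily.hasDerivAt_comp (hG : IsGegenbauerFamily ν μ p R G)
    (hw : (1 - 2 * w) * y ∈ Metric.ball p R) (j : ℕ) :
    HasDerivAt (fun w => G j ((1 - 2 * w) * y)) (2 * y * G (j + 1) ((1 - 2 * w) * y)) w := by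
  have haffine : HasDerivAt (fun w : ℂ => (1 - 2 * w) * y) (-2 * y) w := by
    simpa using (((hasDerivAt_id w).const_mul 2).const_sub 1).mul_const y
  refine ((hG.hasDerivAt j _ hw).scomp w haffine).congr_deriv ?_
  rw [smul_eq_mul]
  ring

theorem differentiableOn_productTerm (hG : IsGegenbauerFamily ν μ' p R G) (k : ℕ) :
    DifferentiableOn ℂ (productTerm μ G y k) (productDomain p R y) := fun w hw =>
  DifferentiableAt.differentiableWithinAt <| .const_mul (.fun_mul (by fun_prop)
    (hG.hasDerivAt_comp (one_sub_two_mul_mul_mem_ball hw) (2 * k)).differentiableAt) _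

theorem hasDerivAt_mul_one_sub_mul (κ w : ℂ) :
    HasDerivAt (fun w => w * (1 - w) * κ) ((1 - 2 * w) * κ) w := by
  refine (((hasDerivAt_id w).mul ((hasDerivAt_id w).const_sub 1)).mul_const κ).congr_deriv ?_
  simp only [id]
  ring

theorem natCast_mul_pow_pred_mul (k : ℕ) (x : ℂ) : k * x ^ (k - 1) * x = k * x ^ k := by
  rcases k with _ | k
  · simp
  · rw [Nat.add_sub_cancel, pow_succ]; ring

theorem natCast_mul_pred_mul_pow_pred_mul (k : ℕ) (x : ℂ) :
    k * (k - 1 : ℕ) * x ^ (k - 1 - 1) * x = k * (k - 1) * x ^ (k - 1) := by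
  rw [mul_assoc, mul_assoc, ← mul_assoc _ _ x, natCast_mul_pow_pred_mul, ← mul_assoc]
  rcases k with _ | k <;> simp

theorem hypergeometricOperator_productTerm (hG : IsGegenbauerFamily ν μ p R G)
    (hw : w ∈ productDomain p R y) (k : ℕ) :
    hypergeometricOperator (μ - ν) (ν + μ + 1) (μ + 1) (productTerm μ G y k) w
      = (1 - y ^ 2) * (k * (μ + k) * besselCoeff μ k
          * ((w * (1 - w) * (1 - y ^ 2)) ^ (k - 1) * G (2 * k) ((1 - 2 * w) * y))
        - productTerm μ (fun n => G (n + 2)) y k w) := by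
  have hball := one_sub_two_mul_mul_mem_ball hw
  have hbase := hasDerivAt_mul_one_sub_mul (1 - y ^ 2)
  have hbase' : HasDerivAt (fun w : ℂ => (1 - 2 * w) * (1 - y ^ 2)) (-2 * (1 - y ^ 2)) w := by
    simpa using (((hasDerivAt_id w).const_mul 2).const_sub 1).mul_const (1 - y ^ 2)
  rw [hypergeometricOperator_eq_of_hasDerivAt
    (f₁ := fun w => besselCoeff μ k * (k * (w * (1 - w) * (1 - y ^ 2)) ^ (k - 1)
      * ((1 - 2 * w) * (1 - y ^ 2)) * G (2 * k) ((1 - 2 * w) * y)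
      + (w * (1 - w) * (1 - y ^ 2)) ^ k * (2 * y * G (2 * k + 1) ((1 - 2 * w) * y))))
    (by
      filter_upwards [(isOpen_productDomain p R y).mem_nhds hw] with v hv
      exact (((hbase v).fun_pow k).fun_mul
        (hG.hasDerivAt_comp (one_sub_two_mul_mul_mem_ball hv) (2 * k))).const_mul _)
    ((((((hbase w).fun_pow (k - 1)).const_mul (k : ℂ)).fun_mul hbase').fun_mul
      (hG.hasDerivAt_comp hball (2 * k)) |>.fun_add (((hbase w).fun_pow k).fun_mul
        ((hG.hasDerivAt_comp hball (2 * k + 1)).const_mul (2 * y)))).const_mul _)]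
  have hode := hG.ode (2 * k) _ hball
  simp only [productTerm]
  set S := w * (1 - w) * (1 - y ^ 2)
  have hpow₁ := natCast_mul_pow_pred_mul k S
  have hpow₂ := natCast_mul_pred_mul_pow_pred_mul k S
  push_cast at hode
  generalize G (2 * k) ((1 - 2 * w) * y) = g₀ at *
  generalize G (2 * k + 1) ((1 - 2 * w) * y) = g₁ at *
  generalize G (2 * k + 2) ((1 - 2 * w) * y) = g₂ at *
  linear_combination besselCoeff μ k * (S ^ k * hode
    + (1 - 2 * w) ^ 2 * (1 - y ^ 2) * g₀ * hpow₂
    + (4 * y * (1 - 2 * w) * g₁ - (4 * (k + μ) + 2) * g₀) * hpow₁)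

theorem hypergeometricOperator_sum_productTerm (hG : IsGegenbauerFamily ν μ p R G)
    (hw : w ∈ productDomain p R y) (N : ℕ) :
    hypergeometricOperator (μ - ν) (ν + μ + 1) (μ + 1)
        (fun w => ∑ k ∈ Finset.range (N + 1), productTerm μ G y k w) w
      = -(1 - y ^ 2) * productTerm μ (fun n => G (n + 2)) y N w := by
  rw [hypergeometricOperator_sum _ (isOpen_productDomain p R y)
    (fun k _ => differentiableOn_productTerm hG k) hw]
  induction N with
  | zero =>
    rw [zero_add, Finset.sum_range_one, hypergeometricOperator_productTerm hG hw, Nat.cast_zero]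
    ring
  | succ N ih =>
    rw [Finset.sum_range_succ, ih, hypergeometricOperator_productTerm hG hw]
    simp only [productTerm, besselCoeff_eq_mul_succ μ N, Nat.add_sub_cancel, mul_add, mul_one]
    push_cast
    ring

theorem isHypergeometricSolutionOn_tsum_productTerm (hG : IsGegenbauerFamily ν μ p R G) :
    IsHypergeometricSolutionOn (μ - ν) (ν + μ + 1) (μ + 1)
      (fun w => ∑' k, productTerm μ G y k w) (productDomain p R y) := by
  have hlim := tendstoLocallyUniformlyOn_productTerm (y := y) μ hG
  have hopen := isOpen_productDomain p R y
  have hdiff : ∀ N, DifferentiableOn ℂ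
      (fun w => ∑ k ∈ Finset.range N, productTerm μ G y k w) (productDomain p R y) :=
    fun N => .fun_sum fun k _ => differentiableOn_productTerm hG k
  refine ⟨hlim.differentiableOn (.of_forall hdiff) hopen, fun w hw => ?_⟩
  refine tendsto_nhds_unique
    ((tendsto_add_atTop_iff_nat 1).2 (tendsto_hypergeometricOperator hopen hdiff hlim hw)) ?_
  simp only [hypergeometricOperator_sum_productTerm hG hw]
  have hzero := (tendsto_productTerm_zero μ (hG.shift 2) hw).const_mul (-(1 - y ^ 2))
  rwa [mul_zero] at hzero

theorem tsum_productTerm_eq (hμ : ∀ k : ℕ, μ + 1 ≠ -k) (hG : IsGegenbauerFamily ν μ p R G)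
    (hseg : segment ℝ 0 w ⊆ productDomain p R y ∩ Metric.ball 0 1) :
    ∑' k, productTerm μ G y k w
      = G 0 y * Complex.regularizedGaussHGFun (μ - ν) (ν + μ + 1) (μ + 1) w := by
  have h0 := hseg (left_mem_segment ℝ 0 w)
  have hcomp := connectedComponentIn_subset (productDomain p R y ∩ Metric.ball 0 1) 0
  refine ((isHypergeometricSolutionOn_tsum_productTerm hG).mono
      (hcomp.trans Set.inter_subset_left)).eqOn
    (((isHypergeometricSolutionOn_regularizedGaussHGFun _ _ _).const_mul (G 0 y)).mono
      (hcomp.trans Set.inter_subset_right)) hμ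
    ((isOpen_productDomain p R y).inter Metric.isOpen_ball).connectedComponentIn
    isPreconnected_connectedComponentIn (mem_connectedComponentIn h0) ?_
    ((convex_segment (0 : ℂ) w).isPreconnected.subset_connectedComponentIn
      (left_mem_segment ℝ 0 w) hseg (right_mem_segment ℝ 0 w))
  rw [tsum_eq_single 0 fun k hk => by simp [productTerm, hk], regularizedGaussHGFun_zero]
  simp [productTerm, besselCoeff, mul_comm]

end Product

/-! ### The expansion in Gegenbauer polynomials -/

theorem tsum_add_two_mul_eq_tsum_sum_range {f : ℕ → ℕ → ℂ} (hf : ∀ m k, m < 2 * k → f m k = 0)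
    (hsum : Summable fun nk : ℕ × ℕ => f (nk.1 + 2 * nk.2) nk.2) :
    ∑' nk : ℕ × ℕ, f (nk.1 + 2 * nk.2) nk.2 = ∑' m, ∑ k ∈ Finset.range (m + 1), f m k := by
  let i : ℕ × ℕ → ℕ × ℕ := fun nk => (nk.1 + 2 * nk.2, nk.2)
  have hi : Function.Injective i := fun a b h => by
    simp only [i, Prod.mk.injEq] at h
    ext <;> omega
  have hzero : ∀ mk ∉ Set.range i, f mk.1 mk.2 = 0 := fun mk hmk =>
    hf _ _ (not_le.1 fun hle => hmk ⟨(mk.1 - 2 * mk.2, mk.2), Prod.ext (by grind) rfl⟩)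
  have hsum' : Summable fun mk : ℕ × ℕ => f mk.1 mk.2 := (hi.summable_iff hzero).1 hsum
  calc ∑' nk : ℕ × ℕ, f (nk.1 + 2 * nk.2) nk.2 = ∑' mk : ℕ × ℕ, f mk.1 mk.2 :=
        hi.tsum_eq (f := fun mk => f mk.1 mk.2) (Function.support_subset_iff'.2 hzero)
    _ = ∑' m, ∑' k, f m k := hsum'.tsum_prod
    _ = ∑' m, ∑ k ∈ Finset.range (m + 1), f m k := tsum_congr fun m =>
        tsum_eq_sum fun k hk => hf m k (by grind)

/-- The terms of the double series obtained by expanding the powers of `2 * s * cos γ` in the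
Taylor series of `G 0 (z + 2 * s * cos γ)` in Gegenbauer polynomials. -/
noncomputable def gegenbauerDoubleTerm (μ : ℂ) (G : ℕ → ℂ → ℂ) (γ : ℝ) (z s : ℂ) (n k : ℕ) : ℂ :=
  ((n : ℂ) + μ) * gegenbauerC n μ (Real.cos γ) *
    (besselCoeff (μ + n) k * ((-s) ^ (n + 2 * k) * G (n + 2 * k) z))

section Expansion

variable {ν μ p y z w s : ℂ} {R : ℝ} {G : ℕ → ℂ → ℂ}

theorem IsGegenbauerFamily.hasSum_taylorSeries (hG : IsGegenbauerFamily ν μ p R G) {h : ℂ}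
    (hz : ‖z - p‖ + ‖h‖ < R) :
    HasSum (fun m => (-h) ^ m / m.factorial * G m z) (G 0 (z + h)) := by
  have hsub : Metric.ball z (R - ‖z - p‖) ⊆ Metric.ball p R := by
    apply Metric.ball_subset_ball'
    rw [dist_eq_norm]
    linarith
  have hzmem : z ∈ Metric.ball p R := hsub (Metric.mem_ball_self (by linarith [norm_nonneg h]))
  refine (Complex.hasSum_taylorSeries_on_ball ((hG.differentiableOn 0).mono hsub)
    (z := z + h) (by simpa using lt_sub_iff_add_lt'.2 hz)).congr_fun fun m => ?_
  rw [hG.iteratedDeriv_eq m z hzmem, add_sub_cancel_left, smul_eq_mul, smul_eq_mul, neg_pow h]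
  ring

theorem IsGegenbauerFamily.exists_norm_besselCoeff_mul_le (hG : IsGegenbauerFamily ν μ p R G)
    (hz : ‖z - p‖ + 2 * ‖s‖ < R) : ∃ M q : ℝ, 0 ≤ q ∧ q < 1 ∧ ∀ n k : ℕ,
      ‖besselCoeff (μ + n) k * ((-s) ^ (n + 2 * k) * G (n + 2 * k) z)‖
        ≤ M * (‖factorialDivGamma μ (n + k)‖ * q ^ (n + 2 * k)) := by
  obtain ⟨r, hr₁, hr₂⟩ := exists_between (lt_sub_iff_add_lt'.2 hz)
  have hr₀ : 0 < r := lt_of_le_of_lt (by positivity) hr₁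
  obtain ⟨δ, hδ, M, hM₀, hM⟩ := hG.exists_norm_le hr₀ (lt_sub_iff_add_lt'.1 hr₂)
  refine ⟨M, 2 * ‖s‖ / r, by positivity, (div_lt_one hr₀).2 hr₁, fun n k => ?_⟩
  calc ‖besselCoeff (μ + n) k * ((-s) ^ (n + 2 * k) * G (n + 2 * k) z)‖
      = ‖besselCoeff (μ + n) k‖ * (‖s‖ ^ (n + 2 * k) * ‖G (n + 2 * k) z‖) := by
        rw [norm_mul, norm_mul, norm_pow, norm_neg]
    _ ≤ ‖besselCoeff (μ + n) k‖
          * (‖s‖ ^ (n + 2 * k) * ((n + 2 * k).factorial * M / r ^ (n + 2 * k))) := by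
        gcongr
        exact hM z (Metric.mem_ball_self hδ) _
    _ = ‖besselCoeff (μ + n) k‖ * (n + 2 * k).factorial * (M * (‖s‖ / r) ^ (n + 2 * k)) := by
        rw [div_pow]; ring
    _ ≤ ‖factorialDivGamma μ (n + k)‖ * 2 ^ (n + 2 * k) * (M * (‖s‖ / r) ^ (n + 2 * k)) := by
        gcongr ?_ * _
        exact norm_besselCoeff_mul_factorial_le μ n k
    _ = M * (‖factorialDivGamma μ (n + k)‖ * (2 * ‖s‖ / r) ^ (n + 2 * k)) := by
        rw [mul_div_assoc, mul_pow]; ring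

theorem summable_gegenbauerDoubleTerm (hμ : ∀ k : ℕ, μ + 1 / 2 ≠ -k)
    (hG : IsGegenbauerFamily ν μ p R G) (γ : ℝ) (hz : ‖z - p‖ + 2 * ‖s‖ < R) :
    Summable fun nk : ℕ × ℕ => gegenbauerDoubleTerm μ G γ z s nk.1 nk.2 := by
  obtain ⟨M, q, hq₀, hq₁, hle⟩ := hG.exists_norm_besselCoeff_mul_le hz
  have hτ₀ : 0 ≤ √q := Real.sqrt_nonneg q
  have hτ₁ : √q < 1 := by simpa using Real.sqrt_lt_sqrt hq₀ hq₁
  obtain ⟨B, hB⟩ := (isSubexponential_factorialDivGamma μ).exists_norm_mul_pow_le hτ₀ hτ₁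
  have hcoeff : IsSubexponential fun n => ((n : ℂ) + μ) * gegenbauerC n μ (Real.cos γ) :=
    (IsSubexponential.natCast.add (IsSubexponential.const μ)).mul
      (isSubexponential_gegenbauerC hμ γ)
  refine Summable.of_norm_bounded (((hcoeff.summable_norm_mul_pow hτ₀ hτ₁).mul_of_nonneg
    (summable_geometric_of_lt_one hτ₀ hτ₁) (fun n => by positivity)
    (fun k => by positivity)).mul_left (|M| * B)) fun ⟨n, k⟩ => ?_
  have hpow : q ^ (n + 2 * k) ≤ √q ^ (n + k) * (√q ^ n * √q ^ k) := by
    nth_rw 1 [← Real.sq_sqrt hq₀]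
    rw [← pow_mul, ← pow_add, ← pow_add]
    exact pow_le_pow_of_le_one hτ₀ hτ₁.le (by omega)
  set c := ‖((n : ℂ) + μ) * gegenbauerC n μ (Real.cos γ)‖
  calc ‖gegenbauerDoubleTerm μ G γ z s n k‖
      ≤ c * (|M| * (‖factorialDivGamma μ (n + k)‖ * q ^ (n + 2 * k))) := by
        rw [gegenbauerDoubleTerm, norm_mul]
        gcongr
        exact (hle n k).trans (by gcongr; exact le_abs_self M)
    _ ≤ c * (|M| * (‖factorialDivGamma μ (n + k)‖ * (√q ^ (n + k) * (√q ^ n * √q ^ k)))) := by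
        gcongr
    _ = c * |M| * (√q ^ n * √q ^ k) * (‖factorialDivGamma μ (n + k)‖ * √q ^ (n + k)) := by ring
    _ ≤ c * |M| * (√q ^ n * √q ^ k) * B := by
        gcongr
        exact hB _
    _ = |M| * B * (c * √q ^ n * √q ^ k) := by ring

theorem tsum_gegenbauerDoubleTerm (hΓ : ∀ k : ℕ, μ ≠ -k) (hμ : ∀ k : ℕ, μ + 1 / 2 ≠ -k)
    (hG : IsGegenbauerFamily ν μ p R G) (γ : ℝ) (hz : ‖z - p‖ + 2 * ‖s‖ < R) :
    Complex.Gamma μ * ∑' nk : ℕ × ℕ, gegenbauerDoubleTerm μ G γ z s nk.1 nk.2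
      = G 0 (z + 2 * s * Real.cos γ) := by
  let f : ℕ → ℕ → ℂ := fun m k => gegenbauerMonomialCoeff μ m k *
    gegenbauerInt μ (Real.cos γ) (m - 2 * k) * ((-s) ^ m * G m z)
  have hf : ∀ m k : ℕ, m < 2 * k → f m k = 0 := fun m k hmk => by
    simp only [f, gegenbauerInt_of_neg μ _ (show (m : ℤ) - 2 * k < 0 by omega), mul_zero, zero_mul]
  have hterm : (fun nk : ℕ × ℕ => gegenbauerDoubleTerm μ G γ z s nk.1 nk.2)
      = fun nk => f (nk.1 + 2 * nk.2) nk.2 := by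
    funext ⟨n, k⟩
    have hindex : ((n + 2 * k : ℕ) : ℤ) - 2 * k = n := by push_cast; ring
    simp only [f, gegenbauerDoubleTerm, gegenbauerMonomialCoeff, besselCoeff, hindex,
      gegenbauerInt_natCast, div_eq_mul_inv]
    push_cast
    ring_nf
  have hbound : ‖z - p‖ + ‖2 * s * Real.cos γ‖ < R := by
    have hcos : ‖(Real.cos γ : ℂ)‖ ≤ 1 :=
      (Complex.norm_real _).trans_le (Real.abs_cos_le_one γ)
    refine lt_of_le_of_lt ?_ hz
    rw [norm_mul, norm_mul, Complex.norm_ofNat]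
    linarith [mul_le_of_le_one_right (a := 2 * ‖s‖) (by positivity) hcos]
  have hsum := summable_gegenbauerDoubleTerm hμ hG γ hz
  rw [hterm] at hsum ⊢
  rw [tsum_add_two_mul_eq_tsum_sum_range hf hsum, ← (hG.hasSum_taylorSeries hbound).tsum_eq,
    ← tsum_mul_left]
  refine tsum_congr fun m => ?_
  rw [← Finset.sum_mul, ← mul_assoc, ← pow_div_factorial_eq_sum_gegenbauerInt hΓ hμ,
    show -(2 * s * (Real.cos γ : ℂ)) = 2 * Real.cos γ * -s by ring,
    mul_pow _ (-s)]
  ring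

/-- The double series is summed over `k` by the product formula for the shifted family, and over
all pairs by Taylor's theorem. -/
theorem IsGegenbauerFamily.hasSum_gegenbauerC (hΓ : ∀ k : ℕ, μ ≠ -k)
    (hμ : ∀ k : ℕ, μ + 1 / 2 ≠ -k) (hG : IsGegenbauerFamily ν μ p R G) (γ : ℝ)
    (hseg : segment ℝ 0 w ⊆ productDomain p R y ∩ Metric.ball 0 1)
    (hs : s ^ 2 = w * (1 - w) * (1 - y ^ 2)) :
    HasSum (fun n : ℕ => ((n : ℂ) + μ) * ((-s) ^ n * G n y *
      Complex.regularizedGaussHGFun (μ + n - ν) (ν + (μ + n) + 1) (μ + n + 1) w) *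
        gegenbauerC n μ (Real.cos γ))
      ((Complex.Gamma μ)⁻¹ * G 0 ((1 - 2 * w) * y + 2 * s * Real.cos γ)) := by
  have hz : ‖(1 - 2 * w) * y - p‖ + 2 * ‖s‖ < R := by
    have hw := (hseg (right_mem_segment ℝ 0 w)).1
    rwa [productDomain, Set.mem_ofPred_eq, ← hs, norm_pow, Real.sqrt_sq (norm_nonneg s)] at hw
  have hsum := summable_gegenbauerDoubleTerm hμ hG γ hz
  rw [← tsum_gegenbauerDoubleTerm hΓ hμ hG γ hz, inv_mul_cancel_left₀ (Complex.Gamma_ne_zero hΓ)]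
  refine (hsum.hasSum.prod_fiberwise fun n => (hsum.prod_factor n).hasSum).congr_fun fun n => ?_
  have hprod := tsum_productTerm_eq (μ := μ + n)
    (fun k hk => hΓ (n + 1 + k) (by push_cast; linear_combination hk)) (hG.shift n) hseg
  rw [zero_add] at hprod
  rw [mul_assoc ((-s) ^ n), ← hprod, ← tsum_mul_left, ← tsum_mul_left, ← tsum_mul_right]
  refine tsum_congr fun k => ?_
  rw [productTerm, gegenbauerDoubleTerm, ← hs, pow_add, pow_mul (-s), neg_sq, add_comm (2 * k)]
  ring

end Expansion

theorem ofReal_cpow_eq_exp {r : ℝ} (hr : 0 < r) (e : ℂ) :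
    (r : ℂ) ^ e = Complex.exp (Real.log r * e) := by
  rw [Complex.cpow_def_of_ne_zero (by exact_mod_cast hr.ne'), Complex.ofReal_log hr.le]

section Angles

variable {α : ℝ}

theorem one_sub_cos_pos (hα : α ∈ Set.Ioo 0 Real.pi) : 0 < 1 - Real.cos α := by
  have h := Real.cos_lt_cos_of_nonneg_of_le_pi le_rfl hα.2.le hα.1
  rw [Real.cos_zero] at h
  linarith

theorem one_add_cos_pos (hα : α ∈ Set.Ioo 0 Real.pi) : 0 < 1 + Real.cos α := by
  have h := Real.cos_lt_cos_of_nonneg_of_le_pi hα.1.le le_rfl hα.2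
  rw [Real.cos_pi] at h
  linarith

theorem two_mul_log_sin (hα : α ∈ Set.Ioo 0 Real.pi) :
    2 * Real.log (Real.sin α) = Real.log (1 + Real.cos α) + Real.log (1 - Real.cos α) := by
  rw [← Real.log_mul (one_add_cos_pos hα).ne' (one_sub_cos_pos hα).ne',
    show (1 + Real.cos α) * (1 - Real.cos α) = Real.sin α ^ 2 by rw [Real.sin_sq]; ring,
    Real.log_pow, Nat.cast_ofNat]

theorem norm_half_one_sub_cos_lt_one (hα : α ∈ Set.Ioo 0 Real.pi) :
    ‖(1 - (Real.cos α : ℂ)) / 2‖ < 1 := by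
  have hcast : (1 - (Real.cos α : ℂ)) / 2 = (((1 - Real.cos α) / 2 : ℝ) : ℂ) := by push_cast; ring
  rw [hcast, Complex.norm_real, Real.norm_of_nonneg (half_pos (one_sub_cos_pos hα)).le]
  linarith [one_add_cos_pos hα]

/-- By Euler's transformation the singular factors of the two half-angles combine to a power of
`sin α`. -/
theorem ferrersP_neg_cos (ν : ℂ) {m : ℂ} (hm : ∀ k : ℕ, m + 1 ≠ -k)
    (hα : α ∈ Set.Ioo 0 Real.pi) :
    ferrersP ν (-m) (Real.cos α) = (((Real.sin α / 2 : ℝ)) : ℂ) ^ m *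
      Complex.regularizedGaussHGFun (m - ν) (ν + m + 1) (m + 1) ((1 - (Real.cos α : ℂ)) / 2) := by
  have hadd := one_add_cos_pos hα
  have hsub := one_sub_cos_pos hα
  have hsin := Real.sin_pos_of_mem_Ioo hα
  have hfactors : (((1 + Real.cos α) / (1 - Real.cos α) : ℝ) : ℂ) ^ (-m / 2)
      * (((1 + Real.cos α) / 2 : ℝ) : ℂ) ^ m = ((Real.sin α / 2 : ℝ) : ℂ) ^ m := by
    rw [ofReal_cpow_eq_exp (div_pos hadd hsub), ofReal_cpow_eq_exp (half_pos hadd),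
      ofReal_cpow_eq_exp (half_pos hsin), ← Complex.exp_add, Real.log_div hadd.ne' hsub.ne',
      Real.log_div hadd.ne' two_ne_zero, Real.log_div hsin.ne' two_ne_zero]
    congr 1
    have hlog := congrArg (fun t : ℝ => (t : ℂ)) (two_mul_log_sin hα)
    push_cast at hlog ⊢
    linear_combination (-m / 2) * hlog
  rw [ferrersP, sub_neg_eq_add, add_comm 1 m,
    regularizedGaussHGFun_euler hm (norm_half_one_sub_cos_lt_one hα),
    show m + 1 - -ν = ν + m + 1 by ring, show m + 1 - (ν + 1) = m - ν by ring,
    show ν + m + 1 - (ν + 1) = m by ring, Complex.regularizedGaussHGFun_symm (ν + m + 1),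
    ← mul_assoc, ← hfactors,
    show 1 - (1 - (Real.cos α : ℂ)) / 2 = (((1 + Real.cos α) / 2 : ℝ) : ℂ) by push_cast; ring]

theorem exists_angle_of_mem_segment (hα : α ∈ Set.Icc 0 Real.pi) {z : ℂ}
    (hz : z ∈ segment ℝ 0 ((1 - (Real.cos α : ℂ)) / 2)) :
    ∃ φ ∈ Set.Icc 0 α, z = (1 - (Real.cos φ : ℂ)) / 2 := by
  obtain ⟨a, t, ha, ht, hat, rfl⟩ := hz
  have hx : Real.cos α ≤ 1 - t * (1 - Real.cos α) := by
    nlinarith [Real.cos_le_one α]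
  have hx₁ : 1 - t * (1 - Real.cos α) ≤ 1 := by
    nlinarith [Real.cos_le_one α]
  refine ⟨Real.arccos (1 - t * (1 - Real.cos α)), ⟨Real.arccos_nonneg _, ?_⟩, ?_⟩
  · exact (Real.arccos_le_arccos hx).trans_eq (Real.arccos_cos hα.1 hα.2)
  · rw [Real.cos_arccos ((Real.neg_one_le_cos α).trans hx) hx₁, smul_zero, zero_add,
      Complex.real_smul]
    push_cast
    ring

theorem half_one_sub_cos_mem_productDomain {p R β φ : ℝ} (hφ : φ ∈ Set.Icc 0 Real.pi)
    (hβ : β ∈ Set.Icc 0 Real.pi)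
    (h : |Real.cos φ * Real.cos β - p| + Real.sin φ * Real.sin β < R) :
    (1 - (Real.cos φ : ℂ)) / 2 ∈ productDomain p R (Real.cos β) := by
  have hcenter : (1 - 2 * ((1 - (Real.cos φ : ℂ)) / 2)) * Real.cos β - p
      = ((Real.cos φ * Real.cos β - p : ℝ) : ℂ) := by push_cast; ring
  have hradius : (1 - (Real.cos φ : ℂ)) / 2 * (1 - (1 - (Real.cos φ : ℂ)) / 2)
      * (1 - (Real.cos β : ℂ) ^ 2) = (((Real.sin φ * Real.sin β / 2) ^ 2 : ℝ) : ℂ) := by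
    rw [div_pow, mul_pow, Real.sin_sq, Real.sin_sq]
    push_cast
    ring
  have hsin : 0 ≤ Real.sin φ * Real.sin β / 2 := div_nonneg
    (mul_nonneg (Real.sin_nonneg_of_mem_Icc hφ) (Real.sin_nonneg_of_mem_Icc hβ)) two_pos.le
  rw [productDomain, Set.mem_ofPred_eq, hcenter, hradius, Complex.norm_real, Complex.norm_real,
    Real.norm_eq_abs, Real.norm_of_nonneg (sq_nonneg _), Real.sqrt_sq hsin]
  linarith

theorem segment_subset_productDomain {p R β : ℝ} (hα : α ∈ Set.Ioo 0 Real.pi)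
    (hβ : β ∈ Set.Ioo 0 Real.pi)
    (hdom : ∀ φ ∈ Set.Icc 0 α, |Real.cos φ * Real.cos β - p| + Real.sin φ * Real.sin β < R) :
    segment ℝ 0 ((1 - (Real.cos α : ℂ)) / 2) ⊆
      productDomain p R (Real.cos β) ∩ Metric.ball 0 1 := fun z hz => by
  refine ⟨?_, (convex_ball 0 1).segment_subset (Metric.mem_ball_self one_pos)
    (mem_ball_zero_iff.2 (norm_half_one_sub_cos_lt_one hα)) hz⟩
  obtain ⟨φ, hφ, rfl⟩ := exists_angle_of_mem_segment (Set.Ioo_subset_Icc_self hα) hz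
  exact half_one_sub_cos_mem_productDomain ⟨hφ.1, hφ.2.trans hα.2.le⟩
    (Set.Ioo_subset_Icc_self hβ) (hdom φ hφ)

end Angles

section HalfInteger

variable {μ : ℂ}

theorem ne_neg_natCast_of_two_mul_ne (hμ : ∀ k : ℕ, 2 * μ ≠ -k) (k : ℕ) : μ ≠ -k := fun hk =>
  hμ (2 * k) (by push_cast; linear_combination 2 * hk)

theorem add_half_ne_neg_natCast_of_two_mul_ne (hμ : ∀ k : ℕ, 2 * μ ≠ -k) (k : ℕ) :
    μ + 1 / 2 ≠ -k := fun hk =>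
  hμ (2 * k + 1) (by push_cast; linear_combination 2 * hk)

theorem HasGegenbauerExpansion.of_hasSum {α β γ s : ℝ} {f : ℂ} {a : ℕ → ℂ}
    (hΓ : ∀ k : ℕ, μ ≠ -k) (hs : 0 < s) (hsin : Real.sin α * Real.sin β = 2 * s)
    (h : HasSum (fun n : ℕ => ((n : ℂ) + μ) * a n * gegenbauerC n μ (Real.cos γ))
      ((s : ℂ) ^ μ * ((Complex.Gamma μ)⁻¹ * f))) :
    HasGegenbauerExpansion μ α β γ f a := by
  refine ⟨h.summable, ?_⟩
  have hgamma := Complex.Gamma_ne_zero hΓ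
  have htwo : (2 : ℂ) ^ μ ≠ 0 := by simp [Complex.cpow_eq_zero_iff]
  have hpow : (s : ℂ) ^ μ ≠ 0 := by simp [Complex.cpow_eq_zero_iff, hs.ne']
  rw [h.tsum_eq, realCpow, hsin, Complex.ofReal_mul,
    Complex.mul_cpow_ofReal_nonneg two_pos.le hs.le, Complex.ofReal_ofNat]
  field_simp

theorem IsGegenbauerFamily.hasGegenbauerExpansion {ν : ℂ} {p R : ℝ} {G : ℕ → ℂ → ℂ}
    (hG : IsGegenbauerFamily ν μ p R G) (hμ : ∀ k : ℕ, 2 * μ ≠ -k)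
    {α β γ Θ : ℝ} (hα : α ∈ Set.Ioo 0 Real.pi) (hβ : β ∈ Set.Ioo 0 Real.pi)
    (hdom : ∀ φ ∈ Set.Icc 0 α, |Real.cos φ * Real.cos β - p| + Real.sin φ * Real.sin β < R)
    (hcos : Real.cos Θ = Real.cos α * Real.cos β + Real.sin α * Real.sin β * Real.cos γ) :
    HasGegenbauerExpansion μ α β γ (G 0 (Real.cos Θ)) (fun n => (-1) ^ n *
      ferrersP ν (-(μ + n)) (Real.cos α) * ((Real.sin β : ℂ) ^ (μ + n) * G n (Real.cos β))) := by
  have hΓ := ne_neg_natCast_of_two_mul_ne hμ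
  have hsα := Real.sin_pos_of_mem_Ioo hα
  have hsβ := Real.sin_pos_of_mem_Ioo hβ
  let w : ℂ := (1 - Real.cos α) / 2
  let s : ℝ := Real.sin α / 2 * Real.sin β
  have hs : 0 < s := by positivity
  have hseg : segment ℝ 0 w ⊆ productDomain p R (Real.cos β) ∩ Metric.ball 0 1 :=
    segment_subset_productDomain hα hβ hdom
  have hsq : (s : ℂ) ^ 2 = w * (1 - w) * (1 - (Real.cos β : ℂ) ^ 2) := by
    simp only [s, w, Complex.ofReal_mul, Complex.ofReal_div, mul_pow, div_pow,
      ← Complex.ofReal_pow, Real.sin_sq]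
    push_cast
    ring
  have harg : (1 - 2 * w) * Real.cos β + 2 * s * Real.cos γ = (Real.cos Θ : ℂ) := by
    rw [hcos]
    simp only [s, w]
    push_cast
    ring
  have hpow (n : ℕ) : ((Real.sin α / 2 : ℝ) : ℂ) ^ (μ + n) * (Real.sin β : ℂ) ^ (μ + n)
      = (s : ℂ) ^ μ * (s : ℂ) ^ n := by
    rw [← Complex.mul_cpow_ofReal_nonneg (by positivity) hsβ.le, ← Complex.ofReal_mul,
      Complex.cpow_add _ _ (by exact_mod_cast hs.ne'), Complex.cpow_natCast]
  have hexp := hG.hasSum_gegenbauerC hΓ (add_half_ne_neg_natCast_of_two_mul_ne hμ) γ hseg hsq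
  rw [harg] at hexp
  refine .of_hasSum hΓ hs (by simp only [s]; ring)
    ((hexp.mul_left ((s : ℂ) ^ μ)).congr_fun fun n => ?_)
  have hm (k : ℕ) : μ + n + 1 ≠ -k := fun hk =>
    hΓ (n + 1 + k) (by push_cast; linear_combination hk)
  rw [ferrersP_neg_cos ν hm hα, neg_pow (s : ℂ)]
  linear_combination (((n : ℂ) + μ) * (-1) ^ n * Complex.regularizedGaussHGFun (μ + n - ν)
    (ν + (μ + n) + 1) (μ + n + 1) w * G n (Real.cos β) * gegenbauerC n μ (Real.cos γ)) * hpow n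

end HalfInteger

/-! ### Families regular or singular at `1` -/

section Contiguity

variable (a b c : ℂ) {z : ℂ}

theorem derivCoeff_gaussCoeff :
    derivCoeff (gaussCoeff a b c) = fun j => a * b * gaussCoeff (a + 1) (b + 1) (c + 1) j := by
  funext j
  have hj : (j : ℂ) + 1 ≠ 0 := Nat.cast_add_one_ne_zero j
  have hj' : (j.factorial : ℂ) ≠ 0 := Nat.cast_ne_zero.2 j.factorial_ne_zero
  have hasc (t : ℂ) : (ascPochhammer ℂ (j + 1)).eval t = t * (ascPochhammer ℂ j).eval (t + 1) := by
    simp [ascPochhammer_succ_left]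
  simp only [derivCoeff, gaussCoeff, hasc, Nat.factorial_succ, Nat.cast_mul, Nat.cast_add,
    Nat.cast_one]
  rw [show c + (j + 1 : ℂ) = c + 1 + j by ring]
  field_simp

theorem powerSum_derivCoeff_gaussCoeff :
    powerSum (derivCoeff (gaussCoeff a b c)) z
      = a * b * Complex.regularizedGaussHGFun (a + 1) (b + 1) (c + 1) z := by
  rw [derivCoeff_gaussCoeff, powerSum_const_mul, powerSum_gaussCoeff]

theorem hasDerivAt_regularizedGaussHGFun (hz : ‖z‖ < 1) :
    HasDerivAt (Complex.regularizedGaussHGFun a b c)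
      (a * b * Complex.regularizedGaussHGFun (a + 1) (b + 1) (c + 1) z) z := by
  rw [← powerSum_gaussCoeff a b c, ← powerSum_derivCoeff_gaussCoeff]
  exact (hypergeometricRecursion_gaussCoeff a b c).isSubexponential.hasDerivAt_powerSum hz

theorem regularizedGaussHGFun_contiguous_add_two (hz : ‖z‖ < 1) :
    a * b * (z * (1 - z) * ((a + 1) * (b + 1) *
        Complex.regularizedGaussHGFun (a + 1 + 1) (b + 1 + 1) (c + 1 + 1) z)
      + (c - (a + b + 1) * z) * Complex.regularizedGaussHGFun (a + 1) (b + 1) (c + 1) z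
      - Complex.regularizedGaussHGFun a b c z) = 0 := by
  have hball : ∀ᶠ w in 𝓝 z, ‖w‖ < 1 := continuous_norm.continuousAt.eventually_lt_const hz
  have hode := (isHypergeometricSolutionOn_regularizedGaussHGFun a b c).operator_eq_zero z
    (mem_ball_zero_iff.2 hz)
  rw [hypergeometricOperator_eq_of_hasDerivAt
    (hball.mono fun w hw => hasDerivAt_regularizedGaussHGFun a b c hw)
    ((hasDerivAt_regularizedGaussHGFun (a + 1) (b + 1) (c + 1) hz).const_mul (a * b))] at hode
  linear_combination hode

theorem gaussCoeff_sub_one (j : ℕ) :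
    gaussCoeff a b (c - 1) j = (c - 1) * gaussCoeff a b c j + j * gaussCoeff a b c j := by
  have h := Complex.one_div_Gamma_eq_self_mul_one_div_Gamma_add_one (c - 1 + j)
  rw [show c - 1 + (j : ℂ) + 1 = c + j by ring] at h
  simp only [gaussCoeff, div_eq_mul_inv, mul_inv, h]
  ring

theorem regularizedGaussHGFun_sub_one (hz : ‖z‖ < 1) :
    Complex.regularizedGaussHGFun a b (c - 1) z
      = (c - 1) * Complex.regularizedGaussHGFun a b c z
        + z * (a * b * Complex.regularizedGaussHGFun (a + 1) (b + 1) (c + 1) z) := by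
  have hs := (hypergeometricRecursion_gaussCoeff a b c).isSubexponential
  rw [← powerSum_derivCoeff_gaussCoeff, hs.mul_powerSum_derivCoeff hz, ← powerSum_gaussCoeff,
    ← powerSum_gaussCoeff, ← powerSum_const_mul, ← (hs.const_mul _).powerSum_add hs.natCast_mul hz]
  exact congrArg (powerSum · z) (funext (gaussCoeff_sub_one a b c))

theorem norm_half_one_sub_lt_one (hz : z ∈ Metric.ball 1 2) : ‖(1 - z) / 2‖ < 1 := by
  rw [mem_ball_iff_norm, norm_sub_rev] at hz
  rw [norm_div, Complex.norm_ofNat]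
  linarith

theorem hasDerivAt_regularizedGaussHGFun_half_one_sub (hz : z ∈ Metric.ball 1 2) :
    HasDerivAt (fun w => Complex.regularizedGaussHGFun a b c ((1 - w) / 2))
      (-(a * b / 2 * Complex.regularizedGaussHGFun (a + 1) (b + 1) (c + 1) ((1 - z) / 2))) z := by
  have hhalf : HasDerivAt (fun w : ℂ => (1 - w) / 2) (-1 / 2) z :=
    ((hasDerivAt_id z).const_sub 1).div_const 2
  refine ((hasDerivAt_regularizedGaussHGFun a b c (norm_half_one_sub_lt_one hz)).comp z
    hhalf).congr_deriv ?_
  ring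

end Contiguity

section Families

variable (ν μ : ℂ)

/-- The family whose `n`-th member is `(1 - z ^ 2) ^ (-(μ + n) / 2)` times the Ferrers function
`𝖯_ν^{-(μ + n)}`, up to a constant; it is regular at `z = 1`. -/
noncomputable def regularFamily (n : ℕ) (z : ℂ) : ℂ :=
  pochhammerSymbol (ν + μ + 1) n * pochhammerSymbol (μ - ν) n * (2 : ℂ) ^ (-(μ + n)) *
    Complex.regularizedGaussHGFun (μ + n - ν) (ν + (μ + n) + 1) (μ + n + 1) ((1 - z) / 2)

theorem regularFamily_succ (n : ℕ) (z : ℂ) :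
    regularFamily ν μ (n + 1) z = (ν + μ + 1 + n) * (μ - ν + n) / 2 *
      (pochhammerSymbol (ν + μ + 1) n * pochhammerSymbol (μ - ν) n * (2 : ℂ) ^ (-(μ + n)) *
        Complex.regularizedGaussHGFun (μ + n - ν + 1) (ν + (μ + n) + 1 + 1) (μ + n + 1 + 1)
          ((1 - z) / 2)) := by
  have hindex : μ + ((n + 1 : ℕ) : ℂ) = μ + n + 1 := by push_cast; ring
  have htwo : (2 : ℂ) ^ (-(μ + n + 1)) = (2 : ℂ) ^ (-(μ + n)) / 2 := by
    rw [neg_add, ← sub_eq_add_neg, Complex.cpow_sub _ _ two_ne_zero, Complex.cpow_one]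
  rw [regularFamily, hindex, htwo, show μ + n + 1 - ν = μ + n - ν + 1 by ring,
    show ν + (μ + n + 1) + 1 = ν + (μ + n) + 1 + 1 by ring]
  simp only [pochhammerSymbol, ascPochhammer_succ_eval]
  ring

theorem isGegenbauerFamily_regularFamily :
    IsGegenbauerFamily ν μ 1 2 (regularFamily ν μ) where
  hasDerivAt n z hz := by
    refine ((hasDerivAt_regularizedGaussHGFun_half_one_sub (μ + n - ν) (ν + (μ + n) + 1)
      (μ + n + 1) hz).const_mul _).congr_deriv ?_
    rw [regularFamily_succ]
    ring
  ode n z hz := by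
    have hode := regularizedGaussHGFun_contiguous_add_two (μ + n - ν) (ν + (μ + n) + 1)
      (μ + n + 1) (norm_half_one_sub_lt_one hz)
    have hindex : μ + ((n + 1 : ℕ) : ℂ) = μ + n + 1 := by push_cast; ring
    have htwo : (2 : ℂ) ^ (-(μ + n + 1)) = (2 : ℂ) ^ (-(μ + n)) / 2 := by
      rw [neg_add, ← sub_eq_add_neg, Complex.cpow_sub _ _ two_ne_zero, Complex.cpow_one]
    rw [regularFamily_succ ν μ (n + 1), regularFamily_succ, regularFamily, hindex, htwo,
      show μ + n + 1 - ν = μ + n - ν + 1 by ring,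
      show ν + (μ + n + 1) + 1 = ν + (μ + n) + 1 + 1 by ring]
    simp only [pochhammerSymbol, ascPochhammer_succ_eval]
    push_cast
    linear_combination ((ascPochhammer ℂ n).eval (ν + μ + 1) * (ascPochhammer ℂ n).eval (μ - ν) *
      (2 : ℂ) ^ (-(μ + n))) * hode

/-- The family whose `n`-th member is `(1 - z ^ 2) ^ (-(μ + n) / 2)` times the Ferrers function
`𝖯_ν^{μ + n}`; it is singular at `z = 1`. -/
noncomputable def singularFamily (n : ℕ) (z : ℂ) : ℂ :=
  (1 - z) ^ (-(μ + n)) *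
    Complex.regularizedGaussHGFun (-ν) (ν + 1) (1 - (μ + n)) ((1 - z) / 2)

theorem isGegenbauerFamily_singularFamily :
    IsGegenbauerFamily ν μ 0 1 (singularFamily ν μ) := by
  have hball : Metric.ball (0 : ℂ) 1 ⊆ Metric.ball 1 2 :=
    Metric.ball_subset_ball' (by rw [dist_zero_left, norm_one]; norm_num)
  have hindex (n : ℕ) : μ + ((n + 1 : ℕ) : ℂ) = μ + n + 1 := by push_cast; ring
  have hsub (t : ℂ) : 1 - (t + 1) = 1 - t - 1 := by ring
  have hneg (t : ℂ) : -(t + 1) = -t - 1 := by ring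
  refine ⟨fun n z hz => ?_, fun n z hz => ?_⟩
  · refine (hasDerivAt_one_sub_cpow_mul (one_sub_mem_slitPlane (mem_ball_zero_iff.1 hz))
      (hasDerivAt_regularizedGaussHGFun_half_one_sub (-ν) (ν + 1) (1 - (μ + n)) (hball hz))
      (-(μ + n))).congr_deriv ?_
    rw [singularFamily, hindex, hsub, hneg,
      regularizedGaussHGFun_sub_one _ _ _ (norm_half_one_sub_lt_one (hball hz))]
    ring
  · have hne := Complex.slitPlane_ne_zero (one_sub_mem_slitPlane (mem_ball_zero_iff.1 hz))
    have hz' := norm_half_one_sub_lt_one (hball hz)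
    have hode := regularizedGaussHGFun_contiguous_add_two (-ν) (ν + 1) (1 - (μ + n)) hz'
    have hsucc := regularizedGaussHGFun_sub_one (-ν + 1) (ν + 1 + 1) (1 - (μ + n) + 1) hz'
    rw [add_sub_cancel_right] at hsucc
    simp only [singularFamily, hindex, hsub, hneg]
    rw [regularizedGaussHGFun_sub_one _ _ (1 - (μ + n) - 1) hz', sub_add_cancel, hsucc,
      regularizedGaussHGFun_sub_one _ _ _ hz', cpow_eq_cpow_sub_one_mul hne (-(μ + n)),
      cpow_eq_cpow_sub_one_mul hne (-(μ + n) - 1)]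
    linear_combination ((1 - z) ^ (-(μ + n) - 1 - 1) * (1 - z) ^ 2) * hode

end Families

/-! ### Families with given values at `0` -/

/-- The relation between the values at `0` of a Gegenbauer family, that is, its differential
equation at `z = 0`. -/
def GegenbauerRecurrence (ν μ : ℂ) (q : ℕ → ℂ) : Prop :=
  ∀ n : ℕ, q (n + 2) = (ν + (μ + n) + 1) * (μ + n - ν) * q n

/-- The Taylor coefficients at `0` of a function whose `j`-th derivative there is
`(-1) ^ j * q j`. -/
noncomputable def taylorCoeff (q : ℕ → ℂ) (j : ℕ) : ℂ :=
  (-1) ^ j * q j / j.factorial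

/-- The candidate for the Gegenbauer family with value `q n` at `0` of the `n`-th member. -/
noncomputable def taylorFamily (q : ℕ → ℂ) (n : ℕ) : ℂ → ℂ :=
  powerSum (taylorCoeff fun j => q (j + n))

theorem derivCoeff_taylorCoeff (q : ℕ → ℂ) :
    derivCoeff (taylorCoeff q) = fun j => -1 * taylorCoeff (fun j => q (j + 1)) j := by
  funext j
  have hfact : (j.factorial : ℂ) ≠ 0 := Nat.cast_ne_zero.2 j.factorial_ne_zero
  have hsucc : (j : ℂ) + 1 ≠ 0 := Nat.cast_add_one_ne_zero j
  rw [derivCoeff, taylorCoeff, taylorCoeff, Nat.factorial_succ, Nat.cast_mul, Nat.cast_succ]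
  field_simp
  ring

theorem derivCoeff_derivCoeff_taylorCoeff (q : ℕ → ℂ) :
    derivCoeff (derivCoeff (taylorCoeff q)) = taylorCoeff fun j => q (j + 2) := by
  funext j
  have h := congrFun (derivCoeff_taylorCoeff fun j => q (j + 1)) j
  rw [derivCoeff_taylorCoeff]
  simp only [derivCoeff] at h ⊢
  linear_combination -h

namespace GegenbauerRecurrence

variable {ν μ : ℂ} {q : ℕ → ℂ}

theorem shift (hq : GegenbauerRecurrence ν μ q) (n : ℕ) :
    GegenbauerRecurrence ν (μ + n) fun j => q (j + n) := fun j => by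
  simp only [Nat.add_right_comm j 2, hq (j + n), Nat.cast_add]
  ring

theorem isSubexponential_taylorCoeff (hq : GegenbauerRecurrence ν μ q) :
    IsSubexponential (taylorCoeff q) := by
  have hleft : Tendsto (fun j : ℕ => (ν + μ + 1 + j) / (1 + j)) atTop (𝓝 1) := by
    simpa using tendsto_add_mul_div_add_mul_atTop_nhds (ν + μ + 1) 1 1 (one_ne_zero (α := ℂ))
  have hright : Tendsto (fun j : ℕ => (μ - ν + j) / (2 + j)) atTop (𝓝 1) := by
    simpa using tendsto_add_mul_div_add_mul_atTop_nhds (μ - ν) 2 1 (one_ne_zero (α := ℂ))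
  refine .of_recurrence (α := 1) (β := -1) (by simp) (by simp)
    (p := fun _ => 0) (by simp) (by simpa using hleft.mul hright) (.of_forall fun j => ?_)
  have hone : (1 : ℂ) + j ≠ 0 := by rw [add_comm]; exact Nat.cast_add_one_ne_zero j
  have htwo : (2 : ℂ) + j ≠ 0 := by exact_mod_cast (show 2 + j ≠ 0 by lia)
  have hfact : (j.factorial : ℂ) ≠ 0 := Nat.cast_ne_zero.2 j.factorial_ne_zero
  simp only [taylorCoeff, hq j, Nat.factorial_succ]
  push_cast
  rw [show (j : ℂ) + 1 + 1 = 2 + j by ring, add_comm (j : ℂ) 1]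
  field_simp
  ring

theorem powerSum_taylorCoeff_ode (hq : GegenbauerRecurrence ν μ q) {z : ℂ} (hz : ‖z‖ < 1) :
    (1 - z ^ 2) * powerSum (taylorCoeff fun j => q (j + 2)) z
      + 2 * (μ + 1) * z * powerSum (taylorCoeff fun j => q (j + 1)) z
      + (ν - μ) * (ν + μ + 1) * powerSum (taylorCoeff q) z = 0 := by
  have hs := hq.isSubexponential_taylorCoeff
  have hs₂ : IsSubexponential fun j : ℕ => (j : ℂ) * ((j : ℂ) - 1) * taylorCoeff q j := by
    simpa only [mul_sub, sub_mul, mul_assoc, mul_one, one_mul] using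
      (hs.natCast_mul.sub hs).natCast_mul
  have hcoeff : taylorCoeff (fun j => q (j + 2)) = fun j : ℕ =>
      (j : ℂ) * ((j : ℂ) - 1) * taylorCoeff q j + 2 * (μ + 1) * (j * taylorCoeff q j)
        - (ν - μ) * (ν + μ + 1) * taylorCoeff q j := by
    funext j
    simp only [taylorCoeff, hq j]
    ring
  have hfirst := hs.mul_powerSum_derivCoeff hz
  have hsecond := hs.sq_mul_powerSum_derivCoeff hz
  rw [derivCoeff_taylorCoeff, powerSum_const_mul] at hfirst
  rw [derivCoeff_derivCoeff_taylorCoeff] at hsecond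
  have hsum := congrArg (powerSum · z) hcoeff
  simp only [(hs₂.add (hs.natCast_mul.const_mul _)).powerSum_sub (hs.const_mul _) hz,
    hs₂.powerSum_add (hs.natCast_mul.const_mul _) hz, powerSum_const_mul, ← hfirst,
    ← hsecond] at hsum
  linear_combination hsum

theorem isGegenbauerFamily_taylorFamily (hq : GegenbauerRecurrence ν μ q) :
    IsGegenbauerFamily ν μ 0 1 (taylorFamily q) where
  hasDerivAt n z hz := by
    have h := (hq.shift n).isSubexponential_taylorCoeff.hasDerivAt_powerSum
      (mem_ball_zero_iff.1 hz)
    rw [derivCoeff_taylorCoeff, powerSum_const_mul, neg_one_mul] at h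
    simpa only [taylorFamily, Nat.add_right_comm _ 1 n, ← add_assoc] using h
  ode n z hz := by
    simpa only [taylorFamily, Nat.add_right_comm _ _ n, ← add_assoc] using
      (hq.shift n).powerSum_taylorCoeff_ode (mem_ball_zero_iff.1 hz)

theorem apply_two_mul (hq : GegenbauerRecurrence ν μ q) (i : ℕ) :
    q (2 * i) = 4 ^ i * (ascPochhammer ℂ i).eval ((μ - ν) / 2) *
      (ascPochhammer ℂ i).eval ((ν + μ + 1) / 2) * q 0 := by
  induction i with
  | zero => simp
  | succ i ih =>
    rw [Nat.mul_succ, hq, ih, ascPochhammer_succ_eval, ascPochhammer_succ_eval]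
    push_cast
    ring

end GegenbauerRecurrence

theorem factorial_two_mul_eq_pow_mul_ascPochhammer (i : ℕ) :
    ((2 * i).factorial : ℂ) = 4 ^ i * i.factorial * (ascPochhammer ℂ i).eval (1 / 2) := by
  induction i with
  | zero => simp
  | succ i ih =>
    rw [Nat.mul_succ, Nat.factorial_succ, Nat.factorial_succ, Nat.factorial_succ,
      ascPochhammer_succ_eval]
    push_cast
    rw [ih]
    ring

theorem factorial_two_mul_add_one_eq_pow_mul_ascPochhammer (i : ℕ) :
    ((2 * i + 1).factorial : ℂ) = 4 ^ i * i.factorial * (ascPochhammer ℂ i).eval (3 / 2) := by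
  induction i with
  | zero => simp
  | succ i ih =>
    rw [show 2 * (i + 1) + 1 = 2 * i + 1 + 1 + 1 by ring, Nat.factorial_succ, Nat.factorial_succ,
      ascPochhammer_succ_eval, Nat.factorial_succ i]
    push_cast
    rw [ih]
    ring

namespace GegenbauerRecurrence

variable {ν μ : ℂ} {q : ℕ → ℂ}

theorem taylorCoeff_two_mul (hq : GegenbauerRecurrence ν μ q) (i : ℕ) :
    taylorCoeff q (2 * i) =
      q 0 * ordinaryHypergeometricCoefficient ((μ - ν) / 2) ((ν + μ + 1) / 2) (1 / 2 : ℂ) i := by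
  have hpow : (4 : ℂ) ^ i ≠ 0 := pow_ne_zero _ (by norm_num)
  rw [taylorCoeff, hq.apply_two_mul, factorial_two_mul_eq_pow_mul_ascPochhammer, pow_mul,
    neg_one_sq, one_pow, one_mul, ordinaryHypergeometricCoefficient,
    mul_assoc (4 ^ i : ℂ) (i.factorial : ℂ), div_eq_mul_inv, mul_inv (4 ^ i : ℂ), mul_inv]
  field_simp

theorem taylorCoeff_two_mul_add_one (hq : GegenbauerRecurrence ν μ q) (i : ℕ) :
    taylorCoeff q (2 * i + 1) = -q 1 *
      ordinaryHypergeometricCoefficient ((μ - ν + 1) / 2) ((ν + μ + 2) / 2) (3 / 2 : ℂ) i := by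
  have hpow : (4 : ℂ) ^ i ≠ 0 := pow_ne_zero _ (by norm_num)
  have happly := (hq.shift 1).apply_two_mul i
  simp only [zero_add, Nat.cast_one] at happly
  rw [taylorCoeff, happly, factorial_two_mul_add_one_eq_pow_mul_ascPochhammer, pow_succ, pow_mul,
    neg_one_sq, one_pow, one_mul, ordinaryHypergeometricCoefficient,
    mul_assoc (4 ^ i : ℂ) (i.factorial : ℂ), div_eq_mul_inv, mul_inv (4 ^ i : ℂ), mul_inv,
    show μ + 1 - ν = μ - ν + 1 by ring, show ν + (μ + 1) + 1 = ν + μ + 2 by ring]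
  field_simp

theorem taylorFamily_zero_apply (hq : GegenbauerRecurrence ν μ q) {z : ℂ} (hz : ‖z‖ < 1) :
    taylorFamily q 0 z
      = q 0 * ordinaryHypergeometric ((μ - ν) / 2) ((ν + μ + 1) / 2) (1 / 2 : ℂ) (z ^ 2)
        - q 1 * z *
          ordinaryHypergeometric ((μ - ν + 1) / 2) ((ν + μ + 2) / 2) (3 / 2 : ℂ) (z ^ 2) := by
  have hs := hq.isSubexponential_taylorCoeff.summable hz
  have heven : Summable fun i => taylorCoeff q (2 * i) * z ^ (2 * i) :=
    hs.comp_injective (i := fun i : ℕ => 2 * i) (mul_right_injective₀ two_ne_zero)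
  have hodd : Summable fun i => taylorCoeff q (2 * i + 1) * z ^ (2 * i + 1) :=
    hs.comp_injective (i := fun i : ℕ => 2 * i + 1) fun a b h => by simpa using h
  have hevenSum : ∑' i, taylorCoeff q (2 * i) * z ^ (2 * i) = q 0 *
      ordinaryHypergeometric ((μ - ν) / 2) ((ν + μ + 1) / 2) (1 / 2 : ℂ) (z ^ 2) := by
    rw [ordinaryHypergeometric_eq_tsum, ← tsum_mul_left]
    refine tsum_congr fun i => ?_
    rw [hq.taylorCoeff_two_mul, smul_eq_mul, pow_mul, mul_assoc]
  have hoddSum : ∑' i, taylorCoeff q (2 * i + 1) * z ^ (2 * i + 1) = -(q 1 * z *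
      ordinaryHypergeometric ((μ - ν + 1) / 2) ((ν + μ + 2) / 2) (3 / 2 : ℂ) (z ^ 2)) := by
    rw [ordinaryHypergeometric_eq_tsum, ← tsum_mul_left, ← tsum_neg]
    refine tsum_congr fun i => ?_
    rw [hq.taylorCoeff_two_mul_add_one, smul_eq_mul, pow_succ, pow_mul]
    ring
  calc taylorFamily q 0 z = ∑' j, taylorCoeff q j * z ^ j := rfl
    _ = _ := (tsum_even_add_odd (f := fun j => taylorCoeff q j * z ^ j) heven hodd).symm
    _ = _ := by rw [hevenSum, hoddSum, ← sub_eq_add_neg]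

theorem taylorFamily_apply (hq : GegenbauerRecurrence ν μ q) (n : ℕ) {z : ℂ} (hz : ‖z‖ < 1) :
    taylorFamily q n z
      = q n * ordinaryHypergeometric ((μ + n - ν) / 2) ((ν + (μ + n) + 1) / 2) (1 / 2 : ℂ) (z ^ 2)
        - q (n + 1) * z * ordinaryHypergeometric ((μ + n - ν + 1) / 2) ((ν + (μ + n) + 2) / 2)
          (3 / 2 : ℂ) (z ^ 2) := by
  have h := (hq.shift n).taylorFamily_zero_apply hz
  rw [zero_add, add_comm 1 n] at h
  exact h

end GegenbauerRecurrence

/-! ### Ferrers functions with given values at `0` -/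

section Continuity

theorem norm_ascPochhammer_eval_le {a : ℂ} {A : ℝ} (h : ‖a‖ ≤ A) (j : ℕ) :
    ‖(ascPochhammer ℂ j).eval a‖ ≤ ‖(ascPochhammer ℂ j).eval (A : ℂ)‖ := by
  have hA : 0 ≤ A := (norm_nonneg a).trans h
  induction j with
  | zero => simp
  | succ j ih =>
    have hnorm : ‖(A : ℂ) + j‖ = A + j := by
      rw [← Complex.ofReal_natCast, ← Complex.ofReal_add, Complex.norm_real,
        Real.norm_of_nonneg (by positivity)]
    have hle : ‖a + j‖ ≤ A + j := (norm_add_le _ _).trans (by rw [Complex.norm_natCast]; gcongr)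
    rw [ascPochhammer_succ_eval, ascPochhammer_succ_eval, norm_mul, norm_mul, hnorm]
    gcongr

theorem continuous_regularizedGaussHGFun (c : ℂ) {z : ℂ} (hz : ‖z‖ < 1) :
    Continuous fun ab : ℂ × ℂ => Complex.regularizedGaussHGFun ab.1 ab.2 c z := by
  simp only [← powerSum_gaussCoeff, powerSum]
  refine continuous_iff_continuousAt.2 fun ⟨a, b⟩ => ?_
  have hcont : ContinuousOn (fun ab : ℂ × ℂ => ∑' j, gaussCoeff ab.1 ab.2 c j * z ^ j)
      (Metric.ball 0 (‖a‖ + 1) ×ˢ Metric.ball 0 (‖b‖ + 1)) := by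
    refine continuousOn_tsum (fun j => ?_) ((hypergeometricRecursion_gaussCoeff
      ((‖a‖ + 1 : ℝ) : ℂ) ((‖b‖ + 1 : ℝ) : ℂ) c).isSubexponential.summable_norm hz)
      fun j ab hab => ?_
    · have heval : Continuous fun t : ℂ => (ascPochhammer ℂ j).eval t := Polynomial.continuous _
      exact ((((heval.comp continuous_fst).mul (heval.comp continuous_snd)).div_const _).mul
        continuous_const).continuousOn
    · have hleft := norm_ascPochhammer_eval_le (mem_ball_zero_iff.1 hab.1).le j
      have hright := norm_ascPochhammer_eval_le (mem_ball_zero_iff.1 hab.2).le j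
      simp only [gaussCoeff, norm_mul, norm_div]
      gcongr
  exact hcont.continuousAt ((Metric.isOpen_ball.prod Metric.isOpen_ball).mem_nhds (by simp))

theorem continuous_ordinaryHypergeometric {c : ℂ} (hc : ∀ k : ℕ, c ≠ -k) {z : ℂ} (hz : ‖z‖ < 1) :
    Continuous fun ab : ℂ × ℂ => ordinaryHypergeometric ab.1 ab.2 c z :=
  ((continuous_regularizedGaussHGFun c hz).mul_const (Complex.Gamma c)).congr fun ab => by
    rw [← Complex.ordinaryHypergeometric_div_Gamma_eq hc,
      div_mul_cancel₀ _ (Complex.Gamma_ne_zero hc)]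

end Continuity

section FerrersForm

/-- The Ferrers function of degree `ν` and order `m` with value `c₀` and derivative `-c₁` at the
origin. -/
noncomputable def ferrersForm (c₀ c₁ ν m : ℂ) (x : ℝ) : ℂ :=
  ((1 - x ^ 2 : ℝ) : ℂ) ^ (-(m / 2)) *
    (c₀ * ordinaryHypergeometric ((-ν - m) / 2) ((ν - m + 1) / 2) (1 / 2 : ℂ) ((x : ℂ) ^ 2)
      - c₁ * x *
        ordinaryHypergeometric ((1 - ν - m) / 2) ((ν - m + 2) / 2) (3 / 2 : ℂ) ((x : ℂ) ^ 2))

variable {ν μ m : ℂ} {q : ℕ → ℂ} {β x : ℝ}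

theorem half_ne_neg_natCast (k : ℕ) : (1 / 2 : ℂ) ≠ -k := fun h => by
  have hcast : (1 + 2 * k : ℂ) = 0 := by linear_combination 2 * h
  exact absurd hcast (by norm_cast; lia)

theorem three_halves_ne_neg_natCast (k : ℕ) : (3 / 2 : ℂ) ≠ -k := fun h => by
  have hcast : (3 + 2 * k : ℂ) = 0 := by linear_combination 2 * h
  exact absurd hcast (by norm_cast; lia)

theorem norm_ofReal_sq_lt_one (hx : |x| < 1) : ‖(x : ℂ) ^ 2‖ < 1 := by
  rw [norm_pow, Complex.norm_real]
  exact pow_lt_one₀ (norm_nonneg _) hx two_ne_zero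

theorem continuousAt_ferrersForm {c₀ c₁ : ℂ → ℂ} (h₀ : ContinuousAt c₀ m)
    (h₁ : ContinuousAt c₁ m) (ν : ℂ) (hx : |x| < 1) :
    ContinuousAt (fun m => ferrersForm (c₀ m) (c₁ m) ν m x) m := by
  have hz := norm_ofReal_sq_lt_one hx
  have hbase : ((1 - x ^ 2 : ℝ) : ℂ) ≠ 0 := by
    exact_mod_cast (sub_pos.2 ((sq_lt_one_iff_abs_lt_one x).2 hx)).ne'
  have hpow : Continuous fun m : ℂ => ((1 - x ^ 2 : ℝ) : ℂ) ^ (-(m / 2)) :=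
    Continuous.const_cpow (by fun_prop) (Or.inl hbase)
  have heven : Continuous fun m : ℂ =>
      ordinaryHypergeometric ((-ν - m) / 2) ((ν - m + 1) / 2) (1 / 2 : ℂ) ((x : ℂ) ^ 2) :=
    (continuous_ordinaryHypergeometric half_ne_neg_natCast hz).comp
      (f := fun m : ℂ => ((-ν - m) / 2, (ν - m + 1) / 2)) (by fun_prop)
  have hodd : Continuous fun m : ℂ =>
      ordinaryHypergeometric ((1 - ν - m) / 2) ((ν - m + 2) / 2) (3 / 2 : ℂ) ((x : ℂ) ^ 2) :=
    (continuous_ordinaryHypergeometric three_halves_ne_neg_natCast hz).comp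
      (f := fun m : ℂ => ((1 - ν - m) / 2, (ν - m + 2) / 2)) (by fun_prop)
  exact hpow.continuousAt.mul ((h₀.mul heven.continuousAt).sub
    ((h₁.mul continuousAt_const).mul hodd.continuousAt))

theorem one_sub_cos_sq_cpow_half (hβ : β ∈ Set.Ioo 0 Real.pi) (e : ℂ) :
    ((1 - Real.cos β ^ 2 : ℝ) : ℂ) ^ (e / 2) = (Real.sin β : ℂ) ^ e := by
  have hsin := Real.sin_pos_of_mem_Ioo hβ
  rw [← Real.sin_sq, ofReal_cpow_eq_exp (by positivity), ofReal_cpow_eq_exp hsin, Real.log_pow]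
  congr 1
  push_cast
  ring

theorem abs_cos_lt_one (hβ : β ∈ Set.Ioo 0 Real.pi) : |Real.cos β| < 1 :=
  abs_lt.2 ⟨by linarith [one_add_cos_pos hβ], by linarith [one_sub_cos_pos hβ]⟩

theorem norm_ofReal_cos_lt_one (hβ : β ∈ Set.Ioo 0 Real.pi) : ‖(Real.cos β : ℂ)‖ < 1 :=
  (Complex.norm_real _).trans_lt (abs_cos_lt_one hβ)

theorem ferrersForm_neg_order (c₀ c₁ ν m : ℂ) (hβ : β ∈ Set.Ioo 0 Real.pi) :
    ferrersForm c₀ c₁ ν (-m) (Real.cos β) = ferrersForm c₀ c₁ ν m (Real.cos β) := by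
  have hz := norm_ofReal_sq_lt_one (abs_cos_lt_one hβ)
  have hsymm (a b c : ℂ) : ordinaryHypergeometric a b c ((Real.cos β : ℂ) ^ 2)
      = ordinaryHypergeometric b a c ((Real.cos β : ℂ) ^ 2) := by
    rw [ordinaryHypergeometric, ordinaryHypergeometric, ordinaryHypergeometricSeries_symm]
  have heven := ordinaryHypergeometric_euler (a := (-ν - m) / 2) (b := (ν - m + 1) / 2)
    half_ne_neg_natCast hz
  have hodd := ordinaryHypergeometric_euler (a := (1 - ν - m) / 2) (b := (ν - m + 2) / 2)
    three_halves_ne_neg_natCast hz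
  have hbase : 1 - (Real.cos β : ℂ) ^ 2 = ((1 - Real.cos β ^ 2 : ℝ) : ℂ) := by push_cast; ring
  rw [hbase, show (1 / 2 : ℂ) - (-ν - m) / 2 - (ν - m + 1) / 2 = 2 * m / 2 by ring,
    show (1 / 2 : ℂ) - (-ν - m) / 2 = (ν + m + 1) / 2 by ring,
    show (1 / 2 : ℂ) - (ν - m + 1) / 2 = (-ν + m) / 2 by ring,
    one_sub_cos_sq_cpow_half hβ, hsymm ((ν + m + 1) / 2)] at heven
  rw [hbase, show (3 / 2 : ℂ) - (1 - ν - m) / 2 - (ν - m + 2) / 2 = 2 * m / 2 by ring,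
    show (3 / 2 : ℂ) - (1 - ν - m) / 2 = (ν + m + 2) / 2 by ring,
    show (3 / 2 : ℂ) - (ν - m + 2) / 2 = (1 - ν + m) / 2 by ring,
    one_sub_cos_sq_cpow_half hβ, hsymm ((ν + m + 2) / 2)] at hodd
  have hpow : (Real.sin β : ℂ) ^ (-m) * (Real.sin β : ℂ) ^ (2 * m) = (Real.sin β : ℂ) ^ m := by
    rw [← Complex.cpow_add _ _ (by exact_mod_cast (Real.sin_pos_of_mem_Ioo hβ).ne')]
    congr 1
    ring
  simp only [ferrersForm, heven, hodd, neg_div', neg_neg, sub_neg_eq_add,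
    one_sub_cos_sq_cpow_half hβ, ← hpow]
  ring

theorem GegenbauerRecurrence.ferrersForm_neg_cos (hq : GegenbauerRecurrence ν μ q) (n : ℕ)
    (hβ : β ∈ Set.Ioo 0 Real.pi) :
    ferrersForm (q n) (q (n + 1)) ν (-(μ + n)) (Real.cos β)
      = (Real.sin β : ℂ) ^ (μ + n) * taylorFamily q n (Real.cos β) := by
  rw [ferrersForm, hq.taylorFamily_apply n (norm_ofReal_cos_lt_one hβ), neg_div', neg_neg,
    one_sub_cos_sq_cpow_half hβ, show -ν - -(μ + n) = μ + n - ν by ring,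
    show ν - -(μ + n) + 1 = ν + (μ + n) + 1 by ring,
    show 1 - ν - -(μ + n) = μ + n - ν + 1 by ring,
    show ν - -(μ + n) + 2 = ν + (μ + n) + 2 by ring]

theorem GegenbauerRecurrence.ferrersForm_cos (hq : GegenbauerRecurrence ν μ q) (n : ℕ)
    (hβ : β ∈ Set.Ioo 0 Real.pi) :
    ferrersForm (q n) (q (n + 1)) ν (μ + n) (Real.cos β)
      = (Real.sin β : ℂ) ^ (μ + n) * taylorFamily q n (Real.cos β) := by
  rw [← ferrersForm_neg_order _ _ _ _ hβ, hq.ferrersForm_neg_cos n hβ]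

end FerrersForm

/-! ### Ferrers functions of the second kind -/

section GammaRatio

theorem inv_Gamma_eq_ascPochhammer_mul (z : ℂ) (n : ℕ) :
    (Complex.Gamma z)⁻¹ = (ascPochhammer ℂ n).eval z * (Complex.Gamma (z + n))⁻¹ := by
  induction n with
  | zero => simp
  | succ n ih =>
    rw [ih, Complex.one_div_Gamma_eq_self_mul_one_div_Gamma_add_one (z + n),
      ascPochhammer_succ_eval, Nat.cast_succ, ← add_assoc, mul_assoc]

theorem Gamma_div_Gamma_of_add_eq_neg {s t : ℂ} {k : ℕ} (hst : s + t = -k)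
    (hs : ∀ j : ℕ, s ≠ -j) :
    Complex.Gamma s / Complex.Gamma t
      = (-1) ^ (k + 1) * (Complex.Gamma (1 - t) / Complex.Gamma (1 - s)) := by
  have hneg : (ascPochhammer ℂ (k + 1)).eval t
      = (-1) ^ (k + 1) * (ascPochhammer ℂ (k + 1)).eval s := by
    rw [show t = -(s + k) by linear_combination hst, ascPochhammer_eval_neg_eq_descPochhammer,
      descPochhammer_eval_eq_ascPochhammer]
    congr 2
    push_cast
    ring
  have hupper := Complex.Gamma_add_nat_div_Gamma_eq (n := k + 1) s hs
  rw [div_eq_iff (Complex.Gamma_ne_zero hs)] at hupper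
  have hone_sub_t : 1 - t = s + (k + 1 : ℕ) := by push_cast; linear_combination -hst
  have hone_sub_s : 1 - s = t + (k + 1 : ℕ) := by push_cast; linear_combination -hst
  rw [div_eq_mul_inv, inv_Gamma_eq_ascPochhammer_mul t (k + 1), hneg, hone_sub_t, hone_sub_s,
    hupper]
  ring

end GammaRatio

section FerrersQ

/-- The value at the origin of the Ferrers function of the second kind of degree `ν` and
order `m`. -/
noncomputable def ferrersQAtZero (ν m : ℂ) : ℂ :=
  -((Complex.Gamma ((ν + m + 1) / 2) / Complex.Gamma ((ν - m + 2) / 2)) *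
    ((Real.sqrt Real.pi : ℂ) * ((2 : ℂ) ^ (m - 1) * Complex.sin (Real.pi / 2 * (ν + m)))))

/-- The continuation in the order `m` of `ferrersQAtZero ν m` for `ν = -(k + 3/2)`: the reflection
formula moves the poles of the gamma functions to the zeros of `m - ν + 2 j`. -/
noncomputable def anomalousQAtZero (k : ℕ) (ν m : ℂ) : ℂ :=
  -((-1) ^ (k + 1) * (Complex.Gamma ((m - ν) / 2) / Complex.Gamma ((1 - ν - m) / 2)) *
    ((Real.sqrt Real.pi : ℂ) * ((2 : ℂ) ^ (m - 1) * Complex.sin (Real.pi / 2 * (ν + m)))))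

variable {ν μ m : ℂ} {k : ℕ} {x : ℝ}

theorem ferrersQSeries_eq_ferrersForm (ν m : ℂ) (x : ℝ) :
    ferrersQSeries ν m x
      = ferrersForm (ferrersQAtZero ν m) (ferrersQAtZero ν (m + 1)) ν m x := by
  have hsin : Complex.sin (Real.pi / 2 * (ν + (m + 1)))
      = Complex.cos (Real.pi / 2 * (ν + m)) := by
    rw [← Complex.sin_add_pi_div_two]
    congr 1
    ring
  rw [ferrersQSeries, ferrersForm, ferrersQAtZero, ferrersQAtZero, hsin, Complex.cpow_neg,
    add_sub_cancel_right, show ν + (m + 1) + 1 = ν + m + 2 by ring,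
    show ν - (m + 1) + 2 = ν - m + 1 by ring]
  ring

theorem two_cpow_mul_sin_add_two (ν m : ℂ) :
    (2 : ℂ) ^ (m + 2 - 1) * Complex.sin (Real.pi / 2 * (ν + (m + 2)))
      = -4 * ((2 : ℂ) ^ (m - 1) * Complex.sin (Real.pi / 2 * (ν + m))) := by
  have hsin : Complex.sin (Real.pi / 2 * (ν + (m + 2)))
      = -Complex.sin (Real.pi / 2 * (ν + m)) := by
    rw [← Complex.sin_add_pi]
    congr 1
    ring
  have hpow : (2 : ℂ) ^ (m + 2 - 1) = 4 * (2 : ℂ) ^ (m - 1) := by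
    rw [show m + 2 - 1 = m - 1 + (2 : ℕ) by push_cast; ring, Complex.cpow_add _ _ two_ne_zero,
      Complex.cpow_natCast]
    ring
  rw [hsin, hpow]
  ring

theorem ferrersQAtZero_add_two (h : ν + m + 1 ≠ 0) :
    ferrersQAtZero ν (m + 2) = (ν + m + 1) * (m - ν) * ferrersQAtZero ν m := by
  have hnum : Complex.Gamma ((ν + (m + 2) + 1) / 2)
      = (ν + m + 1) / 2 * Complex.Gamma ((ν + m + 1) / 2) := by
    rw [← Complex.Gamma_add_one _ (div_ne_zero h two_ne_zero)]
    congr 1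
    ring
  have hden := Complex.one_div_Gamma_eq_self_mul_one_div_Gamma_add_one ((ν - (m + 2) + 2) / 2)
  rw [show (ν - (m + 2) + 2) / 2 + 1 = (ν - m + 2) / 2 by ring] at hden
  rw [ferrersQAtZero, ferrersQAtZero, two_cpow_mul_sin_add_two, div_eq_mul_inv, hnum, hden,
    div_eq_mul_inv]
  ring

theorem anomalousQAtZero_add_two (k : ℕ) (h : m - ν ≠ 0) :
    anomalousQAtZero k ν (m + 2) = (ν + m + 1) * (m - ν) * anomalousQAtZero k ν m := by
  have hnum : Complex.Gamma ((m + 2 - ν) / 2) = (m - ν) / 2 * Complex.Gamma ((m - ν) / 2) := by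
    rw [← Complex.Gamma_add_one _ (div_ne_zero h two_ne_zero)]
    congr 1
    ring
  have hden := Complex.one_div_Gamma_eq_self_mul_one_div_Gamma_add_one ((1 - ν - (m + 2)) / 2)
  rw [show (1 - ν - (m + 2)) / 2 + 1 = (1 - ν - m) / 2 by ring] at hden
  rw [anomalousQAtZero, anomalousQAtZero, two_cpow_mul_sin_add_two, div_eq_mul_inv, hnum, hden,
    div_eq_mul_inv]
  ring

theorem ferrersQAtZero_eq_anomalousQAtZero (hν : ν = -((k : ℂ) + 3 / 2))
    (hm : ¬ IsNegInt (ν + m)) : ferrersQAtZero ν m = anomalousQAtZero k ν m := by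
  have h := Gamma_div_Gamma_of_add_eq_neg (s := (ν + m + 1) / 2) (t := (ν - m + 2) / 2) (k := k)
    (by rw [hν]; ring) fun j hj => hm ⟨2 * j, by push_cast; linear_combination 2 * hj⟩
  rw [ferrersQAtZero, h, anomalousQAtZero, show 1 - (ν - m + 2) / 2 = (m - ν) / 2 by ring,
    show 1 - (ν + m + 1) / 2 = (1 - ν - m) / 2 by ring]

theorem ferrersQSeries_eq_ferrersForm_anomalous (hν : ν = -((k : ℂ) + 3 / 2))
    (hm : ¬ IsNegInt (ν + m)) (x : ℝ) : ferrersQSeries ν m x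
      = ferrersForm (anomalousQAtZero k ν m) (anomalousQAtZero k ν (m + 1)) ν m x := by
  have hm' : ¬ IsNegInt (ν + (m + 1)) := fun ⟨j, hj⟩ =>
    hm ⟨j + 1, by push_cast; linear_combination hj⟩
  rw [ferrersQSeries_eq_ferrersForm, ferrersQAtZero_eq_anomalousQAtZero hν hm,
    ferrersQAtZero_eq_anomalousQAtZero hν hm']

theorem continuousAt_anomalousQAtZero (k : ℕ) (h : ∀ j : ℕ, m - ν ≠ -j) :
    ContinuousAt (anomalousQAtZero k ν) m := by
  have hnum : ContinuousAt (fun m : ℂ => Complex.Gamma ((m - ν) / 2)) m := by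
    have hΓ : ContinuousAt Complex.Gamma ((m - ν) / 2) :=
      (Complex.differentiableAt_Gamma _ fun j hj =>
        h (2 * j) (by push_cast; linear_combination 2 * hj)).continuousAt
    exact hΓ.comp (f := fun m : ℂ => (m - ν) / 2) (by fun_prop)
  have hden : Continuous fun m : ℂ => (Complex.Gamma ((1 - ν - m) / 2))⁻¹ :=
    Complex.differentiable_one_div_Gamma.continuous.comp (by fun_prop)
  have hpow : Continuous fun m : ℂ => (2 : ℂ) ^ (m - 1) :=
    (continuous_id.sub continuous_const).const_cpow (Or.inl two_ne_zero)
  have hsin : Continuous fun m : ℂ => Complex.sin (Real.pi / 2 * (ν + m)) := by fun_prop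
  exact ((continuousAt_const.mul (hnum.mul hden.continuousAt)).mul
    (continuous_const.mul (hpow.mul hsin)).continuousAt).neg

theorem IsNegInt.eventually_not_add (h : IsNegInt (ν + m)) :
    ∀ᶠ m' in 𝓝[≠] m, ¬ IsNegInt (ν + m') := by
  obtain ⟨i, hi⟩ := h
  have hball : ∀ᶠ m' in 𝓝[≠] m, dist m' m < 1 :=
    nhdsWithin_le_nhds (Metric.ball_mem_nhds m one_pos)
  filter_upwards [hball, self_mem_nhdsWithin] with m' hdist hne
  rintro ⟨j, hj⟩
  have hsub : m' - m = ((i - j : ℤ) : ℂ) := by push_cast; linear_combination hj - hi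
  rw [dist_eq_norm, hsub, Complex.norm_intCast] at hdist
  have hzero : (i - j : ℤ) = 0 := Int.abs_lt_one_iff.1 (by exact_mod_cast hdist)
  exact hne (sub_eq_zero.1 (by rw [hsub, hzero, Int.cast_zero]))

theorem ferrersQ_eq_ferrersForm_anomalous (hν : ν = -((k : ℂ) + 3 / 2))
    (hm : ∀ j : ℕ, m - ν ≠ -j) (hx : |x| < 1) : ferrersQ ν m x
      = ferrersForm (anomalousQAtZero k ν m) (anomalousQAtZero k ν (m + 1)) ν m x := by
  by_cases hneg : IsNegInt (ν + m)
  · have hslope : ContinuousAt (fun m' => anomalousQAtZero k ν (m' + 1)) m :=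
      (continuousAt_anomalousQAtZero k fun j hj => hm (j + 1) (by
        push_cast; linear_combination hj)).comp (f := fun m' : ℂ => m' + 1) (by fun_prop)
    have hlim := continuousAt_ferrersForm (continuousAt_anomalousQAtZero k hm) hslope ν hx
    rw [ferrersQ, if_pos hneg]
    refine Tendsto.limUnder_eq ((hlim.tendsto.mono_left nhdsWithin_le_nhds).congr' ?_)
    filter_upwards [hneg.eventually_not_add] with m' hm'
    exact (ferrersQSeries_eq_ferrersForm_anomalous hν hm' x).symm
  · rw [ferrersQ, if_neg hneg, ferrersQSeries_eq_ferrersForm_anomalous hν hneg]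

theorem exists_taylorFamily_ferrersQ (hμ : ∀ k : ℕ, 2 * μ ≠ -k)
    (hdef : ∀ n : ℕ, FerrersQDefined ν (μ + n)) :
    ∃ q : ℕ → ℂ, GegenbauerRecurrence ν μ q ∧
      ∀ n : ℕ, ∀ β ∈ Set.Ioo 0 Real.pi, ferrersQ ν (μ + n) (Real.cos β)
        = (Real.sin β : ℂ) ^ (μ + n) * taylorFamily q n (Real.cos β) := by
  obtain ⟨Q, hQ_add_two, hQ⟩ : ∃ Q : ℂ → ℂ,
      (∀ n : ℕ, Q (μ + n + 2) = (ν + (μ + n) + 1) * (μ + n - ν) * Q (μ + n)) ∧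
      ∀ n : ℕ, ∀ β ∈ Set.Ioo 0 Real.pi, ferrersQ ν (μ + n) (Real.cos β)
        = ferrersForm (Q (μ + n)) (Q (μ + n + 1)) ν (μ + n) (Real.cos β) := by
    by_cases h : ∃ n : ℕ, IsNegInt (ν + (μ + n))
    · obtain ⟨i, hi⟩ := h
      obtain ⟨k, hk⟩ := ((hdef i).resolve_left (not_not.2 hi)).1
      obtain ⟨l, hl⟩ := hi
      have hsub (n j : ℕ) : μ + n - ν ≠ -j := fun hj =>
        hμ (i + l + 1 + n + j) (by push_cast; linear_combination hl + hj)
      exact ⟨anomalousQAtZero k ν,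
        fun n => anomalousQAtZero_add_two k (by simpa using hsub n 0),
        fun n β hβ => ferrersQ_eq_ferrersForm_anomalous hk (hsub n) (abs_cos_lt_one hβ)⟩
    · push Not at h
      refine ⟨ferrersQAtZero ν, fun n => ferrersQAtZero_add_two fun h0 =>
        h n ⟨0, by push_cast; linear_combination h0⟩, fun n β _ => ?_⟩
      rw [ferrersQ, if_neg (h n), ferrersQSeries_eq_ferrersForm]
  have hq : GegenbauerRecurrence ν μ fun n : ℕ => Q (μ + n) := fun n =>
    (congrArg Q (by push_cast; ring)).trans (hQ_add_two n)
  refine ⟨_, hq, fun n β hβ => ?_⟩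
  rw [hQ n β hβ, ← hq.ferrersForm_cos n hβ, Nat.cast_succ, ← add_assoc]

theorem sub_ne_intCast_of_ferrersQDefined (hdef : ∀ n : ℕ, FerrersQDefined ν (-(μ + n))) (N : ℤ) :
    ν - μ ≠ N := by
  intro hN
  obtain ⟨n, hn⟩ := exists_nat_gt (max (N : ℝ) (-(ν + μ).re))
  have hNn : N < n := by exact_mod_cast (le_max_left _ _).trans_lt hn
  have hre := (le_max_right _ _).trans_lt hn
  obtain ⟨i, hi⟩ := Int.le.dest (Int.add_one_le_of_lt hNn)
  have hneg : IsNegInt (ν + -(μ + n)) := ⟨i, by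
    have hcast : (N : ℂ) + 1 + i = n := by exact_mod_cast hi
    linear_combination hN + hcast⟩
  obtain ⟨-, j, hj⟩ := (hdef n).resolve_left (not_not.2 hneg)
  have hsum : (ν + μ).re = -(j + 1) - n := by
    rw [show ν + μ = ((-(j + 1) - n : ℝ) : ℂ) by push_cast; linear_combination hj,
      Complex.ofReal_re]
  linarith [j.cast_nonneg (α := ℝ)]

theorem ferrersQAtZero_neg_add_one (h : ∀ N : ℤ, ν - μ ≠ N) (n : ℕ) :
    ferrersQAtZero ν (-(μ + n) + 1) = (ν + μ + 1 + n) * (μ - ν + n) *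
      ferrersQAtZero ν (-(μ + (n + 1 : ℕ))) := by
  have hadd := ferrersQAtZero_add_two (ν := ν) (m := -(μ + (n + 1 : ℕ))) fun h0 =>
    h n (by push_cast at h0 ⊢; linear_combination h0)
  rw [show -(μ + ((n + 1 : ℕ) : ℂ)) + 2 = -(μ + n) + 1 by push_cast; ring] at hadd
  rw [hadd]
  push_cast
  ring

theorem exists_taylorFamily_ferrersQ_neg (hdef : ∀ n : ℕ, FerrersQDefined ν (-(μ + n))) :
    ∃ q : ℕ → ℂ, GegenbauerRecurrence ν μ q ∧
      ∀ n : ℕ, ∀ β ∈ Set.Ioo 0 Real.pi,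
        pochhammerSymbol (ν + μ + 1) n * pochhammerSymbol (μ - ν) n *
            ferrersQ ν (-(μ + n)) (Real.cos β)
          = (Real.sin β : ℂ) ^ (μ + n) * taylorFamily q n (Real.cos β) := by
  have hsub := sub_ne_intCast_of_ferrersQDefined hdef
  have hpoch (t : ℂ) (n : ℕ) : pochhammerSymbol t (n + 1) = pochhammerSymbol t n * (t + n) :=
    ascPochhammer_succ_eval _ _
  set q : ℕ → ℂ := fun n => pochhammerSymbol (ν + μ + 1) n * pochhammerSymbol (μ - ν) n *
    ferrersQAtZero ν (-(μ + n)) with hq_def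
  have hq : GegenbauerRecurrence ν μ q := fun n => by
    have h := ferrersQAtZero_neg_add_one hsub (n + 1)
    rw [show -(μ + ((n + 1 : ℕ) : ℂ)) + 1 = -(μ + n) by push_cast; ring] at h
    simp only [hq_def, hpoch, h]
    push_cast
    ring_nf
  refine ⟨q, hq, fun n β hβ => ?_⟩
  have hnot : ¬ IsNegInt (ν + -(μ + n)) := fun ⟨j, hj⟩ =>
    hsub (n - j - 1) (by push_cast; linear_combination hj)
  rw [← hq.ferrersForm_neg_cos n hβ, ferrersQ, if_neg hnot, ferrersQSeries_eq_ferrersForm,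
    ferrersQAtZero_neg_add_one hsub]
  simp only [ferrersForm, hq_def, hpoch]
  ring

end FerrersQ

section Domain

variable {α β : ℝ}

theorem add_lt_pi_of_tan_mul_tan_lt_one (hα : α ∈ Set.Ioo 0 Real.pi) (hβ : β ∈ Set.Ioo 0 Real.pi)
    (h : Real.tan (α / 2) * Real.tan (β / 2) < 1) : α + β < Real.pi := by
  by_contra! hle
  have hcosα : 0 < Real.cos (α / 2) :=
    Real.cos_pos_of_mem_Ioo ⟨by linarith [hα.1, Real.pi_pos], by linarith [hα.2]⟩
  have hcosβ : 0 < Real.cos (β / 2) :=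
    Real.cos_pos_of_mem_Ioo ⟨by linarith [hβ.1, Real.pi_pos], by linarith [hβ.2]⟩
  rw [Real.tan_eq_sin_div_cos, Real.tan_eq_sin_div_cos, div_mul_div_comm,
    div_lt_one (mul_pos hcosα hcosβ)] at h
  have hcos : Real.cos (α / 2 + β / 2) ≤ 0 :=
    Real.cos_nonpos_of_pi_div_two_le_of_le (by linarith) (by linarith [hα.2, hβ.2])
  rw [Real.cos_add] at hcos
  linarith

theorem neg_one_lt_cos_mul_cos_sub_sin_mul_sin (h₀ : 0 < α + β) (hπ : α + β < Real.pi) :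
    -1 < Real.cos α * Real.cos β - Real.sin α * Real.sin β := by
  have h := one_add_cos_pos ⟨h₀, hπ⟩
  rw [Real.cos_add] at h
  linarith

theorem cos_mul_cos_add_sin_mul_sin_lt_one (h₀ : α < β) (hπ : β - α < Real.pi) :
    Real.cos α * Real.cos β + Real.sin α * Real.sin β < 1 := by
  have h := one_sub_cos_pos ⟨sub_pos.2 h₀, hπ⟩
  rw [Real.cos_sub] at h
  linarith

theorem abs_cos_mul_cos_le_one (α β : ℝ) : |Real.cos α * Real.cos β| ≤ 1 := by
  rw [abs_mul]
  exact mul_le_one₀ (Real.abs_cos_le_one α) (abs_nonneg _) (Real.abs_cos_le_one β)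

theorem abs_cos_mul_cos_sub_one_add_lt (hβ : 0 < β) (hαβ : α + β < Real.pi) :
    ∀ φ ∈ Set.Icc 0 α, |Real.cos φ * Real.cos β - 1| + Real.sin φ * Real.sin β < 2 := by
  rintro φ ⟨h₀, hφ⟩
  have hadd := neg_one_lt_cos_mul_cos_sub_sin_mul_sin (α := φ) (β := β) (by linarith)
    (by linarith)
  have hle := (abs_le.1 (abs_cos_mul_cos_le_one φ β)).2
  rw [abs_of_nonpos (by linarith)]
  linarith

theorem abs_cos_mul_cos_add_one_add_lt (hβ : β < Real.pi) (hαβ : α < β) :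
    ∀ φ ∈ Set.Icc 0 α, |Real.cos φ * Real.cos β - (-1)| + Real.sin φ * Real.sin β < 2 := by
  rintro φ ⟨h₀, hφ⟩
  have hsub := cos_mul_cos_add_sin_mul_sin_lt_one (α := φ) (β := β) (by linarith) (by linarith)
  have hge := (abs_le.1 (abs_cos_mul_cos_le_one φ β)).1
  rw [abs_of_nonneg (by linarith)]
  linarith

theorem abs_cos_mul_cos_add_lt (hαβ : α + β < Real.pi) (hlt : α < β) :
    ∀ φ ∈ Set.Icc 0 α, |Real.cos φ * Real.cos β - 0| + Real.sin φ * Real.sin β < 1 := by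
  rintro φ ⟨h₀, hφ⟩
  have hadd := neg_one_lt_cos_mul_cos_sub_sin_mul_sin (α := φ) (β := β) (by linarith)
    (by linarith)
  have hsub := cos_mul_cos_add_sin_mul_sin_lt_one (α := φ) (β := β) (by linarith) (by linarith)
  rw [sub_zero]
  rcases abs_cases (Real.cos φ * Real.cos β) with ⟨h, -⟩ | ⟨h, -⟩ <;> rw [h] <;> linarith

end Domain

section Identification

variable {ν μ : ℂ} {β : ℝ}

theorem sin_cpow_ne_zero (hβ : β ∈ Set.Ioo 0 Real.pi) (e : ℂ) : (Real.sin β : ℂ) ^ e ≠ 0 := by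
  rw [ofReal_cpow_eq_exp (Real.sin_pos_of_mem_Ioo hβ)]
  exact Complex.exp_ne_zero _

theorem ferrersP_cos_eq_singularFamily (ν μ : ℂ) (n : ℕ) (hβ : β ∈ Set.Ioo 0 Real.pi) :
    ferrersP ν (μ + n) (Real.cos β)
      = (Real.sin β : ℂ) ^ (μ + n) * singularFamily ν μ n (Real.cos β) := by
  have hadd := one_add_cos_pos hβ
  have hsub := one_sub_cos_pos hβ
  rw [ferrersP, singularFamily, ← mul_assoc]
  congr 1
  rw [show 1 - (Real.cos β : ℂ) = ((1 - Real.cos β : ℝ) : ℂ) by push_cast; ring,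
    ofReal_cpow_eq_exp (div_pos hadd hsub), ofReal_cpow_eq_exp (Real.sin_pos_of_mem_Ioo hβ),
    ofReal_cpow_eq_exp hsub, ← Complex.exp_add, Real.log_div hadd.ne' hsub.ne']
  congr 1
  have hlog := congrArg (fun t : ℝ => (t : ℂ)) (two_mul_log_sin hβ)
  push_cast at hlog ⊢
  linear_combination (-(μ + n) / 2) * hlog

theorem ferrersP_neg_cos_eq_regularFamily (ν : ℂ) (hμ : ∀ k : ℕ, μ ≠ -k) (n : ℕ)
    (hβ : β ∈ Set.Ioo 0 Real.pi) :
    pochhammerSymbol (ν + μ + 1) n * pochhammerSymbol (μ - ν) n *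
        ferrersP ν (-(μ + n)) (Real.cos β)
      = (Real.sin β : ℂ) ^ (μ + n) * regularFamily ν μ n (Real.cos β) := by
  have hsin := Real.sin_pos_of_mem_Ioo hβ
  have hm (k : ℕ) : μ + n + 1 ≠ -k := fun hk =>
    hμ (n + 1 + k) (by push_cast; linear_combination hk)
  have hhalf : ((Real.sin β / 2 : ℝ) : ℂ) ^ (μ + n)
      = (Real.sin β : ℂ) ^ (μ + n) * (2 : ℂ) ^ (-(μ + n)) := by
    rw [← Complex.ofReal_ofNat, ofReal_cpow_eq_exp (half_pos hsin), ofReal_cpow_eq_exp hsin,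
      ofReal_cpow_eq_exp two_pos, ← Complex.exp_add, Real.log_div hsin.ne' two_ne_zero]
    congr 1
    push_cast
    ring
  rw [ferrersP_neg_cos ν hm hβ, hhalf, regularFamily]
  ring

end Identification

/-! ### The addition theorems -/

/-- Sides `α`, `β`, `Θ` of a triangle on the unit sphere whose sides `α` and `β` enclose the
angle `γ`, encoded by the spherical law of cosines; the third side may degenerate. -/
structure IsSphericalTriangle (α β γ Θ : ℝ) : Prop where
  left_mem : α ∈ Set.Ioo 0 Real.pi
  right_mem : β ∈ Set.Ioo 0 Real.pi
  third_mem : Θ ∈ Set.Icc 0 Real.pi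
  cos_third : Real.cos Θ =
    Real.cos α * Real.cos β + Real.sin α * Real.sin β * Real.cos γ

namespace IsSphericalTriangle

variable {α β γ Θ : ℝ}

theorem min_max (h : IsSphericalTriangle α β γ Θ) :
    IsSphericalTriangle (min α β) (max α β) γ Θ where
  left_mem := ⟨lt_min h.left_mem.1 h.right_mem.1, min_lt_of_left_lt h.left_mem.2⟩
  right_mem := ⟨lt_max_of_lt_left h.left_mem.1, max_lt h.left_mem.2 h.right_mem.2⟩
  third_mem := h.third_mem
  cos_third := by
    rw [fn_min_mul_fn_max Real.cos, fn_min_mul_fn_max Real.sin, h.cos_third]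

theorem sin_mul_sin_pos (h : IsSphericalTriangle α β γ Θ) : 0 < Real.sin α * Real.sin β :=
  mul_pos (Real.sin_pos_of_mem_Ioo h.left_mem) (Real.sin_pos_of_mem_Ioo h.right_mem)

theorem third_ne_pi (h : IsSphericalTriangle α β γ Θ) (hπ : α + β < Real.pi) :
    Θ ≠ Real.pi := by
  rintro rfl
  have hadd := neg_one_lt_cos_mul_cos_sub_sin_mul_sin (add_pos h.left_mem.1 h.right_mem.1) hπ
  have hcos := h.cos_third
  rw [Real.cos_pi] at hcos
  nlinarith [h.sin_mul_sin_pos, Real.neg_one_le_cos γ]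

theorem third_ne_zero (h : IsSphericalTriangle α β γ Θ) (hlt : α < β) : Θ ≠ 0 := by
  rintro rfl
  have hsub := cos_mul_cos_add_sin_mul_sin_lt_one hlt (by linarith [h.left_mem.1, h.right_mem.2])
  have hcos := h.cos_third
  rw [Real.cos_zero] at hcos
  nlinarith [h.sin_mul_sin_pos, Real.cos_le_one γ]

theorem third_mem_Ioo (h : IsSphericalTriangle α β γ Θ) (hπ : α + β < Real.pi) (hΘ : Θ ≠ 0) :
    Θ ∈ Set.Ioo 0 Real.pi :=
  ⟨h.third_mem.1.lt_of_ne' hΘ, h.third_mem.2.lt_of_ne (h.third_ne_pi hπ)⟩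

end IsSphericalTriangle

theorem hasGegenbauerExpansion_min_max {μ f : ℂ} {θ θ' γ : ℝ} {a : ℕ → ℂ} :
    HasGegenbauerExpansion μ (min θ θ') (max θ θ') γ f a ↔
      HasGegenbauerExpansion μ θ θ' γ f a := by
  simp only [HasGegenbauerExpansion, fn_min_mul_fn_max Real.sin]

section AdditionTheorems

variable {μ ν : ℂ} {α β γ Θ p R : ℝ} {G : ℕ → ℂ → ℂ} {F : ℕ → ℝ → ℂ}

theorem IsGegenbauerFamily.hasGegenbauerExpansion_of_eq_sin_cpow_mul
    (hG : IsGegenbauerFamily ν μ p R G) (hμ : ∀ k : ℕ, 2 * μ ≠ -k)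
    (h : IsSphericalTriangle α β γ Θ) (hΘ : Θ ∈ Set.Ioo 0 Real.pi)
    (hdom : ∀ φ ∈ Set.Icc 0 α, |Real.cos φ * Real.cos β - p| + Real.sin φ * Real.sin β < R)
    (hF : ∀ n : ℕ, ∀ φ ∈ Set.Ioo 0 Real.pi,
      F n φ = (Real.sin φ : ℂ) ^ (μ + n) * G n (Real.cos φ)) :
    HasGegenbauerExpansion μ α β γ (1 / realCpow (Real.sin Θ) μ * F 0 Θ)
      (fun n => (-1) ^ n * ferrersP ν (-(μ + n)) (Real.cos α) * F n β) := by
  have hf : 1 / realCpow (Real.sin Θ) μ * F 0 Θ = G 0 (Real.cos Θ) := by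
    rw [hF 0 Θ hΘ, realCpow, Nat.cast_zero, add_zero, one_div,
      inv_mul_cancel_left₀ (sin_cpow_ne_zero hΘ μ)]
  simp only [hf, hF _ β h.right_mem]
  exact hG.hasGegenbauerExpansion hμ h.left_mem h.right_mem hdom h.cos_third

theorem IsGegenbauerFamily.hasGegenbauerExpansion_pi_sub
    (hG : IsGegenbauerFamily ν μ p R G) (hμ : ∀ k : ℕ, 2 * μ ≠ -k)
    (h : IsSphericalTriangle α β γ Θ) (hΘ : Θ ∈ Set.Ioo 0 Real.pi)
    (hdom : ∀ φ ∈ Set.Icc 0 α, |Real.cos φ * Real.cos β - -p| + Real.sin φ * Real.sin β < R)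
    (hF : ∀ n : ℕ, ∀ φ ∈ Set.Ioo 0 Real.pi,
      F n φ = (Real.sin φ : ℂ) ^ (μ + n) * G n (Real.cos φ)) :
    HasGegenbauerExpansion μ α β γ (1 / realCpow (Real.sin Θ) μ * F 0 (Real.pi - Θ))
      (fun n => ferrersP ν (-(μ + n)) (Real.cos α) * F n (Real.pi - β)) := by
  have hreflect := hG.reflect
  rw [← Complex.ofReal_neg] at hreflect
  have hexp := hreflect.hasGegenbauerExpansion_of_eq_sin_cpow_mul
    (F := fun n φ => (-1) ^ n * F n (Real.pi - φ)) hμ h hΘ hdom fun n φ hφ => by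
      rw [hF n _ ⟨by linarith [hφ.2], by linarith [hφ.1]⟩, Real.sin_pi_sub, Real.cos_pi_sub,
        Complex.ofReal_neg]
      ring
  have hsign (n : ℕ) (x y : ℂ) : (-1) ^ n * x * ((-1) ^ n * y) = x * y := by
    rw [mul_mul_mul_comm, ← mul_pow, neg_one_mul, neg_neg, one_pow, one_mul]
  simpa only [pow_zero, one_mul, hsign] using hexp

namespace IsSphericalTriangle

theorem hasGegenbauerExpansion_ferrersP
    (h : IsSphericalTriangle α β γ Θ) (hμ : ∀ k : ℕ, 2 * μ ≠ -k)
    (hπ : α + β < Real.pi) (ν : ℂ) (hlt : α < β) :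
    HasGegenbauerExpansion μ α β γ (1 / realCpow (Real.sin Θ) μ * ferrersP ν μ (Real.cos Θ))
      (fun n => (-1) ^ n * ferrersP ν (-(μ + n)) (Real.cos α) *
        ferrersP ν (μ + n) (Real.cos β)) := by
  have hG : IsGegenbauerFamily ν μ (0 : ℝ) 1 (singularFamily ν μ) := by
    simpa using isGegenbauerFamily_singularFamily ν μ
  have hexp := hG.hasGegenbauerExpansion_of_eq_sin_cpow_mul hμ h
    (h.third_mem_Ioo hπ (h.third_ne_zero hlt)) (abs_cos_mul_cos_add_lt hπ hlt)
    fun n φ hφ => ferrersP_cos_eq_singularFamily ν μ n hφ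
  simpa using hexp

theorem hasGegenbauerExpansion_ferrersQ
    (h : IsSphericalTriangle α β γ Θ) (hμ : ∀ k : ℕ, 2 * μ ≠ -k)
    (hπ : α + β < Real.pi) (hlt : α < β)
    (hdef : ∀ n : ℕ, FerrersQDefined ν (μ + n)) :
    HasGegenbauerExpansion μ α β γ (1 / realCpow (Real.sin Θ) μ * ferrersQ ν μ (Real.cos Θ))
      (fun n => (-1) ^ n * ferrersP ν (-(μ + n)) (Real.cos α) *
        ferrersQ ν (μ + n) (Real.cos β)) := by
  obtain ⟨q, hq, hQ⟩ := exists_taylorFamily_ferrersQ hμ hdef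
  have hG : IsGegenbauerFamily ν μ (0 : ℝ) 1 (taylorFamily q) := by
    simpa using hq.isGegenbauerFamily_taylorFamily
  have hexp := hG.hasGegenbauerExpansion_of_eq_sin_cpow_mul hμ h
    (h.third_mem_Ioo hπ (h.third_ne_zero hlt)) (abs_cos_mul_cos_add_lt hπ hlt) hQ
  simpa using hexp

theorem hasGegenbauerExpansion_ferrersP_neg_order
    (h : IsSphericalTriangle α β γ Θ) (hμ : ∀ k : ℕ, 2 * μ ≠ -k)
    (hπ : α + β < Real.pi) (ν : ℂ) (hΘ : Θ ≠ 0) :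
    HasGegenbauerExpansion μ α β γ (1 / realCpow (Real.sin Θ) μ * ferrersP ν (-μ) (Real.cos Θ))
      (fun n => (-1) ^ n * pochhammerSymbol (ν + μ + 1) n * pochhammerSymbol (μ - ν) n *
        ferrersP ν (-(μ + n)) (Real.cos α) * ferrersP ν (-(μ + n)) (Real.cos β)) := by
  have hG : IsGegenbauerFamily ν μ (1 : ℝ) 2 (regularFamily ν μ) := by
    simpa using isGegenbauerFamily_regularFamily ν μ
  have hexp := hG.hasGegenbauerExpansion_of_eq_sin_cpow_mul hμ h (h.third_mem_Ioo hπ hΘ)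
    (abs_cos_mul_cos_sub_one_add_lt h.right_mem.1 hπ)
    fun n φ hφ => ferrersP_neg_cos_eq_regularFamily ν (ne_neg_natCast_of_two_mul_ne hμ) n hφ
  convert hexp using 2
  · simp [pochhammerSymbol]
  · ring

theorem hasGegenbauerExpansion_ferrersQ_neg_order
    (h : IsSphericalTriangle α β γ Θ) (hμ : ∀ k : ℕ, 2 * μ ≠ -k)
    (hπ : α + β < Real.pi) (hlt : α < β)
    (hdef : ∀ n : ℕ, FerrersQDefined ν (-(μ + n))) :
    HasGegenbauerExpansion μ α β γ (1 / realCpow (Real.sin Θ) μ * ferrersQ ν (-μ) (Real.cos Θ))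
      (fun n => (-1) ^ n * pochhammerSymbol (ν + μ + 1) n * pochhammerSymbol (μ - ν) n *
        ferrersP ν (-(μ + n)) (Real.cos α) * ferrersQ ν (-(μ + n)) (Real.cos β)) := by
  obtain ⟨q, hq, hQ⟩ := exists_taylorFamily_ferrersQ_neg hdef
  have hG : IsGegenbauerFamily ν μ (0 : ℝ) 1 (taylorFamily q) := by
    simpa using hq.isGegenbauerFamily_taylorFamily
  have hexp := hG.hasGegenbauerExpansion_of_eq_sin_cpow_mul hμ h
    (h.third_mem_Ioo hπ (h.third_ne_zero hlt)) (abs_cos_mul_cos_add_lt hπ hlt) hQ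
  convert hexp using 2
  · simp [pochhammerSymbol]
  · ring

theorem hasGegenbauerExpansion_ferrersP_neg_order_neg_cos
    (h : IsSphericalTriangle α β γ Θ) (hμ : ∀ k : ℕ, 2 * μ ≠ -k)
    (hπ : α + β < Real.pi) (ν : ℂ) (hlt : α < β) :
    HasGegenbauerExpansion μ α β γ (1 / realCpow (Real.sin Θ) μ * ferrersP ν (-μ) (-Real.cos Θ))
      (fun n => pochhammerSymbol (ν + μ + 1) n * pochhammerSymbol (μ - ν) n *
        ferrersP ν (-(μ + n)) (Real.cos α) * ferrersP ν (-(μ + n)) (-Real.cos β)) := by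
  have hG : IsGegenbauerFamily ν μ (1 : ℝ) 2 (regularFamily ν μ) := by
    simpa using isGegenbauerFamily_regularFamily ν μ
  have hexp := hG.hasGegenbauerExpansion_pi_sub hμ h
    (h.third_mem_Ioo hπ (h.third_ne_zero hlt))
    (abs_cos_mul_cos_add_one_add_lt h.right_mem.2 hlt)
    fun n φ hφ => ferrersP_neg_cos_eq_regularFamily ν (ne_neg_natCast_of_two_mul_ne hμ) n hφ
  simp only [Real.cos_pi_sub] at hexp
  convert hexp using 2
  · simp [pochhammerSymbol]
  · ring

theorem hasGegenbauerExpansion_ferrersQ_neg_order_neg_cos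
    (h : IsSphericalTriangle α β γ Θ) (hμ : ∀ k : ℕ, 2 * μ ≠ -k)
    (hπ : α + β < Real.pi) (hlt : α < β)
    (hdef : ∀ n : ℕ, FerrersQDefined ν (-(μ + n))) :
    HasGegenbauerExpansion μ α β γ (1 / realCpow (Real.sin Θ) μ * ferrersQ ν (-μ) (-Real.cos Θ))
      (fun n => pochhammerSymbol (ν + μ + 1) n * pochhammerSymbol (μ - ν) n *
        ferrersP ν (-(μ + n)) (Real.cos α) * ferrersQ ν (-(μ + n)) (-Real.cos β)) := by
  obtain ⟨q, hq, hQ⟩ := exists_taylorFamily_ferrersQ_neg hdef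
  have hG : IsGegenbauerFamily ν μ (0 : ℝ) 1 (taylorFamily q) := by
    simpa using hq.isGegenbauerFamily_taylorFamily
  have hexp := hG.hasGegenbauerExpansion_pi_sub hμ h
    (h.third_mem_Ioo hπ (h.third_ne_zero hlt))
    (by simpa only [neg_zero] using abs_cos_mul_cos_add_lt hπ hlt) hQ
  simp only [Real.cos_pi_sub] at hexp
  convert hexp using 2
  · simp [pochhammerSymbol]
  · ring

end IsSphericalTriangle

end AdditionTheorems

theorem two_mul_ne_neg_natCast {μ : ℂ} (hμ : -(1 / 2 : ℝ) < μ.re) (hμ0 : μ ≠ 0) (k : ℕ) :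
    2 * μ ≠ -k := fun hk => by
  have hre : 2 * μ.re = -k := by simpa using congrArg Complex.re hk
  have hk₀ : k = 0 := by
    have hlt : (k : ℝ) < 1 := by linarith
    exact Nat.lt_one_iff.1 (by exact_mod_cast hlt)
  exact hμ0 (by simpa [hk₀] using hk)

theorem mainTheorem1_general (μ ν : ℂ) (hμ : ∀ k : ℕ, 2 * μ ≠ -k) (γ θ θ' Θ : ℝ)
    (hθ : θ ∈ Set.Ioo 0 Real.pi) (hθ' : θ' ∈ Set.Ioo 0 Real.pi)
    (htan : Real.tan (min θ θ' / 2) * Real.tan (max θ θ' / 2) < 1)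
    (hΘ : Θ ∈ Set.Icc 0 Real.pi)
    (hcos : Real.cos Θ =
      Real.cos θ * Real.cos θ' + Real.sin θ * Real.sin θ' * Real.cos γ) :
    (θ ≠ θ' →
      HasGegenbauerExpansion μ θ θ' γ
        (1 / realCpow (Real.sin Θ) μ * ferrersP ν μ (Real.cos Θ))
        (fun n => (-1) ^ n * ferrersP ν (-(μ + n)) (Real.cos (min θ θ')) *
          ferrersP ν (μ + n) (Real.cos (max θ θ')))) ∧
    (θ ≠ θ' → (∀ n : ℕ, FerrersQDefined ν (μ + n)) →
      HasGegenbauerExpansion μ θ θ' γ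
        (1 / realCpow (Real.sin Θ) μ * ferrersQ ν μ (Real.cos Θ))
        (fun n => (-1) ^ n * ferrersP ν (-(μ + n)) (Real.cos (min θ θ')) *
          ferrersQ ν (μ + n) (Real.cos (max θ θ')))) ∧
    (Θ ≠ 0 →
      HasGegenbauerExpansion μ θ θ' γ
        (1 / realCpow (Real.sin Θ) μ * ferrersP ν (-μ) (Real.cos Θ))
        (fun n => (-1) ^ n * pochhammerSymbol (ν + μ + 1) n * pochhammerSymbol (μ - ν) n *
          ferrersP ν (-(μ + n)) (Real.cos θ) *
          ferrersP ν (-(μ + n)) (Real.cos θ'))) ∧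
    (θ ≠ θ' → (∀ n : ℕ, FerrersQDefined ν (-(μ + n))) →
      HasGegenbauerExpansion μ θ θ' γ
        (1 / realCpow (Real.sin Θ) μ * ferrersQ ν (-μ) (Real.cos Θ))
        (fun n => (-1) ^ n * pochhammerSymbol (ν + μ + 1) n * pochhammerSymbol (μ - ν) n *
          ferrersP ν (-(μ + n)) (Real.cos (min θ θ')) *
          ferrersQ ν (-(μ + n)) (Real.cos (max θ θ')))) ∧
    (θ ≠ θ' →
      HasGegenbauerExpansion μ θ θ' γ
        (1 / realCpow (Real.sin Θ) μ * ferrersP ν (-μ) (-Real.cos Θ))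
        (fun n => pochhammerSymbol (ν + μ + 1) n * pochhammerSymbol (μ - ν) n *
          ferrersP ν (-(μ + n)) (Real.cos (min θ θ')) *
          ferrersP ν (-(μ + n)) (-Real.cos (max θ θ')))) ∧
    (θ ≠ θ' → (∀ n : ℕ, FerrersQDefined ν (-(μ + n))) →
      HasGegenbauerExpansion μ θ θ' γ
        (1 / realCpow (Real.sin Θ) μ * ferrersQ ν (-μ) (-Real.cos Θ))
        (fun n => pochhammerSymbol (ν + μ + 1) n * pochhammerSymbol (μ - ν) n *
          ferrersP ν (-(μ + n)) (Real.cos (min θ θ')) *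
          ferrersQ ν (-(μ + n)) (-Real.cos (max θ θ')))) := by
  have htri : IsSphericalTriangle θ θ' γ Θ := ⟨hθ, hθ', hΘ, hcos⟩
  have hord := htri.min_max
  have hπ := add_lt_pi_of_tan_mul_tan_lt_one hord.left_mem hord.right_mem htan
  have hlt (hne : θ ≠ θ') : min θ θ' < max θ θ' := min_lt_max.2 hne
  refine ⟨fun hne => hasGegenbauerExpansion_min_max.1 ?_,
    fun hne hdef => hasGegenbauerExpansion_min_max.1 ?_, fun hΘ₀ => ?_,
    fun hne hdef => hasGegenbauerExpansion_min_max.1 ?_,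
    fun hne => hasGegenbauerExpansion_min_max.1 ?_,
    fun hne hdef => hasGegenbauerExpansion_min_max.1 ?_⟩
  · exact hord.hasGegenbauerExpansion_ferrersP hμ hπ ν (hlt hne)
  · exact hord.hasGegenbauerExpansion_ferrersQ hμ hπ (hlt hne) hdef
  · exact htri.hasGegenbauerExpansion_ferrersP_neg_order hμ (min_add_max θ θ' ▸ hπ) ν hΘ₀
  · exact hord.hasGegenbauerExpansion_ferrersQ_neg_order hμ hπ (hlt hne) hdef
  · exact hord.hasGegenbauerExpansion_ferrersP_neg_order_neg_cos hμ hπ ν (hlt hne)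
  · exact hord.hasGegenbauerExpansion_ferrersQ_neg_order_neg_cos hμ hπ (hlt hne) hdef

theorem mainTheorem1 (μ ν : ℂ) (hμ : -(1 / 2 : ℝ) < μ.re) (hμ0 : μ ≠ 0)
    (hν : ¬ IsNegInt ν) (γ θ θ' Θ : ℝ)
    (hθ : θ ∈ Set.Ioo 0 Real.pi) (hθ' : θ' ∈ Set.Ioo 0 Real.pi)
    (htan : Real.tan (min θ θ' / 2) * Real.tan (max θ θ' / 2) < 1)
    (hΘ : Θ ∈ Set.Icc 0 Real.pi)
    (hcos : Real.cos Θ =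
      Real.cos θ * Real.cos θ' + Real.sin θ * Real.sin θ' * Real.cos γ) :
    (θ ≠ θ' →
      HasGegenbauerExpansion μ θ θ' γ
        (1 / realCpow (Real.sin Θ) μ * ferrersP ν μ (Real.cos Θ))
        (fun n => (-1) ^ n * ferrersP ν (-(μ + n)) (Real.cos (min θ θ')) *
          ferrersP ν (μ + n) (Real.cos (max θ θ')))) ∧
    (θ ≠ θ' → (∀ n : ℕ, FerrersQDefined ν (μ + n)) →
      HasGegenbauerExpansion μ θ θ' γ
        (1 / realCpow (Real.sin Θ) μ * ferrersQ ν μ (Real.cos Θ))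
        (fun n => (-1) ^ n * ferrersP ν (-(μ + n)) (Real.cos (min θ θ')) *
          ferrersQ ν (μ + n) (Real.cos (max θ θ')))) ∧
    (Θ ≠ 0 →
      HasGegenbauerExpansion μ θ θ' γ
        (1 / realCpow (Real.sin Θ) μ * ferrersP ν (-μ) (Real.cos Θ))
        (fun n => (-1) ^ n * pochhammerSymbol (ν + μ + 1) n * pochhammerSymbol (μ - ν) n *
          ferrersP ν (-(μ + n)) (Real.cos θ) *
          ferrersP ν (-(μ + n)) (Real.cos θ'))) ∧
    (θ ≠ θ' → (∀ n : ℕ, FerrersQDefined ν (-(μ + n))) →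
      HasGegenbauerExpansion μ θ θ' γ
        (1 / realCpow (Real.sin Θ) μ * ferrersQ ν (-μ) (Real.cos Θ))
        (fun n => (-1) ^ n * pochhammerSymbol (ν + μ + 1) n * pochhammerSymbol (μ - ν) n *
          ferrersP ν (-(μ + n)) (Real.cos (min θ θ')) *
          ferrersQ ν (-(μ + n)) (Real.cos (max θ θ')))) ∧
    (θ ≠ θ' →
      HasGegenbauerExpansion μ θ θ' γ
        (1 / realCpow (Real.sin Θ) μ * ferrersP ν (-μ) (-Real.cos Θ))
        (fun n => pochhammerSymbol (ν + μ + 1) n * pochhammerSymbol (μ - ν) n *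
          ferrersP ν (-(μ + n)) (Real.cos (min θ θ')) *
          ferrersP ν (-(μ + n)) (-Real.cos (max θ θ')))) ∧
    (θ ≠ θ' → (∀ n : ℕ, FerrersQDefined ν (-(μ + n))) →
      HasGegenbauerExpansion μ θ θ' γ
        (1 / realCpow (Real.sin Θ) μ * ferrersQ ν (-μ) (-Real.cos Θ))
        (fun n => pochhammerSymbol (ν + μ + 1) n * pochhammerSymbol (μ - ν) n *
          ferrersP ν (-(μ + n)) (Real.cos (min θ θ')) *
          ferrersQ ν (-(μ + n)) (-Real.cos (max θ θ')))) :=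
  mainTheorem1_general μ ν (two_mul_ne_neg_natCast hμ hμ0) γ θ θ' Θ hθ hθ' htan hΘ hcos
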